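/- Let $n\ge 2$, write $\langle\xi\rangle=(1+|\xi|^2)^{1/2}$ and $\hat f(\xi)=\int_{\mathbb R^n}e^{-ix\cdot\xi}f(x)\,dx$. **Symbol classes.** For $r=l+s>0$ with $l\in\mathbb Z_{\ge0}$ and $s\in(0,1]$, let $C^r_-(\mathbb R^n)$ be the space of $C^l$ functions $f:\mathbb R^n\to\mathbb C$ with $$\|f\|_{C^r_-}=\max_{|\alpha|\le l}\sup_x|\partial^\alpha f(x)|+\max_{|\alpha|=l}\sup_{x\ne y}\frac{|\partial^\alpha f(x)-\partial^\alpha f(y)|}{|x-y|^s}<\infty ;$$ in particular $C^2_-=C^{1,1}$. For $m\in\mathbb R$ and $\delta\in[0,1]$: * $S^m_{1,\delta}$ is the class of $a\in C^\infty(\mathbb R^{2n})$ such that for all multi-indices $\alpha,\beta$ one has $|\partial_\xi^\alpha\partial_x^\beta a(x,\xi)|\le C_{\alpha,\beta}\langle\xi\rangle^{m-|\alpha|+|\beta|\delta}$ for all $x,\xi$. * $C^r_-S^m_{1,\delta}$ is the class of $a:\mathbb R^{2n}\to\mathbb C$ such that each $a(x,\cdot)$ is $C^\infty$ and for every multi-index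 $\alpha$ there is $C_\alpha$ such that for all $x,\xi$: $|\partial_\xi^\alpha a(x,\xi)|\le C_\alpha\langle\xi\rangle^{m-|\alpha|}$, $\|\partial_\xi^\alpha a(\cdot,\xi)\|_{C^r_-}\le C_\alpha\langle\xi\rangle^{m-|\alpha|+r\delta}$, and $\|\partial_\xi^\alpha a(\cdot,\xi)\|_{C^j_-}\le C_\alpha\langle\xi\rangle^{m-|\alpha|+j\delta}$ for all integers $1\le j\le r$. We write $C^{1,1}S^m_{1,\delta}$ for $C^2_-S^m_{1,\delta}$. * $\mathcal A^rS^m_{1,\delta}$ is the class of $a\in S^m_{1,\delta}$ such that for all $\alpha$ and all real $s\ge0$ one has $\|\partial_\xi^\alpha a(\cdot,\xi)\|_{C^{r+s}_-}\le C_{\alpha,s}\langle\xi\rangle^{m-|\alpha|+\delta s}$ for all $\xi$. A symbol $a$ of order $m$ is *elliptic* if there are $\kappa,R>0$ with $|a(x,\xi)|>\kappa|\xi|^m$ whenever $|\xi|\ge R$. It is *homogeneous of degree $m$ for $|\xi|\ge1$* if $a(x,\lambda\xi)=\lambda^ma(x,\xi)$ for all $x$, all $|\xi|\ge1$ and all $\lambda\ge1$.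 A symbol $b\in S^m_{1,\delta}$ is *asymptotically homogeneous of degree $m$ with limit $a$*, where $a\in C^{1,1}S^m_{1,0}$ is homogeneous of degree $m$ for $|\xi|\ge1$, if $(\xi\cdot\partial_\xi-m)b\in S^{m-1}_{1,\delta}$ and $a-b\in C^{1,1}S^{m-1}_{1,\delta}$. **Operators and smoothing.** For a symbol $a$ and $f\in\mathcal S(\mathbb R^n)$ put $a(x,D)f(x)=(2\pi)^{-n}\int e^{ix\cdot\xi}a(x,\xi)\hat f(\xi)\,d\xi$. Fix a real-valued radial $\varphi\in C_c^\infty(\mathbb R^n)$ with $\varphi=1$ near $0$ and $\varphi(\zeta)=0$ for $|\zeta|\ge1$, and real-valued functions $\psi_j\in C_c^\infty(\mathbb R^n)$, $j\ge0$, with $\sum_j\psi_j=1$, $\psi_0(\xi)=0$ for $|\xi|>1$, $\psi_1(\xi)=0$ for $|\xi|\notin[\frac12,2]$ and $\psi_j(\xi)=\psi_1(2^{-j+1}\xi)$ for $j>1$. For $a\in C^{1,1}S^m_{1,0}$ put $$a^\sharp(x,\xi)=\sum_{k=0}^\infty\big(\varphi(2^{-k/2}D)a(\cdot,\xi)\big)(x)\,\psi_k(\xi),$$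 where $\varphi(2^{-k/2}D)$ is the Fourier multiplier with symbol $\eta\mapsto\varphi(2^{-k/2}\eta)$, i.e. convolution with the inverse Fourier transform of that function. **Proposition 4.5.** Let $A\in C^{1,1}S^2_{1,0}$ be non-negative, elliptic and homogeneous of degree $2$ for $|\xi|\ge1$. Then there exist a real-valued elliptic $b\in\mathcal A^2S^1_{1,1/2}$ and an $e\in S^1_{1,1/2}$ such that: 1. $A^\sharp(x,D)=b(x,D)^2+e(x,D)$ as operators on $\mathcal S(\mathbb R^n)$, where $b(x,D)$ maps $\mathcal S(\mathbb R^n)$ into itself; 2. $b$ is asymptotically homogeneous of degree $1$ with a real-valued limit $a\in C^{1,1}S^1_{1,0}$ such that $a(x,\xi)=\sqrt{A(x,\xi)}$ for all $x,\xi\in\mathbb R^n$ with $|\xi|\ge1$. -/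

import Mathlib

open scoped ContDiff SchwartzMap

noncomputable section

namespace PsiDO

/-- Euclidean space `ℝⁿ`. -/
abbrev Rn (n : ℕ) : Type := EuclideanSpace ℝ (Fin n)

variable {n : ℕ}

/-- The Japanese bracket `⟨ξ⟩ = (1 + |ξ|²)^{1/2}`. -/
def bracket (ξ : Rn n) : ℝ := Real.sqrt (1 + ‖ξ‖ ^ 2)

/-- The partial derivative `∂ᵢ f`. -/
def pderiv (i : Fin n) (f : Rn n → ℂ) : Rn n → ℂ :=
  fun x => fderiv ℝ f x (EuclideanSpace.single i 1)

/-- The iterated partial derivative `∂_{i₁} ⋯ ∂_{iₖ} f` for the word `w = [i₁, …, iₖ]`.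
For `f` of class `Cᵏ` the order of the letters is irrelevant, so that these functions are exactly
the derivatives `∂^α f` with multi-indices `|α| = k = w.length`. -/
def pderivs (w : List (Fin n)) (f : Rn n → ℂ) : Rn n → ℂ := w.foldr pderiv f

/-- `∂_x^w a`. -/
def dx (w : List (Fin n)) (a : Rn n → Rn n → ℂ) : Rn n → Rn n → ℂ :=
  fun x ξ => pderivs w (fun y => a y ξ) x

/-- `∂_ξ^w a`. -/
def dxi (w : List (Fin n)) (a : Rn n → Rn n → ℂ) : Rn n → Rn n → ℂ :=
  fun x ξ => pderivs w (a x) ξ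

/-- For `r > 0`: the `l ∈ ℤ₊` in the decomposition `r = l + s` with `s ∈ (0, 1]`. -/
def intPart (r : ℝ) : ℕ := ⌈r⌉₊ - 1

/-- For `r > 0`: the `s ∈ (0, 1]` in the decomposition `r = l + s` with `l ∈ ℤ₊`. -/
def holderPart (r : ℝ) : ℝ := r - intPart r

/-- For `r > 0`: `f ∈ C^r_-(ℝⁿ)` and `‖f‖_{C^r_-} ≤ M`. Here, for `r = l + s` with `l ∈ ℤ₊` and
`s ∈ (0, 1]`, the space `C^r_-(ℝⁿ)` consists of the `Cˡ` functions with bounded derivatives up to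
order `l` whose derivatives of order `l` are `s`-Hölder, and the norm is the largest of the
supremum norms of these derivatives (bounded by `M₀`) plus the largest of the Hölder seminorms of
the derivatives of order `l` (bounded by `M₁`). For `r = 2` this is `C^{1,1}(ℝⁿ)`. -/
def CrNormLE (r : ℝ) (f : Rn n → ℂ) (M : ℝ) : Prop :=
  ContDiff ℝ (intPart r) f ∧ ∃ M₀ M₁ : ℝ, 0 ≤ M₀ ∧ 0 ≤ M₁ ∧ M₀ + M₁ ≤ M ∧
    (∀ w : List (Fin n), w.length ≤ intPart r → ∀ x, ‖pderivs w f x‖ ≤ M₀) ∧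
    (∀ w : List (Fin n), w.length = intPart r → ∀ x y,
      ‖pderivs w f x - pderivs w f y‖ ≤ M₁ * ‖x - y‖ ^ holderPart r)

/-- The symbol class `S^m_{1,δ}`. -/
def IsSymbol (m δ : ℝ) (a : Rn n → Rn n → ℂ) : Prop :=
  ContDiff ℝ ∞ (Function.uncurry a) ∧
    ∀ α β : List (Fin n), ∃ C : ℝ, 0 ≤ C ∧ ∀ x ξ : Rn n,
      ‖dxi α (dx β a) x ξ‖ ≤ C * bracket ξ ^ (m - α.length + β.length * δ)

/-- The rough symbol class `C^r_- S^m_{1,δ}`. The bounds in `C^j_-` are for integers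
`1 ≤ j ≤ r`; the one for `j = 0` is the pointwise bound. -/
def IsRoughSymbol (r m δ : ℝ) (a : Rn n → Rn n → ℂ) : Prop :=
  (∀ x, ContDiff ℝ ∞ (a x)) ∧
    ∀ α : List (Fin n), ∃ C : ℝ, 0 ≤ C ∧
      (∀ x ξ, ‖dxi α a x ξ‖ ≤ C * bracket ξ ^ (m - α.length)) ∧
      (∀ ξ, CrNormLE r (fun x => dxi α a x ξ) (C * bracket ξ ^ (m - α.length + r * δ))) ∧
      (∀ j : ℕ, 1 ≤ j → (j : ℝ) ≤ r → ∀ ξ,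
        CrNormLE j (fun x => dxi α a x ξ) (C * bracket ξ ^ (m - α.length + j * δ)))

/-- The class `𝒜^r S^m_{1,δ}`. -/
def IsASymbol (r m δ : ℝ) (a : Rn n → Rn n → ℂ) : Prop :=
  IsSymbol m δ a ∧
    ∀ (α : List (Fin n)) (s : ℝ), 0 ≤ s → ∃ C : ℝ, 0 ≤ C ∧ ∀ ξ,
      CrNormLE (r + s) (fun x => dxi α a x ξ) (C * bracket ξ ^ (m - α.length + δ * s))

/-- A symbol of order `m` is elliptic if `|a(x,ξ)| > κ|ξ|^m` for `|ξ| ≥ R`, with some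
`κ, R > 0`. -/
def IsElliptic (m : ℝ) (a : Rn n → Rn n → ℂ) : Prop :=
  ∃ κ R : ℝ, 0 < κ ∧ 0 < R ∧ ∀ x ξ : Rn n, R ≤ ‖ξ‖ → κ * ‖ξ‖ ^ m < ‖a x ξ‖

/-- Homogeneity of degree `m` for `|ξ| ≥ 1`. -/
def IsHomogeneous (m : ℝ) (a : Rn n → Rn n → ℂ) : Prop :=
  ∀ (x ξ : Rn n) (t : ℝ), 1 ≤ t → 1 ≤ ‖ξ‖ → a x (t • ξ) = ((t ^ m : ℝ) : ℂ) * a x ξ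

/-- `b ∈ S^m_{1,δ}` is asymptotically homogeneous of degree `m` with limit
`a ∈ C^r_- S^m_{1,0}`. -/
def IsAsympHomogeneous (r m δ : ℝ) (b a : Rn n → Rn n → ℂ) : Prop :=
  IsSymbol m δ b ∧ IsRoughSymbol r m 0 a ∧ IsHomogeneous m a ∧
    IsSymbol (m - 1) δ (fun x ξ => fderiv ℝ (b x) ξ ξ - (m : ℂ) * b x ξ) ∧
    IsRoughSymbol r (m - 1) δ (fun x ξ => a x ξ - b x ξ)

/-- The Fourier transform `f̂(ξ) = ∫ e^{-i x·ξ} f(x) dx`. -/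
def hat (f : Rn n → ℂ) (ξ : Rn n) : ℂ :=
  ∫ x, Complex.exp (-(Complex.I * (inner ℝ x ξ : ℝ))) * f x

/-- The inverse Fourier transform `(2π)^{-n} ∫ e^{i x·ξ} g(ξ) dξ`. -/
def invHat (g : Rn n → ℂ) (x : Rn n) : ℂ :=
  (((2 * Real.pi) ^ n : ℝ) : ℂ)⁻¹ * ∫ ξ, Complex.exp (Complex.I * (inner ℝ x ξ : ℝ)) * g ξ

/-- The pseudodifferential operator
`a(x,D)f(x) = (2π)^{-n} ∫ e^{i x·ξ} a(x,ξ) f̂(ξ) dξ` on Schwartz functions. -/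
def op (a : Rn n → Rn n → ℂ) (f : 𝓢(Rn n, ℂ)) : Rn n → ℂ :=
  fun x => invHat (fun ξ => a x ξ * hat f ξ) x

/-- The Fourier multiplier `g(D)` with symbol `g ∈ C_c^∞(ℝⁿ)`, acting on a bounded continuous
function `f` (not on Schwartz functions only) by convolution with the Schwartz function
`ℱ⁻¹g`. -/
def fourierMultiplier (g f : Rn n → ℂ) : Rn n → ℂ :=
  fun x => ∫ y, invHat g (x - y) * f y

/-- The low-frequency cut-offs `φ`: smooth, real-valued, radial, equal to `1` near zero, and zero
for `|ζ| ≥ 1`. -/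
structure IsCutoff (φ : Rn n → ℝ) : Prop where
  smooth : ContDiff ℝ ∞ φ
  radial : ∀ ζ η : Rn n, ‖ζ‖ = ‖η‖ → φ ζ = φ η
  near_zero : ∀ᶠ ζ in nhds (0 : Rn n), φ ζ = 1
  support : ∀ ζ : Rn n, 1 ≤ ‖ζ‖ → φ ζ = 0

/-- Littlewood--Paley decompositions `(ψ_j)_{j ≥ 0}`. -/
structure IsLittlewoodPaley (ψ : ℕ → Rn n → ℝ) : Prop where
  smooth : ∀ j, ContDiff ℝ ∞ (ψ j)
  hasSum_one : ∀ ξ, HasSum (fun j => ψ j ξ) 1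
  support_zero : ∀ ξ, 1 < ‖ξ‖ → ψ 0 ξ = 0
  support_one : ∀ ξ, ‖ξ‖ ∉ Set.Icc (1 / 2 : ℝ) 2 → ψ 1 ξ = 0
  scaling : ∀ j : ℕ, 1 < j → ∀ ξ, ψ j ξ = ψ 1 (((2 : ℝ) ^ (1 - (j : ℤ))) • ξ)

/-- The smoothed symbol
`a^♯(x,ξ) = ∑_{k ≥ 0} (φ(2^{-k/2}D) a(·,ξ))(x) ψ_k(ξ)`; the sum is locally finite. -/
def sharp (φ : Rn n → ℝ) (ψ : ℕ → Rn n → ℝ) (a : Rn n → Rn n → ℂ) : Rn n → Rn n → ℂ :=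
  fun x ξ => ∑' k : ℕ,
    fourierMultiplier (fun η => (φ (((2 : ℝ) ^ (-(k : ℝ) / 2)) • η) : ℂ)) (fun y => a y ξ) x
      * (ψ k ξ : ℂ)

end PsiDO

end

open scoped ContDiff SchwartzMap

noncomputable section

namespace PsiDO

variable {n : ℕ}

/-! The natural candidate is `b = a^♯` with `a = √A`. One then has to see that squaring the operator
`a^♯(x,D)` agrees with smoothing the symbol `a²` up to an operator of order 1.

The root. For small `ξ` the symbol `A` may vanish, so a bump supported in the unit ball is added.
Then `A + bump ≥ c⟨ξ⟩²`: for `|ξ| ≥ 1` by ellipticity and homogeneity, just inside the unit sphere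
by Lipschitz continuity in `ξ`, further inside by positivity of the bump. Hence `a = √(A + bump)`
lies in `C^{1,1}S^1_{1,0}`, is bounded below by a multiple of `⟨ξ⟩`, and equals `√A` for `|ξ| ≥ 1`
(`exists_sqrt_symbol`).

The smoothing. Where `⟨ξ⟩` is comparable to `λ = 2^k`, the symbol is convolved in `x` with a kernel
of width `1/h`, `h = λ^{1/2}`. Since `φ = 1` near 0, this kernel has integral one and vanishing
first moments, so Taylor's formula for `C^{1,1}` functions shows that `∂_x^β u^♯` is within
`O(h^{|β|-2})`, times the order of `u`, of `∂_x^β u` if `|β| ≤ 1` and of zero if `|β| ≥ 2`. This one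
estimate (`norm_opS_smAmp_sub_le`) gives membership in `𝒜²S^1_{1,1/2}`, ellipticity of `b`, the
order of `a - b`, and, together with Euler's identity, asymptotic homogeneity.

The square. The smoothed symbol has `x`-frequencies `|η| ≤ h` only, so the composition formula is
exact: `b(x,D)²` has the symbol `∑_k (2π)^{-n} ∬ e^{i(x-y)·η} φ(η/h) ψ_k(ξ) a(y,ξ) b(x,ξ+η) dη dy`
(`op_sharp_op_sharp`). The smoothing of `a²` has the same form with `a(y,ξ)²` in place of `a(y,ξ)
b(x,ξ+η)`. The difference of the two is given by the amplitude `φ(η/h) ψ_k(ξ) (a(y,ξ) - b(x,ξ))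
(a(y,ξ) - b(x,ξ+η))`, because the additional terms `-b(x,ξ)(a(y,ξ) - b(x,ξ+η))` integrate and sum to
`-b(b - b) = 0` (`opT_errAmp`, `sharp_sub_eq`). Each of the two factors is `O(λ^{1/2}(1 + h|x-y|))`:
moving `y` to `x` costs `λ|x-y| = λ^{1/2}·h|x-y|`, replacing `a` by `b` costs `O(1)`, and shifting
`ξ` by `|η| ≤ h` costs `O(h)` (`ampBdd_diffAmp`). The error therefore has order 1. Subtracting the
bump, which depends on `ξ` alone and is unchanged by smoothing, gives `e`.

Amplitudes. The rough function `a(y,ξ)` is never differentiated in `y`; decay in `x - y` comes from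
integration by parts in `η`. A derivative in `x` falls on the amplitude or produces `iη`, and costs
`λ^{1/2}` in both cases. So families of amplitudes are closed under differentiation with exactly the
orders of `S^m_{1,1/2}`, and they define symbols (`IsAmp.isSymbol_opS`). -/

open MeasureTheory

/-! ### Iterated directional derivatives indexed by words. -/

section Words

variable {E E' : Type*} [NormedAddCommGroup E] [NormedSpace ℝ E]
  [NormedAddCommGroup E'] [NormedSpace ℝ E'] {ι κ : Type*}

/-- The iterated directional derivative `∂_{v i₁} ⋯ ∂_{v iₖ} f` for the word `w = [i₁, …, iₖ]`. -/
def wderiv (v : ι → E) (w : List ι) (f : E → ℂ) : E → ℂ :=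
  w.foldr (fun i g x => fderiv ℝ g x (v i)) f

@[simp] lemma wderiv_nil (v : ι → E) (f : E → ℂ) : wderiv v [] f = f := rfl

lemma wderiv_cons (v : ι → E) (i : ι) (w : List ι) (f : E → ℂ) :
    wderiv v (i :: w) f = fun x => fderiv ℝ (wderiv v w f) x (v i) := rfl

lemma wderiv_append (v : ι → E) (w w' : List ι) (f : E → ℂ) :
    wderiv v (w ++ w') f = wderiv v w (wderiv v w' f) := by
  simp [wderiv, List.foldr_append]

lemma contDiff_wderiv {v : ι → E} {f : E → ℂ} (hf : ContDiff ℝ ∞ f) (w : List ι) :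
    ContDiff ℝ ∞ (wderiv v w f) := by
  induction w with
  | nil => exact hf
  | cons i w ih =>
    rw [wderiv_cons]
    exact (ih.fderiv_right (m := ∞) (by simp)).clm_apply contDiff_const

lemma differentiable_of_smooth {F : Type*} [NormedAddCommGroup F] [NormedSpace ℝ F] {f : E → F}
    (hf : ContDiff ℝ ∞ f) : Differentiable ℝ f :=
  hf.differentiable (by simp)

lemma wderiv_eventuallyEq {v : ι → E} {f g : E → ℂ} {x : E} (h : f =ᶠ[nhds x] g) (w : List ι) :
    wderiv v w f =ᶠ[nhds x] wderiv v w g := by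
  induction w with
  | nil => exact h
  | cons i w ih =>
    filter_upwards [ih.eventuallyEq_nhds] with y hy
    simp only [wderiv_cons, hy.fderiv_eq]

lemma wderiv_const (v : ι → E) {w : List ι} (hw : w ≠ []) (c : ℂ) :
    wderiv v w (fun _ => c) = fun _ => 0 := by
  induction w with
  | nil => exact absurd rfl hw
  | cons i w ih =>
    rw [wderiv_cons]
    rcases eq_or_ne w [] with rfl | h
    · simp
    · rw [ih h]; simp

lemma wderiv_zero (v : ι → E) (w : List ι) : wderiv v w (fun _ => 0) = fun _ => 0 := by
  rcases eq_or_ne w [] with rfl | h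
  · rfl
  · exact wderiv_const v h 0

/-- The derivatives of a function vanishing off a closed set vanish off that set. -/
lemma wderiv_eq_zero_of_isClosed {v : ι → E} {f : E → ℂ} {S : Set E} (hS : IsClosed S)
    (h : ∀ x, x ∉ S → f x = 0) (w : List ι) {x : E} (hx : x ∉ S) : wderiv v w f x = 0 := by
  have h1 : f =ᶠ[nhds x] fun _ => 0 := by
    filter_upwards [hS.isOpen_compl.mem_nhds hx] with y hy using h y hy
  have := (wderiv_eventuallyEq (v := v) h1 w).eq_of_nhds
  rw [this, wderiv_zero]

lemma wderiv_add {v : ι → E} {f g : E → ℂ} (hf : ContDiff ℝ ∞ f) (hg : ContDiff ℝ ∞ g)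
    (w : List ι) :
    wderiv v w (fun x => f x + g x) = fun x => wderiv v w f x + wderiv v w g x := by
  induction w with
  | nil => rfl
  | cons i w ih =>
    funext x
    rw [wderiv_cons, ih]
    dsimp only
    rw [fderiv_fun_add (differentiable_of_smooth (contDiff_wderiv hf w) x)
      (differentiable_of_smooth (contDiff_wderiv hg w) x)]
    rfl

lemma wderiv_const_mul {v : ι → E} {f : E → ℂ} (hf : ContDiff ℝ ∞ f) (c : ℂ) (w : List ι) :
    wderiv v w (fun x => c * f x) = fun x => c * wderiv v w f x := by
  induction w with
  | nil => rfl
  | cons i w ih =>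
    funext x
    rw [wderiv_cons, ih]
    dsimp only
    rw [fderiv_const_mul (differentiable_of_smooth (contDiff_wderiv hf w) x)]
    rfl

lemma wderiv_sub {v : ι → E} {f g : E → ℂ} (hf : ContDiff ℝ ∞ f) (hg : ContDiff ℝ ∞ g)
    (w : List ι) :
    wderiv v w (fun x => f x - g x) = fun x => wderiv v w f x - wderiv v w g x := by
  have h := wderiv_add (v := v) hf (contDiff_const.mul hg : ContDiff ℝ ∞ fun x => (-1 : ℂ) * g x) w
  rw [wderiv_const_mul hg] at h
  simpa [sub_eq_add_neg] using h

lemma wderiv_sum {v : ι → E} {J : Type*} (s : Finset J) {f : J → E → ℂ}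
    (hf : ∀ j ∈ s, ContDiff ℝ ∞ (f j)) (w : List ι) :
    wderiv v w (fun x => ∑ j ∈ s, f j x) = fun x => ∑ j ∈ s, wderiv v w (f j) x := by
  classical
  induction s using Finset.induction_on with
  | empty => simpa using wderiv_zero v w
  | insert j s hj ih =>
    simp only [Finset.sum_insert hj]
    rw [wderiv_add (hf j (by simp)) (ContDiff.sum fun i hi => hf i (by simp [hi])),
      ih fun i hi => hf i (by simp [hi])]

/-- The ways of distributing the letters of a word over two words. -/
def splits : List ι → List (List ι × List ι)
  | [] => [([], [])]
  | i :: w => (splits w).map (fun p => (i :: p.1, p.2)) ++ (splits w).map (fun p => (p.1, i :: p.2))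

lemma perm_of_mem_splits {w : List ι} {p : List ι × List ι} (hp : p ∈ splits w) :
    (p.1 ++ p.2).Perm w := by
  induction w generalizing p with
  | nil => simp [splits] at hp; simp [hp]
  | cons i w ih =>
    simp only [splits, List.mem_append, List.mem_map] at hp
    rcases hp with ⟨q, hq, rfl⟩ | ⟨q, hq, rfl⟩
    · exact (ih hq).cons i
    · exact List.perm_middle.trans ((ih hq).cons i)

lemma length_of_mem_splits {w : List ι} {p : List ι × List ι} (hp : p ∈ splits w) :
    p.1.length + p.2.length = w.length := by
  simpa using (perm_of_mem_splits hp).length_eq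

/-- The Leibniz rule. -/
lemma wderiv_mul {v : ι → E} {f g : E → ℂ} (hf : ContDiff ℝ ∞ f) (hg : ContDiff ℝ ∞ g)
    (w : List ι) :
    wderiv v w (fun x => f x * g x) =
      fun x => ((splits w).map fun p => wderiv v p.1 f x * wderiv v p.2 g x).sum := by
  induction w with
  | nil => simp [splits]
  | cons i w ih =>
    funext x
    rw [wderiv_cons, ih]
    dsimp only
    have key : ∀ L : List (List ι × List ι),
        DifferentiableAt ℝ (fun x => (L.map fun p => wderiv v p.1 f x * wderiv v p.2 g x).sum) x ∧
        fderiv ℝ (fun x => (L.map fun p => wderiv v p.1 f x * wderiv v p.2 g x).sum) x (v i) =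
          (L.map fun p => wderiv v (i :: p.1) f x * wderiv v p.2 g x).sum +
          (L.map fun p => wderiv v p.1 f x * wderiv v (i :: p.2) g x).sum := by
      intro L
      induction L with
      | nil => simp
      | cons p L ihL =>
        have h1 := differentiable_of_smooth (contDiff_wderiv (v := v) hf p.1) x
        have h2 := differentiable_of_smooth (contDiff_wderiv (v := v) hg p.2) x
        simp only [List.map_cons, List.sum_cons]
        refine ⟨(h1.fun_mul h2).fun_add ihL.1, ?_⟩
        rw [fderiv_fun_add (h1.fun_mul h2) ihL.1, fderiv_fun_mul h1 h2]
        simp only [add_apply, ihL.2, wderiv_cons,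
          smul_apply, smul_eq_mul]
        ring
    rw [(key _).2]
    simp [splits, Function.comp_def]

lemma wderiv_swap {v : ι → E} {f : E → ℂ} (hf : ContDiff ℝ ∞ f) (i j : ι) :
    wderiv v [i, j] f = wderiv v [j, i] f := by
  funext x
  have hd : DifferentiableAt ℝ (fderiv ℝ f) x :=
    differentiable_of_smooth (hf.fderiv_right (m := ∞) (by simp)) x
  have key : ∀ i j, wderiv v [i, j] f x = fderiv ℝ (fderiv ℝ f) x (v i) (v j) := by
    intro i j
    simp only [wderiv_cons, wderiv_nil]
    rw [fderiv_clm_apply hd (differentiableAt_const _)]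
    simp
  rw [key, key]
  have := (hf.contDiffAt (x := x)).isSymmSndFDerivAt (by simpa using ENat.LEInfty.out)
  exact this _ _

/-- The order of the letters is irrelevant. -/
lemma wderiv_perm {v : ι → E} {f : E → ℂ} (hf : ContDiff ℝ ∞ f) {w w' : List ι} (h : w.Perm w') :
    wderiv v w f = wderiv v w' f := by
  induction h with
  | nil => rfl
  | cons i _ ih => simp only [wderiv_cons, ih]
  | swap i j w => exact wderiv_swap (contDiff_wderiv hf w) j i
  | trans _ _ ih₁ ih₂ => rw [ih₁, ih₂]

lemma wderiv_comp_affine {v : ι → E} {f : E' → ℂ} (hf : ContDiff ℝ ∞ f) (A : E →L[ℝ] E') (c : E')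
    (w : List ι) :
    wderiv v w (fun x => f (A x + c)) = fun x => wderiv (fun i => A (v i)) w f (A x + c) := by
  induction w with
  | nil => rfl
  | cons i w ih =>
    funext x
    rw [wderiv_cons, ih]
    have h1 : HasFDerivAt (fun x => A x + c) A x := A.hasFDerivAt.add_const c
    have h2 := (differentiable_of_smooth
      (contDiff_wderiv (v := fun i => A (v i)) hf w) (A x + c)).hasFDerivAt
    have h3 : HasFDerivAt (fun x => wderiv (fun i => A (v i)) w f (A x + c)) _ x := h2.comp x h1
    rw [wderiv_cons]
    dsimp only
    rw [h3.fderiv]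
    rfl

lemma wderiv_comp_linear {v : ι → E} {f : E' → ℂ} (hf : ContDiff ℝ ∞ f) (A : E →L[ℝ] E')
    (w : List ι) :
    wderiv v w (fun x => f (A x)) = fun x => wderiv (fun i => A (v i)) w f (A x) := by
  simpa using wderiv_comp_affine (v := v) hf A 0 w

/-- Directions that are multiples of other directions. -/
lemma wderiv_smul_dir {v' : κ → E} {f : E → ℂ} (hf : ContDiff ℝ ∞ f) (s : ι → ℝ) (π : ι → κ)
    (w : List ι) :
    wderiv (fun i => s i • v' (π i)) w f =
      fun x => (((w.map s).prod : ℝ) : ℂ) * wderiv v' (w.map π) f x := by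
  induction w with
  | nil => simp
  | cons i w ih =>
    funext x
    rw [wderiv_cons, ih]
    dsimp only
    rw [fderiv_const_mul (differentiable_of_smooth (contDiff_wderiv hf _) x)]
    simp [wderiv_cons]
    ring

end Words

/-! ### Uniform weighted bounds for all derivatives of a family. -/

section WeightedBounds

variable {E : Type*} [NormedAddCommGroup E] [NormedSpace ℝ E] {ι P : Type*}

/-- The total weight of a word. -/
def wordWt (wt : ι → ℝ) (w : List ι) : ℝ := (w.map wt).sum

@[simp] lemma wordWt_nil (wt : ι → ℝ) : wordWt wt [] = 0 := rfl

@[simp] lemma wordWt_cons (wt : ι → ℝ) (i : ι) (w : List ι) :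
    wordWt wt (i :: w) = wt i + wordWt wt w := by simp [wordWt]

@[simp] lemma wordWt_append (wt : ι → ℝ) (w w' : List ι) :
    wordWt wt (w ++ w') = wordWt wt w + wordWt wt w' := by simp [wordWt]

lemma wordWt_perm (wt : ι → ℝ) {w w' : List ι} (h : w.Perm w') : wordWt wt w = wordWt wt w' :=
  (h.map wt).sum_eq

/-- Uniform weighted bounds for all the derivatives of a family of functions: the derivative along
the word `w` is at most a constant times `base ^ (m + wt w) * q ^ M` on the sets `Ω p`. -/
def WBdd (v : ι → E) (wt : ι → ℝ) (Ω : P → Set E) (base q : P → E → ℝ) (m : ℝ) (M : ℕ)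
    (f : P → E → ℂ) : Prop :=
  ∀ w : List ι, ∃ C : ℝ, 0 ≤ C ∧ ∀ p, ∀ x ∈ Ω p,
    ‖wderiv v w (f p) x‖ ≤ C * base p x ^ (m + wordWt wt w) * q p x ^ M

variable {v : ι → E} {wt : ι → ℝ} {Ω : P → Set E} {base q : P → E → ℝ} {m m' : ℝ} {M M' : ℕ}
  {f g : P → E → ℂ}

/-- In the Leibniz rule the two halves of a split have total weight `wordWt wt w`, so every term
carries the same power of `base`. The constant is a finite sum over splits and stays uniform in the
parameter. -/
lemma WBdd.mul (hb : ∀ p x, 0 < base p x) (hq : ∀ p x, 1 ≤ q p x)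
    (hfs : ∀ p, ContDiff ℝ ∞ (f p)) (hgs : ∀ p, ContDiff ℝ ∞ (g p))
    (hf : WBdd v wt Ω base q m M f) (hg : WBdd v wt Ω base q m' M' g) :
    WBdd v wt Ω base q (m + m') (M + M') (fun p x => f p x * g p x) := by
  intro w
  choose Cf hCf hf using hf
  choose Cg hCg hg using hg
  refine ⟨((splits w).map fun s => Cf s.1 * Cg s.2).sum, ?_, ?_⟩
  · refine List.sum_nonneg ?_
    simp only [List.mem_map, forall_exists_index, and_imp]
    rintro _ s _ rfl
    exact mul_nonneg (hCf _) (hCg _)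
  · intro p x hx
    rw [wderiv_mul (hfs p) (hgs p)]
    have hmem : ∀ s ∈ splits w, wordWt wt s.1 + wordWt wt s.2 = wordWt wt w := fun s hs => by
      rw [← wordWt_append, wordWt_perm wt (perm_of_mem_splits hs)]
    have hbp := hb p x
    have hqp := (zero_le_one.trans (hq p x))
    -- From here only the weight identity for the members of the list matters, which permits
    -- induction on an arbitrary list.
    generalize splits w = L at hmem
    induction L with
    | nil => simp
    | cons s L ih =>
      simp only [List.map_cons, List.sum_cons]
      rw [add_mul, add_mul]
      refine (norm_add_le _ _).trans (add_le_add ?_ (ih fun t ht => hmem t (by simp [ht])))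
      rw [norm_mul]
      calc _ ≤ (Cf s.1 * base p x ^ (m + wordWt wt s.1) * q p x ^ M) *
            (Cg s.2 * base p x ^ (m' + wordWt wt s.2) * q p x ^ M') :=
            mul_le_mul (hf _ _ _ hx) (hg _ _ _ hx) (norm_nonneg _)
              (mul_nonneg (mul_nonneg (hCf _) (Real.rpow_nonneg hbp.le _)) (pow_nonneg hqp _))
        _ = Cf s.1 * Cg s.2 * (base p x ^ (m + wordWt wt s.1) * base p x ^ (m' + wordWt wt s.2)) *
            q p x ^ (M + M') := by rw [pow_add]; ring
        _ = _ := by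
          rw [← Real.rpow_add hbp, ← hmem s (by simp)]
          ring_nf

lemma WBdd.add (hfs : ∀ p, ContDiff ℝ ∞ (f p)) (hgs : ∀ p, ContDiff ℝ ∞ (g p))
    (hf : WBdd v wt Ω base q m M f) (hg : WBdd v wt Ω base q m M g) :
    WBdd v wt Ω base q m M (fun p x => f p x + g p x) := by
  intro w
  obtain ⟨C, hC, h⟩ := hf w
  obtain ⟨C', hC', h'⟩ := hg w
  refine ⟨C + C', add_nonneg hC hC', fun p x hx => ?_⟩
  rw [wderiv_add (hfs p) (hgs p), add_mul, add_mul]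
  exact (norm_add_le _ _).trans (add_le_add (h p x hx) (h' p x hx))

lemma WBdd.const_mul (hfs : ∀ p, ContDiff ℝ ∞ (f p)) (c : ℂ)
    (hf : WBdd v wt Ω base q m M f) : WBdd v wt Ω base q m M (fun p x => c * f p x) := by
  intro w
  obtain ⟨C, hC, h⟩ := hf w
  refine ⟨‖c‖ * C, by positivity, fun p x hx => ?_⟩
  rw [wderiv_const_mul (hfs p), norm_mul, mul_assoc, mul_assoc, ← mul_assoc C]
  exact mul_le_mul_of_nonneg_left (h p x hx) (norm_nonneg _)

lemma WBdd.wderiv (hf : WBdd v wt Ω base q m M f) (w' : List ι) :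
    WBdd v wt Ω base q (m + wordWt wt w') M (fun p => wderiv v w' (f p)) := by
  intro w
  obtain ⟨C, hC, h⟩ := hf (w ++ w')
  refine ⟨C, hC, fun p x hx => ?_⟩
  have := h p x hx
  rw [wderiv_append, wordWt_append] at this
  rw [add_assoc, add_comm (wordWt wt w')]
  exact this

/-- A function vanishing off the closed set `Ω p` satisfies bounds everywhere. -/
lemma WBdd.univ (hb : ∀ p x, 0 < base p x) (hq : ∀ p x, 1 ≤ q p x) (hΩ : ∀ p, IsClosed (Ω p))
    (h0 : ∀ p x, x ∉ Ω p → f p x = 0) (hf : WBdd v wt Ω base q m M f) :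
    WBdd v wt (fun _ => Set.univ) base q m M f := by
  intro w
  obtain ⟨C, hC, h⟩ := hf w
  refine ⟨C, hC, fun p x _ => ?_⟩
  by_cases hx : x ∈ Ω p
  · exact h p x hx
  · rw [wderiv_eq_zero_of_isClosed (hΩ p) (h0 p) w hx, norm_zero]
    have := hb p x
    have := zero_le_one.trans (hq p x)
    positivity

/-- The product of `f` with a family `g` vanishing off `Ω p`. -/
lemma WBdd.mono_set {Ω' : P → Set E} (h : ∀ p, Ω' p ⊆ Ω p) (hf : WBdd v wt Ω base q m M f) :
    WBdd v wt Ω' base q m M f := by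
  intro w
  obtain ⟨C, hC, hw⟩ := hf w
  exact ⟨C, hC, fun p x hx => hw p x (h p hx)⟩

end WeightedBounds

/-! ### The Japanese bracket, dyadic shells and locally finite dyadic sums. -/

section Bracket

lemma one_le_bracket (ξ : Rn n) : 1 ≤ bracket ξ := by
  rw [bracket, Real.one_le_sqrt]; nlinarith [sq_nonneg ‖ξ‖]

lemma bracket_pos (ξ : Rn n) : 0 < bracket ξ := zero_lt_one.trans_le (one_le_bracket ξ)

lemma bracket_sq (ξ : Rn n) : bracket ξ ^ 2 = 1 + ‖ξ‖ ^ 2 := Real.sq_sqrt (by positivity)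

lemma norm_le_bracket (ξ : Rn n) : ‖ξ‖ ≤ bracket ξ :=
  Real.le_sqrt_of_sq_le (by linarith)

lemma bracket_le (ξ : Rn n) : bracket ξ ≤ 1 + ‖ξ‖ := by
  rw [bracket, Real.sqrt_le_left (by positivity)]; nlinarith [norm_nonneg ξ]

lemma one_add_norm_le_bracket (ξ : Rn n) : 1 + ‖ξ‖ ≤ 2 * bracket ξ := by
  linarith [one_le_bracket ξ, norm_le_bracket ξ]

lemma continuous_bracket : Continuous (bracket : Rn n → ℝ) := by
  unfold bracket; fun_prop

lemma bracket_add_le (ξ η : Rn n) : bracket (ξ + η) ≤ bracket ξ + ‖η‖ := by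
  refine Real.sqrt_le_iff.2 ⟨by have := bracket_pos ξ; positivity, ?_⟩
  have h1 := bracket_sq ξ
  have h2 := norm_le_bracket ξ
  have h3 := norm_add_le ξ η
  nlinarith [norm_nonneg η, norm_nonneg (ξ + η), norm_nonneg ξ,
    mul_le_mul h3 h3 (norm_nonneg _) (by positivity),
    mul_le_mul_of_nonneg_right h2 (norm_nonneg η)]

/-- Exponents of both signs occur, so two-sided comparability is assumed; it costs only the factor
`K ^ |s|`. -/
lemma rpow_le_of_comparable {t u K : ℝ} (ht : 0 < t) (hK : 1 ≤ K) (h1 : t ≤ K * u)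
    (h2 : u ≤ K * t) (s : ℝ) : u ^ s ≤ K ^ |s| * t ^ s := by
  have hu : 0 < u := by
    by_contra h
    nlinarith [not_lt.1 h]
  rcases le_total 0 s with hs | hs
  · rw [abs_of_nonneg hs, ← Real.mul_rpow (by linarith) ht.le]
    exact Real.rpow_le_rpow hu.le h2 hs
  · rw [abs_of_nonpos hs]
    have h3 : K ^ (-s) * t ^ s = (t / K) ^ s := by
      rw [Real.div_rpow ht.le (by linarith), Real.rpow_neg (by linarith)]
      field_simp
    rw [h3]
    exact Real.rpow_le_rpow_of_nonpos (by positivity)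
      (by rw [div_le_iff₀ (by linarith)]; linarith) hs

/-- The dyadic number `2 ^ k`. -/
def lam (k : ℕ) : ℝ := 2 ^ k

/-- The square root of `2 ^ k`. -/
def hlf (k : ℕ) : ℝ := lam k ^ (1 / 2 : ℝ)

lemma one_le_lam (k : ℕ) : 1 ≤ lam k := one_le_pow₀ (by norm_num)

lemma lam_pos (k : ℕ) : 0 < lam k := zero_lt_one.trans_le (one_le_lam k)

lemma one_le_hlf (k : ℕ) : 1 ≤ hlf k := Real.one_le_rpow (one_le_lam k) (by norm_num)

lemma hlf_pos (k : ℕ) : 0 < hlf k := zero_lt_one.trans_le (one_le_hlf k)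

lemma hlf_sq (k : ℕ) : hlf k ^ 2 = lam k := by
  rw [hlf, ← Real.rpow_natCast, ← Real.rpow_mul (lam_pos k).le]; norm_num

lemma hlf_le_lam (k : ℕ) : hlf k ≤ lam k := by
  nlinarith [hlf_sq k, one_le_hlf k]

lemma hlf_pow (k j : ℕ) : hlf k ^ j = lam k ^ ((j : ℝ) / 2) := by
  rw [hlf, ← Real.rpow_natCast, ← Real.rpow_mul (lam_pos k).le]; ring_nf

lemma two_rpow_eq_inv_hlf (k : ℕ) : (2 : ℝ) ^ (-(k : ℝ) / 2) = (hlf k)⁻¹ := by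
  rw [hlf, lam, ← Real.rpow_natCast, ← Real.rpow_mul (by norm_num),
    ← Real.rpow_neg (by norm_num)]
  ring_nf

/-- The dyadic shell where `⟨ξ⟩` is comparable to `2 ^ k`. -/
def Shell (k : ℕ) : Set (Rn n) := {ξ | lam k ≤ 4 * bracket ξ ∧ bracket ξ ≤ 2 * lam k}

lemma isClosed_shell (k : ℕ) : IsClosed (Shell k : Set (Rn n)) :=
  (isClosed_le continuous_const (continuous_const.mul continuous_bracket)).inter
    (isClosed_le continuous_bracket continuous_const)

/-- From `k < 2 ^ k ≤ 4⟨ξ⟩`. The bound is crude but depends on `R` only, which makes every dyadic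
sum finite, uniformly on balls. -/
lemma lt_of_mem_shell {k : ℕ} {ξ : Rn n} (h : ξ ∈ Shell k) {R : ℝ} (hR : ‖ξ‖ ≤ R) :
    k < ⌈4 * (1 + R)⌉₊ := by
  have h1 : (k : ℝ) < lam k := by
    unfold lam; exact_mod_cast Nat.lt_two_pow_self
  have h2 : lam k ≤ 4 * (1 + R) := h.1.trans (by linarith [bracket_le ξ])
  exact Nat.lt_ceil.2 (h1.trans_le h2)

lemma lam_rpow_le_of_mem_shell {k : ℕ} {ξ : Rn n} (h : ξ ∈ Shell k) (s : ℝ) :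
    lam k ^ s ≤ 4 ^ |s| * bracket ξ ^ s :=
  rpow_le_of_comparable (bracket_pos ξ) (by norm_num)
    (by linarith [h.2, lam_pos k]) h.1 s

lemma bracket_rpow_le_of_mem_shell {k : ℕ} {ξ : Rn n} (h : ξ ∈ Shell k) (s : ℝ) :
    bracket ξ ^ s ≤ 4 ^ |s| * lam k ^ s :=
  rpow_le_of_comparable (lam_pos k) (by norm_num) h.1 (by linarith [h.2, lam_pos k]) s

lemma bracket_add_rpow_le_of_mem_shell {k : ℕ} {ξ η : Rn n} (h : ξ ∈ Shell k) (hη : ‖η‖ ≤ hlf k)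
    (s : ℝ) : bracket (ξ + η) ^ s ≤ 64 ^ |s| * lam k ^ s := by
  have h1 := hlf_sq k
  have h2 := one_le_hlf k
  refine rpow_le_of_comparable (lam_pos k) (by norm_num) ?_ ?_ s
  · have h3 := bracket_add_le (ξ + η) (-η)
    rw [add_neg_cancel_right, norm_neg] at h3
    have h4 := one_le_bracket (ξ + η)
    have h5 := h.1
    -- Here `λ ≤ 4⟨ξ + η⟩ + 4h` with `h² = λ`. If `h ≤ 8` then `λ ≤ 64` already; otherwise `4h <
    -- λ/2` is absorbed on the left. This is the origin of 64.
    by_cases h8 : hlf k ≤ 8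
    · nlinarith
    · nlinarith [not_le.1 h8]
  · have h3 := bracket_add_le ξ η
    have h4 := h.2
    nlinarith [hlf_le_lam k, lam_pos k]

lemma tsum_eq_sum_of_shell {f : ℕ → ℂ} {ξ : Rn n} (h : ∀ k, ξ ∉ Shell k → f k = 0) {R : ℝ}
    (hR : ‖ξ‖ ≤ R) : ∑' k, f k = ∑ k ∈ Finset.range ⌈4 * (1 + R)⌉₊, f k := by
  refine tsum_eq_sum fun k hk => h k fun hs => hk ?_
  exact Finset.mem_range.2 (lt_of_mem_shell hs hR)

/-- The dyadic scales whose shell contains `ξ`. -/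
def scales (ξ : Rn n) : Finset ℕ := by
  classical exact (Finset.range ⌈4 * (1 + ‖ξ‖)⌉₊).filter fun k => ξ ∈ (Shell k : Set (Rn n))

lemma mem_scales {k : ℕ} {ξ : Rn n} : k ∈ scales ξ ↔ ξ ∈ (Shell k : Set (Rn n)) := by
  simp only [scales, Finset.mem_filter, Finset.mem_range, and_iff_right_iff_imp]
  exact fun h => lt_of_mem_shell h le_rfl

lemma tsum_eq_sum_scales {f : ℕ → ℂ} {ξ : Rn n} (h : ∀ k, ξ ∉ Shell k → f k = 0) :
    ∑' k, f k = ∑ k ∈ scales ξ, f k :=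
  tsum_eq_sum fun k hk => h k fun hs => hk (mem_scales.2 hs)

/-- If `a` is the least scale of `ξ`, then `λ_k ≤ 4⟨ξ⟩ ≤ 8λ_a`, hence `k ≤ a + 3`. Consequently a
dyadic sum at `ξ` costs only an absolute constant. -/
lemma card_scales_le (ξ : Rn n) : (scales ξ).card ≤ 4 := by
  rcases (scales ξ).eq_empty_or_nonempty with h | h
  · simp [h]
  · set a := (scales ξ).min' h
    have ha : ξ ∈ (Shell a : Set (Rn n)) := mem_scales.1 (Finset.min'_mem _ h)
    have hsub : scales ξ ⊆ Finset.Icc a (a + 3) := by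
      intro k hk
      refine Finset.mem_Icc.2 ⟨Finset.min'_le _ _ hk, ?_⟩
      have h1 : lam k ≤ 8 * lam a := (mem_scales.1 hk).1.trans (by linarith [ha.2])
      by_contra hlt
      have h2 : lam (a + 4) ≤ lam k := pow_le_pow_right₀ (by norm_num) (by omega)
      have h3 : lam (a + 4) = 16 * lam a := by unfold lam; ring
      linarith [lam_pos a]
    exact (Finset.card_le_card hsub).trans (by rw [Nat.card_Icc]; omega)

lemma norm_tsum_le_of_shell {f : ℕ → ℂ} {ξ : Rn n} {B : ℝ} (hB : 0 ≤ B)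
    (h : ∀ k, ξ ∉ Shell k → f k = 0) (hf : ∀ k, ξ ∈ Shell k → ‖f k‖ ≤ B) :
    ‖∑' k, f k‖ ≤ 4 * B := by
  rw [tsum_eq_sum_scales h]
  calc _ ≤ ∑ k ∈ scales ξ, ‖f k‖ := norm_sum_le _ _
    _ ≤ ∑ k ∈ scales ξ, B := Finset.sum_le_sum fun k hk => hf k (mem_scales.1 hk)
    _ = (scales ξ).card * B := by simp
    _ ≤ 4 * B := by
      gcongr
      exact_mod_cast card_scales_le ξ

/-! ### Termwise differentiation of dyadic sums. -/

section LocallyFinite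

/-- On the neighbourhood where `‖π‖ < ‖π p‖ + 1` one finite range of scales serves all points, so
derivatives of the sum may be taken termwise. -/
lemma tsum_shell_eventuallyEq {X : Type*} [TopologicalSpace X] {π : X → Rn n} {F : ℕ → X → ℂ}
    (hπ : Continuous π) (h : ∀ k p, π p ∉ Shell k → F k p = 0) (p : X) :
    (fun p => ∑' k, F k p) =ᶠ[nhds p]
      fun p' => ∑ k ∈ Finset.range ⌈4 * (1 + (‖π p‖ + 1))⌉₊, F k p' := by
  have : ∀ᶠ p' in nhds p, ‖π p'‖ < ‖π p‖ + 1 :=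
    (continuous_norm.comp hπ).continuousAt.eventually_lt continuousAt_const (by simp)
  filter_upwards [this] with p' hp'
  exact tsum_eq_sum_of_shell (fun k hk => h k p' hk) hp'.le

variable {E : Type*} [NormedAddCommGroup E] [NormedSpace ℝ E] {ι : Type*} {π : E → Rn n}
  {F : ℕ → E → ℂ}

lemma wderiv_tsum_shell (hπ : Continuous π) (h : ∀ k p, π p ∉ Shell k → F k p = 0)
    (hF : ∀ k, ContDiff ℝ ∞ (F k)) (v : ι → E) (w : List ι) (p : E) :
    wderiv v w (fun p => ∑' k, F k p) p = ∑' k, wderiv v w (F k) p := by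
  rw [(wderiv_eventuallyEq (tsum_shell_eventuallyEq hπ h p) w).eq_of_nhds,
    wderiv_sum _ fun k _ => hF k]
  refine (tsum_eq_sum_of_shell (ξ := π p) (fun k hk => ?_) (by simp)).symm
  exact wderiv_eq_zero_of_isClosed ((isClosed_shell k).preimage hπ) (fun x hx => h k x hx) w hk

/-- A version for summands that are only known to be differentiable once: smoothness of `opS` is
bootstrapped from it. -/
lemma hasFDerivAt_tsum_shell (hπ : Continuous π) (h : ∀ k p, π p ∉ Shell k → F k p = 0)
    (hF : ∀ k, Differentiable ℝ (F k)) (p v : E) :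
    DifferentiableAt ℝ (fun p => ∑' k, F k p) p ∧
      fderiv ℝ (fun p => ∑' k, F k p) p v = ∑' k, fderiv ℝ (F k) p v := by
  have h1 := tsum_shell_eventuallyEq hπ h p
  have h2 : HasFDerivAt (fun p' => ∑ k ∈ Finset.range ⌈4 * (1 + (‖π p‖ + 1))⌉₊, F k p')
      (∑ k ∈ Finset.range ⌈4 * (1 + (‖π p‖ + 1))⌉₊, fderiv ℝ (F k) p) p :=
    HasFDerivAt.fun_sum fun k _ => (hF k p).hasFDerivAt
  have h3 := h2.congr_of_eventuallyEq h1
  refine ⟨h3.differentiableAt, ?_⟩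
  rw [h3.fderiv, sum_apply]
  refine (tsum_eq_sum_of_shell (ξ := π p) (fun k hk => ?_) (by simp)).symm
  exact wderiv_eq_zero_of_isClosed (v := fun _ : Unit => v) ((isClosed_shell k).preimage hπ)
    (fun x hx => h k x hx) [()] hk

end LocallyFinite

end Bracket

/-! ### Symbol classes in terms of words in all variables. -/

section Symbols

/-- The `i`-th standard basis vector. -/
def bv (i : Fin n) : Rn n := EuclideanSpace.single i 1

lemma sum_coord_bv (u : Rn n) : ∑ i, u i • bv i = u := by
  ext j
  simp [bv, Pi.single_apply]

lemma pderivs_eq_wderiv_bv (w : List (Fin n)) (f : Rn n → ℂ) : pderivs w f = wderiv bv w f := rfl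

lemma pderivs_cons (i : Fin n) (w : List (Fin n)) (f : Rn n → ℂ) :
    pderivs (i :: w) f = fun x => fderiv ℝ (pderivs w f) x (bv i) := rfl

/-- The coordinate directions of `ℝⁿ × ℝⁿ`. -/
def dir2 : Fin n ⊕ Fin n → Rn n × Rn n
  | .inl i => (bv i, 0)
  | .inr i => (0, bv i)

/-- The weights of the letters for the class `S^m_{1,δ}`. -/
def wt2 (δ : ℝ) : Fin n ⊕ Fin n → ℝ
  | .inl _ => δ
  | .inr _ => -1

lemma fderiv_uncurry_fst {f : Rn n → Rn n → ℂ} {x ξ u : Rn n}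
    (hf : DifferentiableAt ℝ (Function.uncurry f) (x, ξ)) :
    fderiv ℝ (fun y => f y ξ) x u = fderiv ℝ (Function.uncurry f) (x, ξ) (u, 0) := by
  have h1 : HasFDerivAt (fun y : Rn n => (y, ξ)) (ContinuousLinearMap.inl ℝ (Rn n) (Rn n)) x :=
    hasFDerivAt_prodMk_left x ξ
  have h2 : HasFDerivAt (fun y => f y ξ) _ x := HasFDerivAt.comp (g := Function.uncurry f) x hf.hasFDerivAt h1
  rw [h2.fderiv]; rfl

lemma fderiv_uncurry_snd {f : Rn n → Rn n → ℂ} {x ξ u : Rn n}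
    (hf : DifferentiableAt ℝ (Function.uncurry f) (x, ξ)) :
    fderiv ℝ (f x) ξ u = fderiv ℝ (Function.uncurry f) (x, ξ) (0, u) := by
  have h1 : HasFDerivAt (fun η : Rn n => (x, η)) (ContinuousLinearMap.inr ℝ (Rn n) (Rn n)) ξ :=
    hasFDerivAt_prodMk_right x ξ
  have h2 : HasFDerivAt (f x) _ ξ := HasFDerivAt.comp (g := Function.uncurry f) ξ hf.hasFDerivAt h1
  rw [h2.fderiv]; rfl

lemma dx_eq_wderiv {a : Rn n → Rn n → ℂ} (ha : ContDiff ℝ ∞ (Function.uncurry a))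
    (β : List (Fin n)) :
    Function.uncurry (dx β a) = wderiv dir2 (β.map Sum.inl) (Function.uncurry a) := by
  induction β with
  | nil => rfl
  | cons i β ih =>
    funext ⟨x, ξ⟩
    have hs : ContDiff ℝ ∞ (Function.uncurry (dx β a)) := ih ▸ contDiff_wderiv ha _
    rw [List.map_cons, wderiv_cons, ← ih]
    exact fderiv_uncurry_fst (f := dx β a) (differentiable_of_smooth hs _)

lemma dxi_eq_wderiv {a : Rn n → Rn n → ℂ} (ha : ContDiff ℝ ∞ (Function.uncurry a))
    (α : List (Fin n)) :
    Function.uncurry (dxi α a) = wderiv dir2 (α.map Sum.inr) (Function.uncurry a) := by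
  induction α with
  | nil => rfl
  | cons i α ih =>
    funext ⟨x, ξ⟩
    have hs : ContDiff ℝ ∞ (Function.uncurry (dxi α a)) := ih ▸ contDiff_wderiv ha _
    rw [List.map_cons, wderiv_cons, ← ih]
    exact fderiv_uncurry_snd (f := dxi α a) (differentiable_of_smooth hs _)

lemma contDiff_dx {a : Rn n → Rn n → ℂ} (ha : ContDiff ℝ ∞ (Function.uncurry a))
    (β : List (Fin n)) : ContDiff ℝ ∞ (Function.uncurry (dx β a)) := by
  rw [dx_eq_wderiv ha]; exact contDiff_wderiv ha _

lemma contDiff_dxi {a : Rn n → Rn n → ℂ} (ha : ContDiff ℝ ∞ (Function.uncurry a))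
    (α : List (Fin n)) : ContDiff ℝ ∞ (Function.uncurry (dxi α a)) := by
  rw [dxi_eq_wderiv ha]; exact contDiff_wderiv ha _

lemma dxi_dx_eq_wderiv {a : Rn n → Rn n → ℂ} (ha : ContDiff ℝ ∞ (Function.uncurry a))
    (α β : List (Fin n)) (x ξ : Rn n) :
    dxi α (dx β a) x ξ =
      wderiv dir2 (α.map Sum.inr ++ β.map Sum.inl) (Function.uncurry a) (x, ξ) := by
  rw [wderiv_append, ← dx_eq_wderiv ha, ← dxi_eq_wderiv (contDiff_dx ha β)]
  rfl

lemma dx_dxi_comm {a : Rn n → Rn n → ℂ} (ha : ContDiff ℝ ∞ (Function.uncurry a))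
    (α β : List (Fin n)) : dx β (dxi α a) = dxi α (dx β a) := by
  funext x ξ
  rw [dxi_dx_eq_wderiv ha, wderiv_perm ha List.perm_append_comm, wderiv_append,
    ← dxi_eq_wderiv ha, ← dx_eq_wderiv (contDiff_dxi ha α)]
  rfl

lemma perm_inr_append_inl (w : List (Fin n ⊕ Fin n)) :
    ∃ α β : List (Fin n), w.Perm (α.map Sum.inr ++ β.map Sum.inl) := by
  induction w with
  | nil => exact ⟨[], [], by simp⟩
  | cons i w ih =>
    obtain ⟨α, β, h⟩ := ih
    cases i with
    | inl i => exact ⟨α, i :: β, (h.cons _).trans List.perm_middle.symm⟩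
    | inr i => exact ⟨i :: α, β, h.cons _⟩

lemma wordWt_wt2 (δ : ℝ) (α β : List (Fin n)) :
    wordWt (wt2 δ) (α.map Sum.inr ++ β.map Sum.inl) = -α.length + β.length * δ := by
  have h1 : wordWt (wt2 δ) (α.map Sum.inr) = -α.length := by
    induction α with
    | nil => simp
    | cons i α ih => simp only [List.map_cons, wordWt_cons, ih, wt2, List.length_cons]; push_cast; ring
  have h2 : wordWt (wt2 δ) (β.map Sum.inl) = β.length * δ := by
    induction β with
    | nil => simp
    | cons i β ih => simp only [List.map_cons, wordWt_cons, ih, wt2, List.length_cons]; push_cast; ring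
  rw [wordWt_append, h1, h2]

/-- The class `S^m_{1,δ}` in terms of words in all the variables. -/
def SymBdd (m δ : ℝ) (a : Rn n → Rn n → ℂ) : Prop :=
  WBdd (P := Unit) dir2 (wt2 δ) (fun _ => Set.univ) (fun _ p => bracket p.2) (fun _ _ => 1) m 0
    (fun _ => Function.uncurry a)

/-- Treating `x` and `ξ` on the same footing makes the weighted Leibniz rule available. A mixed word
is sorted into `ξ`-letters and `x`-letters by symmetry of derivatives, which preserves its weight.
-/
lemma isSymbol_iff {m δ : ℝ} {a : Rn n → Rn n → ℂ} :
    IsSymbol m δ a ↔ ContDiff ℝ ∞ (Function.uncurry a) ∧ SymBdd m δ a := by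
  refine and_congr_right fun ha => ⟨fun h w => ?_, fun h α β => ?_⟩
  · obtain ⟨α, β, hw⟩ := perm_inr_append_inl w
    obtain ⟨C, hC, h⟩ := h α β
    refine ⟨C, hC, fun _ p _ => ?_⟩
    rw [wderiv_perm ha hw, wordWt_perm _ hw, wordWt_wt2, ← dxi_dx_eq_wderiv ha, pow_zero, mul_one]
    convert h p.1 p.2 using 3
    ring
  · obtain ⟨C, hC, h⟩ := h (α.map Sum.inr ++ β.map Sum.inl)
    refine ⟨C, hC, fun x ξ => ?_⟩
    have := h () (x, ξ) trivial
    rw [wordWt_wt2, ← dxi_dx_eq_wderiv ha, pow_zero, mul_one] at this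
    convert this using 3
    ring

lemma IsSymbol.mul {m m' δ : ℝ} {a b : Rn n → Rn n → ℂ} (ha : IsSymbol m δ a)
    (hb : IsSymbol m' δ b) : IsSymbol (m + m') δ (fun x ξ => a x ξ * b x ξ) := by
  rw [isSymbol_iff] at *
  obtain ⟨ha1, ha2⟩ := ha
  obtain ⟨hb1, hb2⟩ := hb
  have h1 : ContDiff ℝ ∞ fun p => Function.uncurry a p * Function.uncurry b p := ha1.mul hb1
  have h2 : SymBdd (m + m') δ (fun x ξ => a x ξ * b x ξ) := by
    unfold SymBdd at ha2 hb2 ⊢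
    exact WBdd.mul (M := 0) (M' := 0) (fun _ p => bracket_pos p.2) (fun _ _ => le_rfl)
      (fun _ => ha1) (fun _ => hb1) ha2 hb2
  exact ⟨h1, h2⟩

lemma IsSymbol.add {m δ : ℝ} {a b : Rn n → Rn n → ℂ} (ha : IsSymbol m δ a)
    (hb : IsSymbol m δ b) : IsSymbol m δ (fun x ξ => a x ξ + b x ξ) := by
  rw [isSymbol_iff] at *
  have h1 : ContDiff ℝ ∞ fun p => Function.uncurry a p + Function.uncurry b p := ha.1.add hb.1
  exact ⟨h1, WBdd.add (fun _ => ha.1) (fun _ => hb.1) ha.2 hb.2⟩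

lemma IsSymbol.const_mul {m δ : ℝ} {a : Rn n → Rn n → ℂ} (ha : IsSymbol m δ a) (c : ℂ) :
    IsSymbol m δ (fun x ξ => c * a x ξ) := by
  rw [isSymbol_iff] at *
  have h1 : ContDiff ℝ ∞ fun p => c * Function.uncurry a p := contDiff_const.mul ha.1
  exact ⟨h1, WBdd.const_mul (fun _ => ha.1) c ha.2⟩

lemma IsSymbol.dx {m δ : ℝ} {a : Rn n → Rn n → ℂ} (ha : IsSymbol m δ a) (β : List (Fin n)) :
    IsSymbol (m + β.length * δ) δ (dx β a) := by
  rw [isSymbol_iff] at *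
  refine ⟨contDiff_dx ha.1 β, ?_⟩
  have := ha.2.wderiv (β.map Sum.inl)
  rw [SymBdd, dx_eq_wderiv ha.1]
  have h := wordWt_wt2 δ [] β
  simp only [List.map_nil, List.nil_append, List.length_nil, Nat.cast_zero, neg_zero,
    zero_add] at h
  rwa [h] at this

lemma fderiv_eq_sum_dir2 {f : Rn n × Rn n → ℂ} (p : Rn n × Rn n) :
    fderiv ℝ f p = ∑ i : Fin n ⊕ Fin n,
      ((Sum.elim (fun i => (EuclideanSpace.proj i).comp (ContinuousLinearMap.fst ℝ _ _))
        (fun i => (EuclideanSpace.proj i).comp (ContinuousLinearMap.snd ℝ _ _)) i :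
        Rn n × Rn n →L[ℝ] ℝ)).smulRight (fderiv ℝ f p (dir2 i)) := by
  refine ContinuousLinearMap.ext fun u => ?_
  have hu : u = ∑ i, u.1 i • (dir2 (Sum.inl i) : Rn n × Rn n) + ∑ i, u.2 i • dir2 (Sum.inr i) := by
    refine Prod.ext ?_ ?_
    · simp [dir2, Prod.fst_sum, sum_coord_bv]
    · simp [dir2, Prod.snd_sum, sum_coord_bv]
  conv_lhs => rw [hu]
  simp [map_sum, sum_apply]

/-- A family of functions on `ℝⁿ × ℝⁿ` closed under the partial derivatives consists of smooth
functions, and of symbols if the functions satisfy the bounds of order zero. -/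
theorem isSymbol_of_family {J : Type*} (ord : J → ℝ) (f : J → Rn n → Rn n → ℂ) (δ : ℝ)
    (hd : ∀ j, Differentiable ℝ (Function.uncurry (f j)))
    (hb : ∀ j, ∃ C, 0 ≤ C ∧ ∀ x ξ, ‖f j x ξ‖ ≤ C * bracket ξ ^ ord j)
    (hD : ∀ j i, ∃ j', ord j' = ord j + wt2 δ i ∧
      ∀ p : Rn n × Rn n, fderiv ℝ (Function.uncurry (f j)) p (dir2 i) = f j' p.1 p.2) (j : J) :
    IsSymbol (ord j) δ (f j) := by
  rw [isSymbol_iff]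
  constructor
  · rw [contDiff_infty]
    intro N
    -- The coordinates of the differential of a member are again members, so `C^N` for all members
    -- at once gives `C^{N+1}`.
    induction N generalizing j with
    | zero => exact contDiff_zero.2 (hd j).continuous
    | succ N ih =>
      rw [show ((N + 1 : ℕ) : WithTop ℕ∞) = (N : WithTop ℕ∞) + 1 by push_cast; rfl,
        contDiff_succ_iff_fderiv]
      refine ⟨hd j, by simp, ?_⟩
      rw [funext fun p => fderiv_eq_sum_dir2 (f := Function.uncurry (f j)) p]
      refine ContDiff.sum fun i _ => ?_
      obtain ⟨j', -, h⟩ := hD j i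
      have h' : (fun p => fderiv ℝ (Function.uncurry (f j)) p (dir2 i)) =
        Function.uncurry (f j') := funext h
      exact contDiff_const.smulRight (h' ▸ ih j')
  · have key : ∀ w : List (Fin n ⊕ Fin n), ∃ j', ord j' = ord j + wordWt (wt2 δ) w ∧
        wderiv dir2 w (Function.uncurry (f j)) = Function.uncurry (f j') := by
      intro w
      induction w with
      | nil => exact ⟨j, by simp, rfl⟩
      | cons i w ih =>
        obtain ⟨j', h1, h2⟩ := ih
        obtain ⟨j'', h3, h4⟩ := hD j' i
        refine ⟨j'', by rw [h3, h1, wordWt_cons]; ring, ?_⟩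
        rw [wderiv_cons, h2]
        funext p
        exact h4 p
    intro w
    obtain ⟨j', h1, h2⟩ := key w
    obtain ⟨C, hC, h⟩ := hb j'
    refine ⟨C, hC, fun _ p _ => ?_⟩
    rw [h2, ← h1, pow_zero, mul_one]
    exact h _ _

end Symbols

/-! ### Oscillatory integrals and integration by parts. -/

section Oscillation

/-- The oscillating factor `e^{i z·η}`. -/
def osc (z η : Rn n) : ℂ := Complex.exp (Complex.I * (inner ℝ z η : ℝ))

lemma norm_osc (z η : Rn n) : ‖osc z η‖ = 1 := by
  rw [osc, mul_comm, Complex.norm_exp_ofReal_mul_I]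

lemma osc_add_left (z z' η : Rn n) : osc (z + z') η = osc z η * osc z' η := by
  rw [osc, osc, osc, inner_add_left, ← Complex.exp_add]
  push_cast; ring_nf

lemma osc_add_right (z η η' : Rn n) : osc z (η + η') = osc z η * osc z η' := by
  rw [osc, osc, osc, inner_add_right, ← Complex.exp_add]
  push_cast; ring_nf

lemma osc_comm (z η : Rn n) : osc z η = osc η z := by
  rw [osc, osc, real_inner_comm]

lemma contDiff_osc : ContDiff ℝ ∞ (fun p : Rn n × Rn n => osc p.1 p.2) := by
  unfold osc
  have h : ContDiff ℝ ∞ fun p : Rn n × Rn n => (inner ℝ p.1 p.2 : ℝ) := contDiff_fst.inner ℝ contDiff_snd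
  exact (contDiff_const.mul (Complex.ofRealCLM.contDiff.comp h)).cexp

lemma continuous_osc {X : Type*} [TopologicalSpace X] {f g : X → Rn n} (hf : Continuous f)
    (hg : Continuous g) : Continuous fun x => osc (f x) (g x) :=
  (contDiff_osc (n := n)).continuous.comp (hf.prodMk hg)

lemma hasFDerivAt_osc_left (z η : Rn n) :
    HasFDerivAt (fun z => osc z η)
      ((innerSL ℝ η).smulRight (Complex.I * osc z η)) z := by
  have h1 : HasFDerivAt (fun z : Rn n => (inner ℝ z η : ℝ)) (innerSL ℝ η) z := by
    have := (innerSL ℝ η).hasFDerivAt (x := z)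
    refine this.congr_of_eventuallyEq (Filter.Eventually.of_forall fun y => ?_)
    exact (real_inner_comm _ _)
  have h2 := ((Complex.ofRealCLM.hasFDerivAt.comp z h1).const_mul Complex.I).cexp
  refine h2.congr_fderiv ?_
  ext u
  simp only [osc, ContinuousLinearMap.smulRight_apply, smul_apply, Function.comp_apply,
    ContinuousLinearMap.comp_apply, Complex.ofRealCLM_apply, innerSL_apply_apply, smul_eq_mul,
    Complex.real_smul]
  ring

lemma fderiv_osc_right (z η u : Rn n) :
    fderiv ℝ (fun η => osc z η) η u = Complex.I * (inner ℝ z u : ℝ) * osc z η := by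
  have := hasFDerivAt_osc_left η z
  simp_rw [osc_comm _ z] at this
  rw [this.fderiv]
  simp
  ring

lemma inner_bv (z : Rn n) (j : Fin n) : inner ℝ z (bv j) = z j := by
  simp [bv, EuclideanSpace.inner_single_right]

lemma norm_bv (j : Fin n) : ‖(bv j : Rn n)‖ = 1 := by simp [bv]

lemma norm_le_sum_abs_coord (z : Rn n) : ‖z‖ ≤ ∑ j, |z j| := by
  conv_lhs => rw [← sum_coord_bv z]
  refine (norm_sum_le _ _).trans (Finset.sum_le_sum fun j _ => ?_)
  rw [norm_smul, norm_bv, mul_one, Real.norm_eq_abs]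

/-- Integration by parts along one axis, repeated. Integrability of the derivatives replaces compact
support, so that the lemma also serves integrands that merely decay. -/
lemma integral_osc_mul_pderivs {G : Rn n → ℂ} (hG : ContDiff ℝ ∞ G) (j : Fin n) (N : ℕ)
    (hint : ∀ N' ≤ N, Integrable (pderivs (List.replicate N' j) G)) (z : Rn n) :
    ∫ η, osc z η * pderivs (List.replicate N j) G η =
      (-(Complex.I * (z j : ℝ))) ^ N * ∫ η, osc z η * G η := by
  induction N with
  | zero => simp [pderivs]
  | succ N ih =>
    have hosc : ∀ {f : Rn n → ℂ}, Integrable f → Integrable fun η => osc z η * f η := by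
      intro f hf
      refine hf.bdd_mul (c := 1) (continuous_osc continuous_const continuous_id).aestronglyMeasurable ?_
      exact Filter.Eventually.of_forall fun η => (norm_osc z η).le
    have h0 := hint N (by omega)
    have h1 := hint (N + 1) le_rfl
    rw [List.replicate_succ, pderivs_cons] at h1 ⊢
    rw [integral_mul_fderiv_eq_neg_fderiv_mul_of_integrable]
    · simp_rw [fderiv_osc_right, inner_bv, mul_assoc]
      rw [integral_const_mul, integral_const_mul, ih fun N' hN' => hint N' (by omega)]
      ring
    · simp_rw [fderiv_osc_right, mul_assoc]
      exact ((hosc h0).const_mul _).const_mul _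
    · exact hosc h1
    · exact hosc h0
    · exact fun η _ => (differentiable_of_smooth
        (contDiff_osc.comp (contDiff_const.prodMk contDiff_id)) η)
    · exact fun η _ => differentiable_of_smooth (contDiff_wderiv hG _) η

/-- Decay of oscillating integrals, from integration by parts. -/
lemma coord_pow_mul_norm_integral_osc_le {G : Rn n → ℂ} (hG : ContDiff ℝ ∞ G) (j : Fin n) (N : ℕ)
    (hint : ∀ N' ≤ N, Integrable (pderivs (List.replicate N' j) G)) (z : Rn n) :
    |z j| ^ N * ‖∫ η, osc z η * G η‖ ≤ ∫ η, ‖pderivs (List.replicate N j) G η‖ := by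
  have h := integral_osc_mul_pderivs hG j N hint z
  have h2 : |z j| ^ N * ‖∫ η, osc z η * G η‖ =
      ‖∫ η, osc z η * pderivs (List.replicate N j) G η‖ := by
    rw [h, norm_mul, norm_pow, norm_neg, norm_mul, Complex.norm_I, one_mul, Complex.norm_real,
      Real.norm_eq_abs]
  rw [h2]
  refine (norm_integral_le_integral_norm _).trans (le_of_eq ?_)
  simp [norm_osc]

/-- Integration by parts along the axes controls single coordinates only; the largest one satisfies
`‖z‖ ≤ n |z j|`. For `n = 0` the claim needs `N ≠ 0`. -/
lemma norm_pow_le_sum_coord (z : Rn n) {N : ℕ} (hN : N ≠ 0) :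
    ‖z‖ ^ N ≤ n ^ N * ∑ j, |z j| ^ N := by
  rcases isEmpty_or_nonempty (Fin n) with h | h
  · have : z = 0 := Subsingleton.elim _ _
    subst this
    simp [hN]
  · obtain ⟨j, -, hj⟩ := Finset.exists_max_image (Finset.univ : Finset (Fin n)) (fun j => |z j|)
      Finset.univ_nonempty
    have h1 : ‖z‖ ≤ n * |z j| := by
      refine (norm_le_sum_abs_coord z).trans ?_
      refine (Finset.sum_le_card_nsmul _ _ _ fun i hi => hj i hi).trans ?_
      simp
    calc ‖z‖ ^ N ≤ (n * |z j|) ^ N := pow_le_pow_left₀ (norm_nonneg _) h1 N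
      _ = n ^ N * |z j| ^ N := mul_pow _ _ _
      _ ≤ _ := by
        gcongr
        exact Finset.single_le_sum (f := fun j => |z j| ^ N) (fun _ _ => by positivity)
          (Finset.mem_univ j)

/-- The bound `(1 + s‖z‖)^N |∫ e^{iz·η} G(η) dη| ≤ C L` if the derivatives of `G` of order `N` along
the axes have integrals at most `L s^{-N}`. -/
lemma weighted_norm_integral_osc_le {G : Rn n → ℂ} (hG : ContDiff ℝ ∞ G) (N : ℕ)
    (hint : ∀ j, ∀ N' ≤ N, Integrable (pderivs (List.replicate N' j) G)) {s L : ℝ} (hs : 0 < s)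
    (hL0 : ∫ η, ‖G η‖ ≤ L)
    (hL : ∀ j, s ^ N * ∫ η, ‖pderivs (List.replicate N j) G η‖ ≤ L) (z : Rn n) :
    (1 + s * ‖z‖) ^ N * ‖∫ η, osc z η * G η‖ ≤ 2 ^ N * (1 + n ^ N * n) * L := by
  have hI0 : ‖∫ η, osc z η * G η‖ ≤ L :=
    ((norm_integral_le_integral_norm _).trans (le_of_eq (by simp [norm_osc]))).trans hL0
  have hL' : 0 ≤ L := (norm_nonneg _).trans hI0
  rcases eq_or_ne N 0 with rfl | hN
  · simp only [pow_zero, one_mul]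
    nlinarith [Nat.cast_nonneg (α := ℝ) n]
  set I := ‖∫ η, osc z η * G η‖
  have h1 : (1 + s * ‖z‖) ^ N ≤ 2 ^ N * (1 + (s * ‖z‖) ^ N) := by
    refine (add_pow_le zero_le_one (by positivity) N).trans ?_
    rw [one_pow]
    gcongr
    · norm_num
    · omega
  have h2 : (s * ‖z‖) ^ N * I ≤ n ^ N * n * L := by
    calc (s * ‖z‖) ^ N * I = s ^ N * (‖z‖ ^ N) * I := by rw [mul_pow]
      _ ≤ s ^ N * (n ^ N * ∑ j, |z j| ^ N) * I := by
        gcongr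
        exact norm_pow_le_sum_coord z hN
      _ = n ^ N * ∑ j, s ^ N * (|z j| ^ N * I) := by
        simp_rw [Finset.mul_sum, Finset.sum_mul]
        refine Finset.sum_congr rfl fun j _ => by ring
      _ ≤ n ^ N * ∑ j : Fin n, L := by
        gcongr with j
        refine le_trans ?_ (hL j)
        gcongr
        exact coord_pow_mul_norm_integral_osc_le hG j N (hint j) z
      _ = _ := by simp; ring
  calc (1 + s * ‖z‖) ^ N * I ≤ 2 ^ N * (1 + (s * ‖z‖) ^ N) * I := by gcongr
    _ = 2 ^ N * (I + (s * ‖z‖) ^ N * I) := by ring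
    _ ≤ 2 ^ N * (L + n ^ N * n * L) := by gcongr
    _ = _ := by ring

lemma integrable_of_continuous_of_zero_off_ball {f : Rn n → ℂ} (hf : Continuous f) {R : ℝ}
    (h0 : ∀ η, R < ‖η‖ → f η = 0) : Integrable f := by
  refine hf.integrable_of_hasCompactSupport ?_
  refine HasCompactSupport.intro (isCompact_closedBall (0 : Rn n) R) fun η hη => h0 η ?_
  simpa using hη

lemma zero_off_ball_wderiv {ι : Type*} {v : ι → Rn n} {f : Rn n → ℂ} {R : ℝ}
    (h0 : ∀ η, R < ‖η‖ → f η = 0) (w : List ι) (η : Rn n) (hη : R < ‖η‖) : wderiv v w f η = 0 := by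
  refine wderiv_eq_zero_of_isClosed (S := Metric.closedBall 0 R) Metric.isClosed_closedBall
    (fun x hx => h0 x ?_) w ?_
  · simpa using hx
  · simpa using hη

/-- The volume of the unit ball. -/
def ballVol (n : ℕ) : ℝ := (volume (Metric.ball (0 : Rn n) 1)).toReal

lemma integral_norm_le_of_zero_off_ball {f : Rn n → ℂ} {R B : ℝ} (hR : 0 ≤ R)
    (h0 : ∀ η, R < ‖η‖ → f η = 0) (hB : ∀ η, ‖f η‖ ≤ B) :
    ∫ η, ‖f η‖ ≤ ballVol n * (R ^ n * B) := by
  have h1 : ∫ η, ‖f η‖ = ∫ η in Metric.closedBall 0 R, ‖f η‖ := by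
    rw [setIntegral_eq_integral_of_forall_compl_eq_zero]
    intro η hη
    rw [h0 η (by simpa using hη), norm_zero]
  have h2 := norm_setIntegral_le_of_norm_le_const (μ := volume) (s := Metric.closedBall (0 : Rn n) R)
    (f := fun η => ‖f η‖) (C := B) measure_closedBall_lt_top (fun η _ => by simpa using hB η)
  rw [h1]
  refine (le_abs_self _).trans (h2.trans (le_of_eq ?_))
  rw [Measure.real, Measure.addHaar_closedBall _ _ hR, ENNReal.toReal_mul,
    ENNReal.toReal_ofReal (by positivity), ballVol, finrank_euclideanSpace_fin]
  ring

/-- If `G` lives in a ball of radius `R` and varies on the scale `R`, its Fourier integral has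
height of order `R ^ n * B` and is concentrated on the dual scale `1 / R`. -/
lemma weighted_norm_integral_osc_le_of_ball {G : Rn n → ℂ} (hG : ContDiff ℝ ∞ G) (N : ℕ)
    {R B : ℝ} (hR : 0 < R) (h0 : ∀ η, R < ‖η‖ → G η = 0) (hB : ∀ η, ‖G η‖ ≤ B)
    (hBN : ∀ j η, R ^ N * ‖pderivs (List.replicate N j) G η‖ ≤ B) (z : Rn n) :
    (1 + R * ‖z‖) ^ N * ‖∫ η, osc z η * G η‖ ≤
      2 ^ N * (1 + n ^ N * n) * (ballVol n * (R ^ n * B)) := by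
  refine weighted_norm_integral_osc_le hG N (fun j N' _ => ?_) hR ?_ (fun j => ?_) z
  · exact integrable_of_continuous_of_zero_off_ball (contDiff_wderiv hG _).continuous
      (zero_off_ball_wderiv h0 _)
  · exact integral_norm_le_of_zero_off_ball hR.le h0 hB
  · have h1 : R ^ N * ∫ η, ‖pderivs (List.replicate N j) G η‖ =
        ∫ η, ‖((R ^ N : ℝ) : ℂ) * pderivs (List.replicate N j) G η‖ := by
      rw [← integral_const_mul]
      congr 1 with η
      rw [norm_mul, Complex.norm_real, Real.norm_of_nonneg (by positivity)]
    rw [h1]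
    refine integral_norm_le_of_zero_off_ball hR.le (fun η hη => ?_) (fun η => ?_)
    · rw [pderivs_eq_wderiv_bv, zero_off_ball_wderiv h0 _ η hη, mul_zero]
    · rw [norm_mul, Complex.norm_real, Real.norm_of_nonneg (by positivity)]
      exact hBN j η

end Oscillation

/-! ### Amplitudes at a single scale: kernels and their derivatives. -/

section Amplitudes

/-- The space of the variables `(x, ξ, η)` of an amplitude. -/
abbrev R3 (n : ℕ) : Type := Rn n × Rn n × Rn n

/-- The coordinate directions of the space of the variables `(x, ξ, η)`. -/
def dir3 : Fin n ⊕ Fin n ⊕ Fin n → R3 n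
  | .inl i => (bv i, 0, 0)
  | .inr (.inl i) => (0, bv i, 0)
  | .inr (.inr i) => (0, 0, bv i)

/-- The weights of the derivatives of an amplitude in `x`, `ξ`, `η`. -/
def wt3 : Fin n ⊕ Fin n ⊕ Fin n → ℝ
  | .inl _ => 1 / 2
  | .inr (.inl _) => -1
  | .inr (.inr _) => -(1 / 2)

/-- The kernel `∫ e^{i(x-y)·η} F(y; x, ξ, η) dη`. -/
def kerJ (F : Rn n → R3 n → ℂ) (x ξ y : Rn n) : ℂ := ∫ η, osc (x - y) η * F y (x, ξ, η)

/-- The function `(2π)^{-n} ∫∫ e^{i(x-y)·η} F(y; x, ξ, η) dη dy`. -/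
def opT (F : Rn n → R3 n → ℂ) (x ξ : Rn n) : ℂ :=
  (((2 * Real.pi) ^ n : ℝ) : ℂ)⁻¹ * ∫ y, kerJ F x ξ y

/-- The amplitude of the partial derivatives of `opT F`. -/
def ampD : Fin n ⊕ Fin n → (Rn n → R3 n → ℂ) → Rn n → R3 n → ℂ
  | .inl l, F => fun y p => wderiv dir3 [.inl l] (F y) p + (Complex.I * (p.2.2 l : ℝ)) * F y p
  | .inr l, F => fun y => wderiv dir3 [.inr (.inl l)] (F y)

/-- Amplitudes with compact support in `η`. -/
structure IsAmp1 (R : ℝ) (M : ℕ) (F : Rn n → R3 n → ℂ) : Prop where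
  smooth : ∀ y, ContDiff ℝ ∞ (F y)
  cont : ∀ w, Continuous fun q : Rn n × R3 n => wderiv dir3 w (F q.1) q.2
  supp : ∀ y p, R < ‖p.2.2‖ → F y p = 0
  bound : ∀ w, ∃ C, 0 ≤ C ∧ ∀ y p, ‖wderiv dir3 w (F y) p‖ ≤ C * (1 + ‖p.1 - y‖) ^ M

/-- The coordinate functionals of `ℝⁿ × ℝⁿ`. -/
def coord2 (i : Fin n ⊕ Fin n) : Rn n × Rn n →L[ℝ] ℝ :=
  Sum.elim (fun i => (EuclideanSpace.proj i).comp (ContinuousLinearMap.fst ℝ _ _))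
    (fun i => (EuclideanSpace.proj i).comp (ContinuousLinearMap.snd ℝ _ _)) i

lemma coord2_dir2 (i j : Fin n ⊕ Fin n) :
    coord2 i (dir2 j) = if i = j then 1 else 0 := by
  rcases i with i | i <;> rcases j with j | j <;>
    simp [coord2, dir2, bv]

lemma sum_coord2_smulRight_apply (g : Fin n ⊕ Fin n → ℂ) (j : Fin n ⊕ Fin n) :
    (∑ i, (coord2 i).smulRight (g i)) (dir2 j) = g j := by
  simp only [sum_apply, ContinuousLinearMap.smulRight_apply, coord2_dir2]
  simp

/-- Differentiation under the integral sign when the differential is given by its `2n` coordinates: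
it suffices to dominate each coordinate near the point. -/
lemma hasFDerivAt_integral_coord2 {G : Rn n × Rn n → Rn n → ℂ}
    {G' : Fin n ⊕ Fin n → Rn n × Rn n → Rn n → ℂ} {p₀ : Rn n × Rn n} {bd : Rn n → ℝ}
    (hm : ∀ p, AEStronglyMeasurable (G p) volume) (hi : Integrable (G p₀))
    (hm' : ∀ i, AEStronglyMeasurable (G' i p₀) volume)
    (hb : ∀ i p y, p ∈ Metric.ball p₀ 1 → ‖G' i p y‖ ≤ bd y) (hbi : Integrable bd)
    (hd : ∀ p y, HasFDerivAt (fun p => G p y) (∑ i, (coord2 i).smulRight (G' i p y)) p) :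
    HasFDerivAt (fun p => ∫ y, G p y) (∑ i, (coord2 i).smulRight (∫ y, G' i p₀ y)) p₀ := by
  have hG'i : ∀ i, Integrable (G' i p₀) := fun i =>
    hbi.mono' (hm' i) (Filter.Eventually.of_forall fun y => hb i p₀ y (Metric.mem_ball_self one_pos))
  have hmeas : ∀ i, AEStronglyMeasurable (fun y => (coord2 i).smulRight (G' i p₀ y)) volume :=
    fun i => (ContinuousLinearMap.smulRightL ℝ (Rn n × Rn n) ℂ (coord2 i)).continuous.comp_aestronglyMeasurable
      (hm' i)
  have h := hasFDerivAt_integral_of_dominated_of_fderiv_le (𝕜 := ℝ) (μ := volume)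
    (F := G) (F' := fun p y => ∑ i, (coord2 i).smulRight (G' i p y)) (x₀ := p₀)
    (s := Metric.ball p₀ 1) (bound := fun y => (∑ i : Fin n ⊕ Fin n, ‖coord2 i‖) * bd y)
    (Metric.ball_mem_nhds _ one_pos) (Filter.Eventually.of_forall hm) hi
    (Finset.aestronglyMeasurable_fun_sum _ fun i _ => hmeas i)
    (Filter.Eventually.of_forall fun y p hp => ?_) (hbi.const_mul _)
    (Filter.Eventually.of_forall fun y p _ => hd p y)
  · refine h.congr_fderiv ?_
    rw [integral_finsetSum _ fun i _ => ?_]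
    · refine Finset.sum_congr rfl fun i _ => ?_
      exact (ContinuousLinearMap.smulRightL ℝ (Rn n × Rn n) ℂ (coord2 i)).integral_comp_comm (hG'i i)
    · exact (ContinuousLinearMap.smulRightL ℝ (Rn n × Rn n) ℂ (coord2 i)).integrable_comp (hG'i i)
  · refine (norm_sum_le _ _).trans ?_
    rw [Finset.sum_mul]
    refine Finset.sum_le_sum fun i _ => ?_
    rw [ContinuousLinearMap.norm_smulRight_apply]
    exact mul_le_mul_of_nonneg_left (hb i p y hp) (norm_nonneg _)

/-- The linear function `η ↦ i η_l`. -/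
def ietaL (l : Fin n) : R3 n →L[ℝ] ℂ :=
  (((EuclideanSpace.proj l : Rn n →L[ℝ] ℝ).comp
    ((ContinuousLinearMap.snd ℝ (Rn n) (Rn n)).comp (ContinuousLinearMap.snd ℝ (Rn n) _))).smulRight
      Complex.I)

lemma ietaL_apply (l : Fin n) (p : R3 n) : ietaL l p = Complex.I * (p.2.2 l : ℝ) := by
  simp [ietaL, mul_comm]

lemma wderiv_clm {E ι : Type*} [NormedAddCommGroup E] [NormedSpace ℝ E] (A : E →L[ℝ] ℂ)
    (v : ι → E) (w : List ι) :
    wderiv v w A = match w with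
      | [] => A
      | [i] => fun _ => A (v i)
      | _ => fun _ => 0 := by
  rcases w.eq_nil_or_concat with rfl | ⟨w, i, rfl⟩
  · rfl
  · rw [List.concat_eq_append, wderiv_append]
    have h1 : wderiv v [i] A = fun _ => A (v i) := by
      funext x; simp [wderiv_cons]
    rw [h1]
    rcases eq_or_ne w [] with rfl | hw
    · rfl
    · rw [wderiv_const v hw]
      match w with
      | [] => exact absurd rfl hw
      | [j] => rfl
      | j :: k :: w => rfl

lemma abs_coord_le_norm (η : Rn n) (l : Fin n) : |η l| ≤ ‖η‖ := by
  simpa using PiLp.norm_apply_le η l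

/-- On the support `‖η‖ ≤ R` the new factor `iη_l` and its derivatives are at most `R + 1`; off the
support nothing has to be shown. -/
lemma IsAmp1.ampD {R : ℝ} {M : ℕ} {F : Rn n → R3 n → ℂ} (hR : 0 ≤ R) (hF : IsAmp1 R M F)
    (i : Fin n ⊕ Fin n) : IsAmp1 R M (ampD i F) := by
  have hsupp : ∀ w y (p : R3 n), R < ‖p.2.2‖ → wderiv dir3 w (F y) p = 0 := by
    intro w y p hp
    refine wderiv_eq_zero_of_isClosed (S := {p : R3 n | ‖p.2.2‖ ≤ R})
      (isClosed_le (by fun_prop) continuous_const) (fun q hq => hF.supp y q ?_) w ?_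
    · simpa using hq
    · simpa using hp
  cases i with
  | inr l =>
    refine ⟨fun y => contDiff_wderiv (hF.smooth y) _, fun w => ?_, fun y p hp => hsupp _ y p hp,
      fun w => ?_⟩
    · have := hF.cont (w ++ [.inr (.inl l)])
      simp only [wderiv_append] at this
      exact this
    · have := hF.bound (w ++ [.inr (.inl l)])
      simp only [wderiv_append] at this
      exact this
  | inl l =>
    have hfun : ∀ y, PsiDO.ampD (.inl l) F y =
        fun p => wderiv dir3 [.inl l] (F y) p + ietaL l p * F y p := by
      intro y; funext p; simp [PsiDO.ampD, ietaL_apply]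
    have hw : ∀ w y, wderiv dir3 w (PsiDO.ampD (.inl l) F y) = fun p =>
        wderiv dir3 (w ++ [.inl l]) (F y) p + ((splits w).map fun s =>
          wderiv dir3 s.1 (ietaL l) p * wderiv dir3 s.2 (F y) p).sum := by
      intro w y
      rw [hfun, wderiv_add (contDiff_wderiv (hF.smooth y) _)
        ((ietaL l).contDiff.mul (hF.smooth y)), wderiv_mul (ietaL l).contDiff (hF.smooth y),
        wderiv_append]
    refine ⟨fun y => ?_, fun w => ?_, fun y p hp => ?_, fun w => ?_⟩
    · rw [hfun]
      exact (contDiff_wderiv (hF.smooth y) _).add ((ietaL l).contDiff.mul (hF.smooth y))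
    · simp_rw [hw]
      refine (hF.cont _).add ?_
      refine continuous_list_sum _ fun s _ => ?_
      exact ((contDiff_wderiv (ietaL l).contDiff s.1).continuous.comp continuous_snd).mul (hF.cont _)
    · rw [hfun]
      simp only [hsupp _ y p hp, hF.supp y p hp]
      ring
    · choose C hC hb using hF.bound
      have hη : ∀ w (p : R3 n), ‖p.2.2‖ ≤ R → ‖wderiv dir3 w (ietaL l) p‖ ≤ R + 1 := by
        intro w p hp
        rw [wderiv_clm]
        match w with
        | [] =>
          dsimp only
          rw [ietaL_apply, norm_mul, Complex.norm_I, one_mul, Complex.norm_real, Real.norm_eq_abs]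
          linarith [abs_coord_le_norm p.2.2 l]
        | [i] =>
          dsimp only
          rw [ietaL_apply, norm_mul, Complex.norm_I, one_mul, Complex.norm_real, Real.norm_eq_abs]
          refine (abs_coord_le_norm _ l).trans ?_
          rcases i with i | i | i <;> simp [dir3, norm_bv] <;> linarith
        | i :: j :: w => simp; linarith
      refine ⟨C (w ++ [.inl l]) + (((splits w).map fun s => (R + 1) * C s.2).sum), ?_, ?_⟩
      · refine add_nonneg (hC _) (List.sum_nonneg ?_)
        simp only [List.mem_map, forall_exists_index, and_imp]
        rintro _ s _ rfl
        exact mul_nonneg (by linarith) (hC _)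
      · intro y p
        rw [hw, add_mul]
        refine (norm_add_le _ _).trans (add_le_add (hb _ y p) ?_)
        generalize splits w = L
        induction L with
        | nil => simp
        | cons s L ih =>
          simp only [List.map_cons, List.sum_cons]
          rw [add_mul]
          refine (norm_add_le _ _).trans (add_le_add ?_ ih)
          rw [norm_mul]
          by_cases hp : ‖p.2.2‖ ≤ R
          · rw [mul_assoc]
            exact mul_le_mul (hη _ p hp) (hb _ y p) (norm_nonneg _) (by linarith)
          · rw [hsupp _ y p (not_le.1 hp), norm_zero, mul_zero]
            have := hC s.2
            positivity

lemma IsAmp1.slice_smooth {R : ℝ} {M : ℕ} {F : Rn n → R3 n → ℂ} (hF : IsAmp1 R M F)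
    (x ξ y : Rn n) : ContDiff ℝ ∞ fun η => F y (x, ξ, η) :=
  (hF.smooth y).comp (contDiff_const.prodMk (contDiff_const.prodMk contDiff_id))

lemma pderivs_slice {f : R3 n → ℂ} (hf : ContDiff ℝ ∞ f) (x ξ : Rn n) (w : List (Fin n))
    (η : Rn n) :
    pderivs w (fun η => f (x, ξ, η)) η = wderiv dir3 (w.map fun i => .inr (.inr i)) f (x, ξ, η) := by
  have h := wderiv_comp_affine (v := bv) hf
    ((ContinuousLinearMap.inr ℝ (Rn n) (Rn n × Rn n)).comp
      (ContinuousLinearMap.inr ℝ (Rn n) (Rn n))) (x, ξ, 0) w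
  have h2 : ∀ η : Rn n, ((ContinuousLinearMap.inr ℝ (Rn n) (Rn n × Rn n)).comp
      (ContinuousLinearMap.inr ℝ (Rn n) (Rn n))) η + (x, ξ, 0) = (x, ξ, η) := by
    intro η; simp
  simp_rw [h2] at h
  rw [pderivs_eq_wderiv_bv, h]
  have h3 := wderiv_smul_dir (v' := dir3) hf (fun _ : Fin n => 1) (fun i => .inr (.inr i)) w
  simp only [one_smul, List.map_const', List.prod_replicate, one_pow, Complex.ofReal_one,
    one_mul] at h3
  exact congrFun h3 _

lemma IsAmp1.continuous_integrand {R : ℝ} {M : ℕ} {F : Rn n → R3 n → ℂ} (hF : IsAmp1 R M F)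
    (x ξ : Rn n) : Continuous fun q : Rn n × Rn n => osc (x - q.1) q.2 * F q.1 (x, ξ, q.2) := by
  refine (continuous_osc (by fun_prop) continuous_snd).mul ?_
  exact (hF.cont []).comp (continuous_fst.prodMk (by fun_prop))

lemma IsAmp1.measurable_kerJ {R : ℝ} {M : ℕ} {F : Rn n → R3 n → ℂ} (hF : IsAmp1 R M F)
    (x ξ : Rn n) : StronglyMeasurable (kerJ F x ξ) :=
  (hF.continuous_integrand x ξ).stronglyMeasurable.integral_prod_right

/-- A derivative in `x` also hits `e^{i(x-y)·η}` and brings down `iη_l`, which explains the second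
term of `ampD`. A derivative in `ξ` sees the amplitude only. -/
lemma IsAmp1.hasFDerivAt_integrand {R : ℝ} {M : ℕ} {F : Rn n → R3 n → ℂ}
    (hF : IsAmp1 R M F) (p : Rn n × Rn n) (y η : Rn n) :
    HasFDerivAt (fun p : Rn n × Rn n => osc (p.1 - y) η * F y (p.1, p.2, η))
      (∑ i, (coord2 i).smulRight (osc (p.1 - y) η * PsiDO.ampD i F y (p.1, p.2, η))) p := by
  have h1 : HasFDerivAt (fun p : Rn n × Rn n => p.1 - y) (ContinuousLinearMap.fst ℝ (Rn n) (Rn n)) p :=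
    hasFDerivAt_fst.sub_const y
  have h2 := HasFDerivAt.comp (g := fun z => osc z η) p (hasFDerivAt_osc_left (p.1 - y) η) h1
  have h3 : HasFDerivAt (fun p : Rn n × Rn n => (p.1, p.2, η))
      ((ContinuousLinearMap.fst ℝ (Rn n) (Rn n)).prod ((ContinuousLinearMap.snd ℝ (Rn n) (Rn n)).prod 0)) p :=
    hasFDerivAt_fst.prodMk (hasFDerivAt_snd.prodMk (hasFDerivAt_const η p))
  have h4 := HasFDerivAt.comp (g := F y) p
    (differentiable_of_smooth (hF.smooth y) (p.1, p.2, η)).hasFDerivAt h3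
  have h5 : HasFDerivAt (fun p : Rn n × Rn n => osc (p.1 - y) η * F y (p.1, p.2, η)) _ p :=
    h2.mul h4
  refine h5.congr_fderiv ?_
  rw [← h5.fderiv, fderiv_eq_sum_dir2, h5.fderiv]
  refine Finset.sum_congr rfl fun i _ => ?_
  congr 1
  rcases i with l | l
  · simp [dir2, PsiDO.ampD, wderiv_cons, dir3, inner_bv]
    ring
  · simp [dir2, PsiDO.ampD, wderiv_cons, dir3]

lemma IsAmp1.continuous_slice {R : ℝ} {M : ℕ} {F : Rn n → R3 n → ℂ} (hF : IsAmp1 R M F)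
    (p : Rn n × Rn n) (y : Rn n) : Continuous fun η => osc (p.1 - y) η * F y (p.1, p.2, η) := by
  refine (continuous_osc continuous_const continuous_id).mul ?_
  exact (hF.slice_smooth p.1 p.2 y).continuous

lemma one_add_norm_sub_le {p p₀ : Rn n × Rn n} (hp : p ∈ Metric.ball p₀ 1) (y : Rn n) :
    1 + ‖p.1 - y‖ ≤ 2 + ‖p₀.1 - y‖ := by
  have h2 : ‖p.1 - p₀.1‖ ≤ 1 := (norm_fst_le (p - p₀)).trans (mem_ball_iff_norm.1 hp).le
  have h3 := norm_add_le (p.1 - p₀.1) (p₀.1 - y)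
  rw [sub_add_sub_cancel] at h3
  linarith

lemma IsAmp1.hasFDerivAt_kerJ {R : ℝ} {M : ℕ} {F : Rn n → R3 n → ℂ} (hR : 0 ≤ R)
    (hF : IsAmp1 R M F) (p₀ : Rn n × Rn n) (y : Rn n) :
    HasFDerivAt (fun p : Rn n × Rn n => kerJ F p.1 p.2 y)
      (∑ i, (coord2 i).smulRight (kerJ (PsiDO.ampD i F) p₀.1 p₀.2 y)) p₀ := by
  have hD := fun i => hF.ampD hR i
  choose C hC hb using fun i => (hD i).bound []
  have hC' : 0 ≤ ∑ i, C i := Finset.sum_nonneg fun i _ => hC i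
  have hbd : ∀ i (p : Rn n × Rn n) (η : Rn n), p ∈ Metric.ball p₀ 1 →
      ‖osc (p.1 - y) η * PsiDO.ampD i F y (p.1, p.2, η)‖ ≤
        Set.indicator (Metric.closedBall 0 R) (fun _ => (∑ i, C i) * (2 + ‖p₀.1 - y‖) ^ M) η := by
    intro i p η hp
    rw [norm_mul, norm_osc, one_mul]
    by_cases hη : ‖η‖ ≤ R
    · rw [Set.indicator_of_mem (by simpa using hη)]
      refine (hb i y (p.1, p.2, η)).trans ?_
      have h3 : C i ≤ ∑ i, C i := Finset.single_le_sum (fun i _ => hC i) (Finset.mem_univ i)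
      exact mul_le_mul h3 (pow_le_pow_left₀ (by positivity) (one_add_norm_sub_le hp y) M)
        (by positivity) hC'
    · rw [(hD i).supp y (p.1, p.2, η) (not_le.1 hη), norm_zero]
      refine Set.indicator_nonneg (fun _ _ => ?_) _
      positivity
  have hbi : Integrable
      (Set.indicator (Metric.closedBall (0 : Rn n) R) fun _ => (∑ i, C i) * (2 + ‖p₀.1 - y‖) ^ M) :=
    (integrable_indicator_iff measurableSet_closedBall).2
      (integrableOn_const measure_closedBall_lt_top.ne)
  have hi : Integrable fun η => osc (p₀.1 - y) η * F y (p₀.1, p₀.2, η) := by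
    refine integrable_of_continuous_of_zero_off_ball (R := R) (hF.continuous_slice p₀ y) fun η hη => ?_
    rw [hF.supp y (p₀.1, p₀.2, η) hη, mul_zero]
  exact hasFDerivAt_integral_coord2
    (G := fun p η => osc (p.1 - y) η * F y (p.1, p.2, η))
    (G' := fun i p η => osc (p.1 - y) η * PsiDO.ampD i F y (p.1, p.2, η))
    (fun p => (hF.continuous_slice p y).aestronglyMeasurable) hi
    (fun i => ((hD i).continuous_slice p₀ y).aestronglyMeasurable) hbd hbi
    (fun p η => hF.hasFDerivAt_integrand p y η)

end Amplitudes

/-! ### Dyadic families of amplitudes define symbols. -/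

section AmplitudeFamilies

/-- The constant in the kernel bound. -/
def cJ (n N : ℕ) : ℝ := 2 ^ N * (1 + n ^ N * n) * ballVol n

lemma cJ_nonneg (n N : ℕ) : 0 ≤ cJ n N := by
  unfold cJ ballVol; positivity

lemma norm_kerJ_le {F : Rn n → R3 n → ℂ} {y : Rn n} (hF : ContDiff ℝ ∞ (F y)) {R B : ℝ} (hR : 0 < R)
    (h0 : ∀ p, R < ‖p.2.2‖ → F y p = 0) (N : ℕ) (x ξ : Rn n) (hB : ∀ η, ‖F y (x, ξ, η)‖ ≤ B)
    (hBN : ∀ j η, R ^ N * ‖wderiv dir3 (List.replicate N (.inr (.inr j))) (F y) (x, ξ, η)‖ ≤ B) :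
    (1 + R * ‖x - y‖) ^ N * ‖kerJ F x ξ y‖ ≤ cJ n N * (R ^ n * B) := by
  have h := weighted_norm_integral_osc_le_of_ball (G := fun η => F y (x, ξ, η))
    (hF.comp (contDiff_const.prodMk (contDiff_const.prodMk contDiff_id))) N hR
    (fun η hη => h0 (x, ξ, η) hη) hB (fun j η => ?_) (x - y)
  · refine h.trans (le_of_eq ?_)
    rw [cJ]; ring
  · rw [pderivs_slice hF, List.map_replicate]
    exact hBN j η

lemma integrable_inv_one_add_norm_pow : Integrable fun y : Rn n => ((1 + ‖y‖) ^ (n + 1))⁻¹ := by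
  have h := integrable_one_add_norm (E := Rn n) (μ := volume) (r := n + 1) (by simp)
  refine h.congr (Filter.Eventually.of_forall fun y => ?_)
  dsimp only
  rw [Real.rpow_neg (by positivity)]
  norm_cast

lemma integrable_inv_one_add_norm_sub_pow {s : ℝ} (hs : 0 < s) (x : Rn n) :
    Integrable fun y : Rn n => ((1 + s * ‖x - y‖) ^ (n + 1))⁻¹ := by
  have h1 := (integrable_inv_one_add_norm_pow (n := n)).comp_smul hs.ne'
  have h2 := h1.comp_sub_left x
  refine h2.congr (Filter.Eventually.of_forall fun y => ?_)
  simp [norm_smul, abs_of_pos hs]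

/-- The integral of the standard weight. -/
def wInt (n : ℕ) : ℝ := ∫ y : Rn n, ((1 + ‖y‖) ^ (n + 1))⁻¹

lemma wInt_nonneg (n : ℕ) : 0 ≤ wInt n := integral_nonneg fun y => by positivity

lemma integral_inv_one_add_norm_sub_pow {s : ℝ} (hs : 0 < s) (x : Rn n) :
    s ^ n * ∫ y : Rn n, ((1 + s * ‖x - y‖) ^ (n + 1))⁻¹ = wInt n := by
  rw [integral_sub_left_eq_self (fun y : Rn n => ((1 + s * ‖y‖) ^ (n + 1))⁻¹) volume x]
  have := Measure.integral_comp_smul volume (fun y : Rn n => ((1 + ‖y‖) ^ (n + 1))⁻¹) s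
  simp only [norm_smul, Real.norm_of_nonneg hs.le, finrank_euclideanSpace_fin] at this
  rw [this, smul_eq_mul, abs_of_pos (by positivity), ← mul_assoc, mul_inv_cancel₀ (by positivity),
    one_mul, wInt]

lemma IsAmp1.norm_kerJ_le {R : ℝ} {M : ℕ} {F : Rn n → R3 n → ℂ} (hR : 1 ≤ R) (hF : IsAmp1 R M F) :
    ∃ C, 0 ≤ C ∧ ∀ x ξ y, ‖kerJ F x ξ y‖ ≤ C * ((1 + ‖x - y‖) ^ (n + 1))⁻¹ := by
  -- `M` powers absorb the growth of the amplitude in `x - y`; the other `n + 1` make the kernel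
  -- integrable in `y`.
  set N := n + 1 + M
  choose C hC hb using hF.bound
  set K := C [] + R ^ N * ∑ j : Fin n, C (List.replicate N (.inr (.inr j)))
  have hK : 0 ≤ K := add_nonneg (hC _) (by
    have := Finset.sum_nonneg fun (j : Fin n) (_ : j ∈ Finset.univ) =>
      hC (List.replicate N (.inr (.inr j)))
    positivity)
  refine ⟨cJ n N * (R ^ n * K), by have := cJ_nonneg n N; positivity, fun x ξ y => ?_⟩
  have h := PsiDO.norm_kerJ_le (hF.smooth y) (zero_lt_one.trans_le hR) (hF.supp y) N x ξ
    (B := K * (1 + ‖x - y‖) ^ M) (fun η => ?_) (fun j η => ?_)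
  · have h1 : (1 + ‖x - y‖) ^ (n + 1) * (1 + ‖x - y‖) ^ M * ‖kerJ F x ξ y‖ ≤
        cJ n N * (R ^ n * K) * (1 + ‖x - y‖) ^ M := by
      rw [← pow_add]
      refine le_trans ?_ (h.trans (le_of_eq (by ring)))
      gcongr
      nlinarith [norm_nonneg (x - y)]
    rw [← div_eq_mul_inv, le_div_iff₀ (by positivity)]
    have h2 : 0 < (1 + ‖x - y‖) ^ M := by positivity
    nlinarith
  · refine (hb [] y (x, ξ, η)).trans ?_
    gcongr
    have := Finset.sum_nonneg fun (j : Fin n) (_ : j ∈ Finset.univ) =>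
      hC (List.replicate N (.inr (.inr j)))
    have : 0 ≤ R ^ N * ∑ j : Fin n, C (List.replicate N (.inr (.inr j))) := by positivity
    linarith
  · have h1 := hb (List.replicate N (.inr (.inr j))) y (x, ξ, η)
    have h2 : C (List.replicate N (.inr (.inr j))) ≤
        ∑ j : Fin n, C (List.replicate N (.inr (.inr j))) :=
      Finset.single_le_sum (f := fun j : Fin n => C (List.replicate N (.inr (.inr j))))
        (fun j _ => hC _) (Finset.mem_univ j)
    calc _ ≤ R ^ N * (C (List.replicate N (.inr (.inr j))) * (1 + ‖x - y‖) ^ M) := by gcongr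
      _ ≤ R ^ N * ((∑ j : Fin n, C (List.replicate N (.inr (.inr j)))) * (1 + ‖x - y‖) ^ M) := by
        gcongr
      _ ≤ _ := by
        rw [← mul_assoc]
        gcongr
        linarith [hC []]

lemma IsAmp1.integrable_kerJ {R : ℝ} {M : ℕ} {F : Rn n → R3 n → ℂ} (hR : 1 ≤ R) (hF : IsAmp1 R M F)
    (x ξ : Rn n) : Integrable (kerJ F x ξ) := by
  obtain ⟨C, hC, hb⟩ := hF.norm_kerJ_le hR
  have h := (integrable_inv_one_add_norm_sub_pow one_pos x).const_mul C
  simp only [one_mul] at h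
  exact h.mono' (hF.measurable_kerJ x ξ).aestronglyMeasurable
    (Filter.Eventually.of_forall fun y => hb x ξ y)

lemma IsAmp1.hasFDerivAt_opT {R : ℝ} {M : ℕ} {F : Rn n → R3 n → ℂ} (hR : 1 ≤ R)
    (hF : IsAmp1 R M F) (p₀ : Rn n × Rn n) :
    HasFDerivAt (Function.uncurry (opT F))
      (∑ i, (coord2 i).smulRight (opT (PsiDO.ampD i F) p₀.1 p₀.2)) p₀ := by
  have hD := fun i => hF.ampD (by linarith) i
  choose C hC hb using fun i => (hD i).norm_kerJ_le hR
  have hC' : 0 ≤ ∑ i, C i := Finset.sum_nonneg fun i _ => hC i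
  have key := hasFDerivAt_integral_coord2
    (G := fun p y => kerJ F p.1 p.2 y) (G' := fun i p y => kerJ (PsiDO.ampD i F) p.1 p.2 y)
    (p₀ := p₀) (bd := fun y => (∑ i, C i) * 2 ^ (n + 1) * ((1 + ‖p₀.1 - y‖) ^ (n + 1))⁻¹)
    (fun p => (hF.measurable_kerJ p.1 p.2).aestronglyMeasurable) (hF.integrable_kerJ hR _ _)
    (fun i => ((hD i).measurable_kerJ _ _).aestronglyMeasurable) ?_ ?_
    (fun p y => hF.hasFDerivAt_kerJ (by linarith) p y)
  · have h2 := key.const_mul ((((2 * Real.pi) ^ n : ℝ) : ℂ)⁻¹)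
    refine HasFDerivAt.congr_fderiv (f := Function.uncurry (opT F)) h2 ?_
    rw [Finset.smul_sum]
    refine Finset.sum_congr rfl fun i _ => ?_
    ext u <;> simp [opT] <;> ring
  · intro i p y hp
    refine (hb i p.1 p.2 y).trans ?_
    have h3 : C i ≤ ∑ i, C i := Finset.single_le_sum (fun i _ => hC i) (Finset.mem_univ i)
    rw [mul_assoc]
    refine mul_le_mul h3 ?_ (by positivity) hC'
    -- Moving the base point by at most 1 changes the weight by a factor at most 2, so the majorant
    -- can be centred at `p₀`.
    have h4 : (1 + ‖p₀.1 - y‖) ≤ 2 * (1 + ‖p.1 - y‖) := by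
      have := one_add_norm_sub_le (p := p₀) (p₀ := p) (Metric.mem_ball_comm.1 hp) y
      linarith [norm_nonneg (p.1 - y)]
    rw [inv_le_iff_one_le_mul₀ (by positivity), mul_right_comm, ← div_eq_mul_inv,
      le_div_iff₀ (by positivity), one_mul, ← mul_pow]
    gcongr
  · have h := (integrable_inv_one_add_norm_sub_pow one_pos p₀.1).const_mul ((∑ i, C i) * 2 ^ (n + 1))
    simpa only [one_mul] using h

/-- Families of amplitudes, adapted to the dyadic decomposition. -/
structure IsAmp (m : ℝ) (M : ℕ) (F : ℕ → Rn n → R3 n → ℂ) : Prop where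
  smooth : ∀ k y, ContDiff ℝ ∞ (F k y)
  cont : ∀ k w, Continuous fun q : Rn n × R3 n => wderiv dir3 w (F k q.1) q.2
  supp_eta : ∀ k y p, hlf k < ‖p.2.2‖ → F k y p = 0
  supp_xi : ∀ k y p, p.2.1 ∉ Shell k → F k y p = 0
  bdd : WBdd (P := ℕ × Rn n) dir3 wt3 (fun _ => Set.univ) (fun q _ => lam q.1)
    (fun q p => 1 + hlf q.1 * ‖p.1 - q.2‖) m M (fun q => F q.1 q.2)

lemma IsAmp.amp1 {m : ℝ} {M : ℕ} {F : ℕ → Rn n → R3 n → ℂ} (hF : IsAmp m M F) (k : ℕ) :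
    IsAmp1 (hlf k) M (F k) := by
  refine ⟨hF.smooth k, hF.cont k, hF.supp_eta k, fun w => ?_⟩
  obtain ⟨C, hC, h⟩ := hF.bdd w
  refine ⟨C * lam k ^ (m + wordWt wt3 w) * hlf k ^ M, ?_, fun y p => ?_⟩
  · have := lam_pos k
    have := hlf_pos k
    positivity
  · refine (h (k, y) p trivial).trans ?_
    dsimp only
    rw [mul_assoc (C * _), ← mul_pow]
    have := lam_pos k
    have h1 := one_le_hlf k
    gcongr
    nlinarith [norm_nonneg (p.1 - y)]

lemma one_le_q (q : ℕ × Rn n) (p : R3 n) : 1 ≤ 1 + hlf q.1 * ‖p.1 - q.2‖ := by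
  have := hlf_pos q.1
  have : 0 ≤ hlf q.1 * ‖p.1 - q.2‖ := by positivity
  linarith

/-- On `‖η‖ ≤ h_k` the factor `iη_l` is at most `λ^{1/2}`, and a derivative in `η` removes exactly
this half order. This is why an `x`-derivative of the oscillating factor costs only 1/2. -/
lemma wbdd_ietaL (l : Fin n) :
    WBdd (P := ℕ × Rn n) dir3 wt3 (fun q => {p : R3 n | ‖p.2.2‖ ≤ hlf q.1}) (fun q _ => lam q.1)
      (fun q p => 1 + hlf q.1 * ‖p.1 - q.2‖) (1 / 2) 0 (fun _ => ietaL l) := by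
  intro w
  refine ⟨1, zero_le_one, fun q p hp => ?_⟩
  rw [wderiv_clm, pow_zero, mul_one, one_mul]
  have hl := lam_pos q.1
  match w with
  | [] =>
    simp only [wordWt_nil, add_zero]
    rw [ietaL_apply, norm_mul, Complex.norm_I, one_mul, Complex.norm_real, Real.norm_eq_abs]
    exact (abs_coord_le_norm p.2.2 l).trans hp
  | [i] =>
    dsimp only
    rw [ietaL_apply, norm_mul, Complex.norm_I, one_mul, Complex.norm_real, Real.norm_eq_abs]
    rcases i with i | i | i
    · simp only [dir3, PiLp.zero_apply, abs_zero]; positivity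
    · simp only [dir3, PiLp.zero_apply, abs_zero]; positivity
    · refine (abs_coord_le_norm _ l).trans ?_
      simp [dir3, norm_bv, wt3]
  | i :: j :: w => simp only [norm_zero]; positivity

/-- Both terms of an `x`-derivative raise the order by 1/2, and a `ξ`-derivative lowers it by 1:
these are the weights of `S^m_{1,1/2}`. -/
lemma IsAmp.ampD {m : ℝ} {M : ℕ} {F : ℕ → Rn n → R3 n → ℂ} (hF : IsAmp m M F)
    (i : Fin n ⊕ Fin n) : IsAmp (m + wt2 (1 / 2) i) M (fun k => PsiDO.ampD i (F k)) := by
  have hA := fun k => (hF.amp1 k).ampD (hlf_pos k).le i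
  have hsupp : ∀ k w y (p : R3 n), p.2.1 ∉ Shell k → wderiv dir3 w (F k y) p = 0 := by
    intro k w y p hp
    exact wderiv_eq_zero_of_isClosed (S := {p : R3 n | p.2.1 ∈ Shell k})
      ((isClosed_shell k).preimage (by fun_prop)) (fun q hq => hF.supp_xi k y q hq) w hp
  refine ⟨fun k => (hA k).smooth, fun k => (hA k).cont, fun k => (hA k).supp, fun k y p hp => ?_, ?_⟩
  · cases i with
    | inl l => simp [PsiDO.ampD, hsupp k _ y p hp, hF.supp_xi k y p hp]
    | inr l => exact hsupp k _ y p hp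
  · cases i with
    | inr l =>
      have := hF.bdd.wderiv [.inr (.inl l)]
      simpa [wt3, wt2, PsiDO.ampD] using this
    | inl l =>
      have h1 := hF.bdd.wderiv [.inl l]
      have h2 := WBdd.mul (fun q _ => lam_pos q.1) one_le_q (fun _ => (ietaL l).contDiff)
        (fun q => hF.smooth q.1 q.2) (wbdd_ietaL l) (hF.bdd.mono_set fun _ => Set.subset_univ _)
      have h3 := WBdd.univ (fun q _ => lam_pos q.1) one_le_q
        (fun q => isClosed_le (by fun_prop) continuous_const)
        (fun q p hp => by rw [hF.supp_eta q.1 q.2 p (by simpa using hp), mul_zero]) h2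
      have h4 : wordWt (wt3 (n := n)) [.inl l] = 1 / 2 := by simp [wt3]
      rw [h4] at h1
      rw [zero_add, add_comm] at h3
      have h5 := WBdd.add (fun q : ℕ × Rn n => contDiff_wderiv (hF.smooth q.1 q.2) _)
        (fun q : ℕ × Rn n => (ietaL l).contDiff.mul (hF.smooth q.1 q.2)) h1 h3
      have h6 : (fun q : ℕ × Rn n => PsiDO.ampD (.inl l) (F q.1) q.2) =
          fun q p => wderiv dir3 [.inl l] (F q.1 q.2) p + ietaL l p * F q.1 q.2 p := by
        funext q p; simp [PsiDO.ampD, ietaL_apply]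
      rw [h6]
      exact h5

lemma hlf_pow_mul_lam_rpow (k N : ℕ) (m : ℝ) (j : Fin n) :
    hlf k ^ N * lam k ^ (m + wordWt wt3 (List.replicate N (.inr (.inr j) : Fin n ⊕ Fin n ⊕ Fin n))) =
      lam k ^ m := by
  have h1 : wordWt wt3 (List.replicate N (.inr (.inr j) : Fin n ⊕ Fin n ⊕ Fin n)) = -((N : ℝ) / 2) := by
    simp [wordWt, wt3]; ring
  rw [h1, hlf_pow, ← Real.rpow_add (lam_pos k)]
  ring_nf

/-- Each `η`-derivative gains `λ^{-1/2} = 1/h`, matching the radius `h` of the `η`-support.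
Integrating by parts `n + 1 + M` times gives `λ^m` times a bump of width `1/h` whose integral in `y`
does not depend on `h`; `y` is never differentiated. -/
lemma IsAmp.norm_kerJ_le {m : ℝ} {M : ℕ} {F : ℕ → Rn n → R3 n → ℂ} (hF : IsAmp m M F) :
    ∃ C, 0 ≤ C ∧ ∀ k x ξ y, ‖kerJ (F k) x ξ y‖ ≤
      C * lam k ^ m * (hlf k ^ n * ((1 + hlf k * ‖x - y‖) ^ (n + 1))⁻¹) := by
  set N := n + 1 + M
  choose C hC hb using hF.bdd
  set K := C [] + ∑ j : Fin n, C (List.replicate N (.inr (.inr j)))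
  have hS : 0 ≤ ∑ j : Fin n, C (List.replicate N (.inr (.inr j))) :=
    Finset.sum_nonneg fun j _ => hC _
  have hK : 0 ≤ K := add_nonneg (hC _) hS
  refine ⟨cJ n N * K, by have := cJ_nonneg n N; positivity, fun k x ξ y => ?_⟩
  have hl := lam_pos k
  have hh := hlf_pos k
  have h := PsiDO.norm_kerJ_le (hF.smooth k y) hh (hF.supp_eta k y) N x ξ
    (B := K * lam k ^ m * (1 + hlf k * ‖x - y‖) ^ M) (fun η => ?_) (fun j η => ?_)
  · rw [pow_add] at h
    rw [← mul_assoc, ← div_eq_mul_inv, le_div_iff₀ (by positivity)]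
    have h2 : 0 < (1 + hlf k * ‖x - y‖) ^ M := by positivity
    refine le_of_mul_le_mul_right ?_ h2
    calc _ = (1 + hlf k * ‖x - y‖) ^ (n + 1) * (1 + hlf k * ‖x - y‖) ^ M * ‖kerJ (F k) x ξ y‖ := by
          ring
      _ ≤ _ := h
      _ = _ := by ring
  · refine (hb [] (k, y) (x, ξ, η) trivial).trans ?_
    simp only [wordWt_nil, add_zero]
    gcongr
    linarith
  · have h1 := hb (List.replicate N (.inr (.inr j))) (k, y) (x, ξ, η) trivial
    have h2 : C (List.replicate N (.inr (.inr j))) ≤ K := by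
      have := Finset.single_le_sum (f := fun j : Fin n => C (List.replicate N (.inr (.inr j))))
        (fun j _ => hC _) (Finset.mem_univ j)
      linarith [hC []]
    dsimp only at h1
    calc _ ≤ hlf k ^ N * (C (List.replicate N (.inr (.inr j))) *
          lam k ^ (m + wordWt wt3 (List.replicate N (.inr (.inr j) : Fin n ⊕ Fin n ⊕ Fin n))) *
          (1 + hlf k * ‖x - y‖) ^ M) := by gcongr
      _ = C (List.replicate N (.inr (.inr j))) * lam k ^ m * (1 + hlf k * ‖x - y‖) ^ M := by
        rw [← hlf_pow_mul_lam_rpow k N m j]; ring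
      _ ≤ _ := by gcongr

lemma IsAmp.norm_opT_le {m : ℝ} {M : ℕ} {F : ℕ → Rn n → R3 n → ℂ} (hF : IsAmp m M F) :
    ∃ C, 0 ≤ C ∧ ∀ k x ξ, ‖opT (F k) x ξ‖ ≤ C * lam k ^ m := by
  obtain ⟨C, hC, hb⟩ := hF.norm_kerJ_le
  refine ⟨((2 * Real.pi) ^ n)⁻¹ * (C * wInt n), by have := wInt_nonneg n; positivity, fun k x ξ => ?_⟩
  have hl := lam_pos k
  have hh := hlf_pos k
  rw [opT, norm_mul, norm_inv, Complex.norm_real, Real.norm_of_nonneg (by positivity), mul_assoc]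
  gcongr
  have hi := ((integrable_inv_one_add_norm_sub_pow hh x).const_mul (hlf k ^ n)).const_mul
    (C * lam k ^ m)
  refine (norm_integral_le_of_norm_le hi (Filter.Eventually.of_forall fun y => hb k x ξ y)).trans ?_
  rw [integral_const_mul, integral_const_mul, integral_inv_one_add_norm_sub_pow hh]
  exact le_of_eq (by ring)

/-- The sum over the dyadic scales of the functions given by amplitudes. -/
def opS (F : ℕ → Rn n → R3 n → ℂ) (x ξ : Rn n) : ℂ := ∑' k, opT (F k) x ξ

lemma IsAmp.opT_eq_zero {m : ℝ} {M : ℕ} {F : ℕ → Rn n → R3 n → ℂ} (hF : IsAmp m M F) {k : ℕ}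
    {x ξ : Rn n} (h : ξ ∉ Shell k) : opT (F k) x ξ = 0 := by
  have : kerJ (F k) x ξ = fun _ => 0 := by
    funext y
    simp [kerJ, fun η => hF.supp_xi k y (x, ξ, η) h]
  simp [opT, this]

lemma IsAmp.fderiv_opS {m : ℝ} {M : ℕ} {F : ℕ → Rn n → R3 n → ℂ} (hF : IsAmp m M F)
    (p : Rn n × Rn n) (i : Fin n ⊕ Fin n) :
    DifferentiableAt ℝ (Function.uncurry (opS F)) p ∧
      fderiv ℝ (Function.uncurry (opS F)) p (dir2 i) = opS (fun k => PsiDO.ampD i (F k)) p.1 p.2 := by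
  have h := hasFDerivAt_tsum_shell (F := fun k => Function.uncurry (opT (F k))) (π := Prod.snd)
    continuous_snd (fun k p hp => hF.opT_eq_zero hp)
    (fun k p => ((hF.amp1 k).hasFDerivAt_opT (one_le_hlf k) p).differentiableAt) p (dir2 i)
  refine ⟨h.1, h.2.trans ?_⟩
  refine tsum_congr fun k => ?_
  rw [((hF.amp1 k).hasFDerivAt_opT (one_le_hlf k) p).fderiv, sum_coord2_smulRight_apply]

/-- The function given by a family of amplitudes of order `m` is a symbol of order `m`. -/
theorem IsAmp.isSymbol_opS {m : ℝ} {M : ℕ} {F : ℕ → Rn n → R3 n → ℂ} (hF : IsAmp m M F) :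
    IsSymbol m (1 / 2) (opS F) := by
  -- The index set consists of all pairs of an order and a family of amplitudes of that order, with
  -- the growth `M` fixed. It is closed under `ampD`.
  refine isSymbol_of_family (J := {q : ℝ × (ℕ → Rn n → R3 n → ℂ) // IsAmp q.1 M q.2})
    (fun j => j.1.1) (fun j => opS j.1.2) (1 / 2) ?_ ?_ ?_ ⟨(m, F), hF⟩
  · rintro ⟨⟨m, F⟩, hF⟩ p
    -- `IsAmp.fderiv_opS` needs a direction, and there is none for `n = 0`.
    by_cases h : Nonempty (Fin n)
    · exact (IsAmp.fderiv_opS hF p (.inl h.some)).1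
    · have := not_nonempty_iff.1 h
      have hs : Subsingleton (Rn n × Rn n) := inferInstance
      exact (hasFDerivAt_of_subsingleton _ _).differentiableAt
  · rintro ⟨⟨m, F⟩, hF⟩
    obtain ⟨C, hC, hb⟩ := IsAmp.norm_opT_le hF
    refine ⟨4 * (C * 4 ^ |m|), by positivity, fun x ξ => ?_⟩
    have := bracket_pos ξ
    refine (norm_tsum_le_of_shell (B := C * 4 ^ |m| * bracket ξ ^ m) (by positivity)
      (fun k hk => hF.opT_eq_zero hk) fun k hk => (hb k x ξ).trans ?_).trans
        (le_of_eq (by ring))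
    rw [mul_assoc]
    gcongr
    exact lam_rpow_le_of_mem_shell hk m
  · rintro ⟨⟨m, F⟩, hF⟩ i
    exact ⟨⟨(m + wt2 (1 / 2) i, fun k => PsiDO.ampD i (F k)), IsAmp.ampD hF i⟩, rfl,
      fun p => (IsAmp.fderiv_opS hF p i).2⟩

end AmplitudeFamilies

/-! ### Fourier inversion, decay and moments of the smoothing kernels. -/

section Fourier

open FourierTransform

lemma invHat_eq (g : Rn n → ℂ) (x : Rn n) :
    invHat g x = (((2 * Real.pi) ^ n : ℝ) : ℂ)⁻¹ * ∫ ξ, osc x ξ * g ξ := rfl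

lemma invHat_eq_fourierInv (g : Rn n → ℂ) :
    invHat g = 𝓕⁻ (fun v : Rn n => g ((2 * Real.pi) • v)) := by
  funext x
  have h := Measure.integral_comp_smul volume
    (fun ξ : Rn n => osc x ξ * g ξ) (2 * Real.pi)
  rw [finrank_euclideanSpace_fin, abs_of_pos (by positivity)] at h
  rw [Real.fourierInv_eq', invHat_eq]
  have h2 : ∀ v : Rn n, Complex.exp (↑(2 * Real.pi * inner ℝ v x) * Complex.I) •
      g ((2 * Real.pi) • v) = osc x ((2 * Real.pi) • v) * g ((2 * Real.pi) • v) := by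
    intro v
    rw [osc, inner_smul_right, real_inner_comm, smul_eq_mul, mul_comm Complex.I]
  simp_rw [h2]
  rw [h, Complex.real_smul, Complex.ofReal_inv]

lemma hat_eq_fourier (f : Rn n → ℂ) (ξ : Rn n) : hat f ξ = 𝓕 f ((2 * Real.pi)⁻¹ • ξ) := by
  rw [Real.fourier_eq', hat]
  congr 1 with x
  rw [smul_eq_mul, inner_smul_right]
  congr 2
  have : (Real.pi : ℂ) ≠ 0 := by exact_mod_cast Real.pi_ne_zero
  push_cast
  field_simp

/-- The Fourier inversion formula. -/
lemma hat_invHat {g : Rn n → ℂ} (hg : Continuous g) (hi : Integrable g)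
    (hi' : Integrable (invHat g)) : hat (invHat g) = g := by
  funext ξ
  have hpi : (2 * Real.pi) ≠ 0 := by positivity
  set g' := fun v : Rn n => g ((2 * Real.pi) • v) with hg'
  have h1 : Continuous g' := hg.comp (continuous_const_smul _)
  have h2 : Integrable g' := hi.comp_smul hpi
  have h3 : Integrable (𝓕 g') := by
    have : 𝓕 g' = fun v => invHat g (-v) := by
      funext v
      rw [invHat_eq_fourierInv, Real.fourierInv_eq_fourier_neg, neg_neg]
    rw [this]
    exact hi'.comp_neg
  rw [hat_eq_fourier, invHat_eq_fourierInv, h1.fourier_fourierInv_eq h2 h3, hg']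
  simp only [smul_smul, mul_inv_cancel₀ hpi, one_smul]

lemma continuous_invHat {g : Rn n → ℂ} (hi : Integrable g) : Continuous (invHat g) := by
  unfold invHat
  refine continuous_const.mul ?_
  refine continuous_of_dominated (bound := fun ξ => ‖g ξ‖)
    (fun x => ?_) (fun x => ?_) hi.norm ?_
  · exact (continuous_osc continuous_const continuous_id).aestronglyMeasurable.mul
      hi.aestronglyMeasurable
  · refine Filter.Eventually.of_forall fun ξ => ?_
    have := norm_osc x ξ
    rw [osc] at this
    rw [norm_mul, this, one_mul]
  · refine Filter.Eventually.of_forall fun ξ => ?_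
    exact (continuous_osc continuous_id continuous_const).mul continuous_const

/-- Rapid decay of the inverse Fourier transform of a test function. -/
lemma norm_invHat_le {g : Rn n → ℂ} (hg : ContDiff ℝ ∞ g) {R : ℝ}
    (h0 : ∀ η, R < ‖η‖ → g η = 0) (N : ℕ) :
    ∃ C, 0 ≤ C ∧ ∀ z, ‖invHat g z‖ ≤ C * ((1 + ‖z‖) ^ N)⁻¹ := by
  set L := ∫ η, ‖g η‖
  set L' := ∑ j : Fin n, ∫ η, ‖pderivs (List.replicate N j) g η‖
  have hL : 0 ≤ L := integral_nonneg fun _ => norm_nonneg _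
  have hLj : ∀ j : Fin n, 0 ≤ ∫ η, ‖pderivs (List.replicate N j) g η‖ :=
    fun j => integral_nonneg fun _ => norm_nonneg _
  have hL' : 0 ≤ L' := Finset.sum_nonneg fun j _ => hLj j
  refine ⟨((2 * Real.pi) ^ n)⁻¹ * (2 ^ N * (1 + n ^ N * n) * (L + L')), by positivity, fun z => ?_⟩
  have h := weighted_norm_integral_osc_le hg N (s := 1) (L := L + L') (fun j N' _ => ?_) one_pos
    (by linarith) (fun j => ?_) z
  · rw [invHat_eq, norm_mul, norm_inv, Complex.norm_real, Real.norm_of_nonneg (by positivity),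
      mul_assoc]
    gcongr
    rw [← div_eq_mul_inv, le_div_iff₀ (by positivity), mul_comm]
    simpa using h
  · exact integrable_of_continuous_of_zero_off_ball (contDiff_wderiv hg _).continuous
      (zero_off_ball_wderiv h0 _)
  · rw [one_pow, one_mul]
    have := Finset.single_le_sum (f := fun j : Fin n => ∫ η, ‖pderivs (List.replicate N j) g η‖)
      (fun j _ => hLj j) (Finset.mem_univ j)
    linarith

lemma integrable_weighted_invHat {g : Rn n → ℂ} (hg : ContDiff ℝ ∞ g) {R : ℝ}
    (h0 : ∀ η, R < ‖η‖ → g η = 0) (N : ℕ) :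
    Integrable fun z => (1 + ‖z‖) ^ N * ‖invHat g z‖ := by
  obtain ⟨C, hC, hb⟩ := norm_invHat_le hg h0 (n + 1 + N)
  have hi := integrable_of_continuous_of_zero_off_ball hg.continuous h0
  refine (integrable_inv_one_add_norm_pow.const_mul C).mono' ?_
    (Filter.Eventually.of_forall fun z => ?_)
  · exact (Continuous.mul (by fun_prop) (continuous_invHat hi).norm).aestronglyMeasurable
  · rw [Real.norm_of_nonneg (by positivity)]
    calc _ ≤ (1 + ‖z‖) ^ N * (C * ((1 + ‖z‖) ^ (n + 1 + N))⁻¹) := by gcongr; exact hb z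
      _ = _ := by rw [pow_add]; field_simp

lemma integrable_invHat {g : Rn n → ℂ} (hg : ContDiff ℝ ∞ g) {R : ℝ}
    (h0 : ∀ η, R < ‖η‖ → g η = 0) : Integrable (invHat g) := by
  have h := integrable_weighted_invHat hg h0 0
  simp only [pow_zero, one_mul] at h
  exact (integrable_norm_iff (continuous_invHat
    (integrable_of_continuous_of_zero_off_ball hg.continuous h0)).aestronglyMeasurable).1 h

lemma integral_invHat {g : Rn n → ℂ} (hg : ContDiff ℝ ∞ g) {R : ℝ}
    (h0 : ∀ η, R < ‖η‖ → g η = 0) : ∫ z, invHat g z = g 0 := by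
  have h := congrFun (hat_invHat hg.continuous
    (integrable_of_continuous_of_zero_off_ball hg.continuous h0) (integrable_invHat hg h0)) 0
  rw [← h, hat]
  simp

/-- Multiplying the inverse transform of `g` by `z_l` gives the inverse transform of `i ∂_l g`,
whose integral is the value of `i ∂_l g` at zero. -/
lemma integral_coord_mul_invHat {g : Rn n → ℂ} (hg : ContDiff ℝ ∞ g) {R : ℝ}
    (h0 : ∀ η, R < ‖η‖ → g η = 0) (l : Fin n) :
    ∫ z, ((z l : ℝ) : ℂ) * invHat g z = Complex.I * pderiv l g 0 := by
  have hs : ContDiff ℝ ∞ fun η => Complex.I * pderivs [l] g η :=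
    contDiff_const.mul (contDiff_wderiv hg [l])
  have hs0 : ∀ η, R < ‖η‖ → Complex.I * pderivs [l] g η = 0 := fun η hη => by
    rw [pderivs_eq_wderiv_bv, zero_off_ball_wderiv h0 [l] η hη, mul_zero]
  have h1 : ∀ z, ((z l : ℝ) : ℂ) * invHat g z = invHat (fun η => Complex.I * pderivs [l] g η) z := by
    intro z
    have h2 := integral_osc_mul_pderivs hg l 1 (fun N' _ =>
      integrable_of_continuous_of_zero_off_ball (contDiff_wderiv hg _).continuous
        (zero_off_ball_wderiv h0 _)) z
    simp only [List.replicate_one, pow_one] at h2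
    simp only [invHat_eq, mul_left_comm _ Complex.I]
    rw [integral_const_mul, h2]
    linear_combination (((z l : ℝ) : ℂ) * (((2 * Real.pi) ^ n : ℝ) : ℂ)⁻¹ *
      ∫ η, osc z η * g η) * Complex.I_mul_I
  simp_rw [h1]
  rw [integral_invHat hs hs0]
  rfl

lemma invHat_comp_inv_smul (g : Rn n → ℂ) {h : ℝ} (hh : 0 < h) (z : Rn n) :
    invHat (fun η => g (h⁻¹ • η)) z = ((h ^ n : ℝ) : ℂ) * invHat g (h • z) := by
  have h1 := Measure.integral_comp_inv_smul_of_nonneg volume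
    (fun η : Rn n => osc (h • z) η * g η) hh.le
  have h2 : ∀ η : Rn n, osc (h • z) (h⁻¹ • η) = osc z η := by
    intro η
    rw [osc, osc, inner_smul_left, inner_smul_right]
    congr 3
    simp only [conj_trivial]
    field_simp
  simp_rw [h2] at h1
  rw [invHat_eq, invHat_eq, h1, finrank_euclideanSpace_fin, Complex.real_smul]
  ring

end Fourier

/-! ### Functions of class `C^{1,1}` and Fourier multipliers applied to them. -/

section Holder

/-- Functions with bounds by `M` for the function and its first derivatives, and with Lipschitz
constants at most `M` of the first derivatives. -/
structure C11 (f : Rn n → ℂ) (M : ℝ) : Prop where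
  contDiff : ContDiff ℝ 1 f
  sup : ∀ x, ‖f x‖ ≤ M
  sup_deriv : ∀ i x, ‖pderiv i f x‖ ≤ M
  lip_deriv : ∀ i x y, ‖pderiv i f x - pderiv i f y‖ ≤ M * ‖x - y‖

variable {f g : Rn n → ℂ} {M M' : ℝ}

lemma C11.nonneg (hf : C11 f M) : 0 ≤ M := (norm_nonneg _).trans (hf.sup 0)

lemma C11.differentiable (hf : C11 f M) : Differentiable ℝ f :=
  hf.contDiff.differentiable (by simp)

lemma C11.mono (hf : C11 f M) (h : M ≤ M') : C11 f M' :=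
  ⟨hf.contDiff, fun x => (hf.sup x).trans h, fun i x => (hf.sup_deriv i x).trans h,
    fun i x y => (hf.lip_deriv i x y).trans (by gcongr)⟩

lemma norm_clm_le_sum (L : Rn n →L[ℝ] ℂ) {B : ℝ} (hB : 0 ≤ B) (h : ∀ i, ‖L (bv i)‖ ≤ B) :
    ‖L‖ ≤ n * B := by
  refine L.opNorm_le_bound (by positivity) fun u => ?_
  conv_lhs => rw [← sum_coord_bv u, map_sum]
  refine (norm_sum_le _ _).trans ?_
  calc ∑ i, ‖L (u i • bv i)‖ ≤ ∑ i : Fin n, B * ‖u‖ := by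
        refine Finset.sum_le_sum fun i _ => ?_
        rw [map_smul, norm_smul, mul_comm, Real.norm_eq_abs]
        exact mul_le_mul (h i) (abs_coord_le_norm u i) (abs_nonneg _) hB
    _ = _ := by simp; ring

lemma fderiv_eq_sum_pderiv (f : Rn n → ℂ) (x u : Rn n) :
    fderiv ℝ f x u = ∑ i, (u i : ℂ) * pderiv i f x := by
  conv_lhs => rw [← sum_coord_bv u, map_sum]
  simp [pderiv, bv]

lemma norm_sub_le_of_pderiv_le {f : Rn n → ℂ} (hf : Differentiable ℝ f) {B : ℝ} (hB : 0 ≤ B)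
    (h : ∀ i x, ‖pderiv i f x‖ ≤ B) (x y : Rn n) : ‖f x - f y‖ ≤ n * B * ‖x - y‖ :=
  Convex.norm_image_sub_le_of_norm_fderiv_le (𝕜 := ℝ) (fun z _ => hf z)
    (fun z _ => norm_clm_le_sum _ hB fun i => h i z) convex_univ (Set.mem_univ y) (Set.mem_univ x)

lemma C11.lip (hf : C11 f M) (x y : Rn n) : ‖f x - f y‖ ≤ n * M * ‖x - y‖ :=
  norm_sub_le_of_pderiv_le hf.differentiable hf.nonneg hf.sup_deriv x y

/-- The Taylor formula of order one. -/
lemma C11.taylor (hf : C11 f M) (x y : Rn n) :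
    ‖f y - f x - fderiv ℝ f x (y - x)‖ ≤ n * M * ‖y - x‖ ^ 2 := by
  have hd : ∀ z, HasFDerivAt (fun z => f z - fderiv ℝ f x z) (fderiv ℝ f z - fderiv ℝ f x) z :=
    fun z => (hf.differentiable z).hasFDerivAt.sub (fderiv ℝ f x).hasFDerivAt
  have hM := hf.nonneg
  have h := Convex.norm_image_sub_le_of_norm_hasFDerivWithin_le (𝕜 := ℝ)
    (f := fun z => f z - fderiv ℝ f x z) (s := Metric.closedBall x ‖y - x‖)
    (C := n * (M * ‖y - x‖)) (x := x) (y := y)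
    (fun z _ => (hd z).hasFDerivWithinAt) (fun z hz => ?_) (convex_closedBall _ _)
    (Metric.mem_closedBall_self (norm_nonneg _)) (by simp [dist_eq_norm])
  · rw [map_sub]
    refine le_trans (le_of_eq ?_) (h.trans (le_of_eq (by ring)))
    congr 1; ring
  · refine norm_clm_le_sum _ (by positivity) fun i => ?_
    refine (hf.lip_deriv i z x).trans ?_
    gcongr
    simpa [dist_eq_norm] using hz

lemma C11.add (hf : C11 f M) (hg : C11 g M') : C11 (fun x => f x + g x) (M + M') := by
  have hd : ∀ i x, pderiv i (fun x => f x + g x) x = pderiv i f x + pderiv i g x := fun i x => by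
    simp only [pderiv]
    rw [fderiv_fun_add (hf.differentiable x) (hg.differentiable x)]; rfl
  refine ⟨hf.contDiff.add hg.contDiff, fun x => ?_, fun i x => ?_, fun i x y => ?_⟩
  · exact (norm_add_le _ _).trans (add_le_add (hf.sup x) (hg.sup x))
  · rw [hd]; exact (norm_add_le _ _).trans (add_le_add (hf.sup_deriv i x) (hg.sup_deriv i x))
  · rw [hd, hd, add_sub_add_comm, add_mul]
    exact (norm_add_le _ _).trans (add_le_add (hf.lip_deriv i x y) (hg.lip_deriv i x y))

lemma C11.zero : C11 (fun _ : Rn n => (0 : ℂ)) 0 :=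
  ⟨contDiff_const, by simp, by simp [pderiv], by simp [pderiv]⟩

lemma C11.const (c : ℂ) : C11 (fun _ : Rn n => c) ‖c‖ :=
  ⟨contDiff_const, by simp, by simp [pderiv], fun i x y => by simp [pderiv]; positivity⟩

lemma norm_mul_sub_mul_le {a b a' b' : ℂ} {A B la lb : ℝ} (ha' : ‖a'‖ ≤ A)
    (hb : ‖b‖ ≤ B) (h1 : ‖a - a'‖ ≤ la) (h2 : ‖b - b'‖ ≤ lb) :
    ‖a * b - a' * b'‖ ≤ la * B + A * lb := by
  have : a * b - a' * b' = (a - a') * b + a' * (b - b') := by ring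
  rw [this]
  refine (norm_add_le _ _).trans (add_le_add ?_ ?_)
  · rw [norm_mul]; exact mul_le_mul h1 hb (norm_nonneg _) ((norm_nonneg _).trans h1)
  · rw [norm_mul]; exact mul_le_mul ha' h2 (norm_nonneg _) ((norm_nonneg _).trans ha')

lemma C11.mul (hf : C11 f M) (hg : C11 g M') :
    C11 (fun x => f x * g x) (2 * (1 + n) * (M * M')) := by
  have hM := hf.nonneg
  have hM' := hg.nonneg
  have hMM : 0 ≤ M * M' := mul_nonneg hM hM'
  have hn : (0 : ℝ) ≤ n := Nat.cast_nonneg n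
  have hd : ∀ i x, pderiv i (fun x => f x * g x) x = f x * pderiv i g x + pderiv i f x * g x := by
    intro i x
    simp only [pderiv]
    rw [fderiv_fun_mul (hf.differentiable x) (hg.differentiable x)]
    simp [mul_comm]
  refine ⟨hf.contDiff.mul hg.contDiff, fun x => ?_, fun i x => ?_, fun i x y => ?_⟩
  · rw [norm_mul]
    have := mul_le_mul (hf.sup x) (hg.sup x) (norm_nonneg _) hM
    nlinarith
  · rw [hd]
    refine (norm_add_le _ _).trans ?_
    rw [norm_mul, norm_mul]
    have h1 := mul_le_mul (hf.sup x) (hg.sup_deriv i x) (norm_nonneg _) hM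
    have h2 := mul_le_mul (hf.sup_deriv i x) (hg.sup x) (norm_nonneg _) hM
    nlinarith
  · rw [hd, hd, add_sub_add_comm]
    refine (norm_add_le _ _).trans ?_
    have h1 := norm_mul_sub_mul_le (hf.sup y) (hg.sup_deriv i x) (hf.lip x y) (hg.lip_deriv i x y)
    have h2 := norm_mul_sub_mul_le (hf.sup_deriv i y) (hg.sup x) (hf.lip_deriv i x y) (hg.lip x y)
    refine (add_le_add h1 h2).trans (le_of_eq ?_)
    ring

lemma C11.list_sum {J : Type*} (L : List J) {f : J → Rn n → ℂ} {M : J → ℝ}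
    (h : ∀ j ∈ L, C11 (f j) (M j)) : C11 (fun x => (L.map fun j => f j x).sum) (L.map M).sum := by
  induction L with
  | nil => simpa using C11.zero
  | cons j L ih =>
    simp only [List.map_cons, List.sum_cons]
    exact (h j (by simp)).add (ih fun i hi => h i (by simp [hi]))

/-- Expansion of a Fourier multiplier at scale `h` applied to a `C^{1,1}` function. -/
theorem norm_multiplier_sub_le {g : Rn n → ℂ} (hg : ContDiff ℝ ∞ g) {R : ℝ}
    (h0 : ∀ η, R < ‖η‖ → g η = 0) :
    ∃ C, 0 ≤ C ∧ ∀ (h : ℝ), 0 < h → ∀ (f : Rn n → ℂ) (M : ℝ), C11 f M → ∀ x,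
      ‖fourierMultiplier (fun η => g (h⁻¹ • η)) f x - (g 0 * f x -
        (Complex.I * (h⁻¹ : ℝ)) * ∑ l, pderiv l g 0 * pderiv l f x)‖ ≤ C * (h⁻¹ ^ 2 * M) := by
  have hw := integrable_weighted_invHat hg h0
  have hgi := integrable_of_continuous_of_zero_off_ball hg.continuous h0
  have hcont := continuous_invHat hgi
  refine ⟨n * ∫ z, (1 + ‖z‖) ^ 2 * ‖invHat g z‖, ?_, ?_⟩
  · exact mul_nonneg (Nat.cast_nonneg n) (integral_nonneg fun z => by positivity)
  intro h hh f M hf x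
  have hM := hf.nonneg
  -- After `z = h(x - y)` the kernel no longer depends on `h`, and `f` is evaluated at `x - z/h`,
  -- ready for Taylor expansion.
  have e1 : fourierMultiplier (fun η => g (h⁻¹ • η)) f x = ∫ z, invHat g z * f (x - h⁻¹ • z) := by
    have h1 : fourierMultiplier (fun η => g (h⁻¹ • η)) f x =
        ∫ z, invHat (fun η => g (h⁻¹ • η)) z * f (x - z) := by
      rw [← integral_sub_left_eq_self _ volume x]
      simp [fourierMultiplier]
    have h2 := Measure.integral_comp_smul_of_nonneg volume
      (fun z : Rn n => invHat g z * f (x - h⁻¹ • z)) h (hR := hh.le)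
    simp only [smul_smul, inv_mul_cancel₀ hh.ne', one_smul, finrank_euclideanSpace_fin] at h2
    rw [h1]
    simp_rw [invHat_comp_inv_smul g hh, mul_assoc]
    rw [integral_const_mul, h2, Complex.real_smul, ← mul_assoc, ← Complex.ofReal_mul,
      mul_inv_cancel₀ (by positivity), Complex.ofReal_one, one_mul]
  have i0 : Integrable (invHat g) := integrable_invHat hg h0
  have i1 : Integrable fun z => invHat g z * f (x - h⁻¹ • z) := by
    refine i0.mul_bdd (c := M) ?_ (Filter.Eventually.of_forall fun z => hf.sup _)
    exact (hf.contDiff.continuous.comp (by fun_prop)).aestronglyMeasurable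
  have i2 : Integrable fun z => invHat g z * f x := i0.mul_const _
  have i3l : ∀ l : Fin n, Integrable fun z : Rn n => ((z l : ℝ) : ℂ) * invHat g z := by
    intro l
    refine (hw 1).mono' ?_ (Filter.Eventually.of_forall fun z => ?_)
    · refine (Continuous.mul ?_ hcont).aestronglyMeasurable
      exact Complex.continuous_ofReal.comp (EuclideanSpace.proj l : Rn n →L[ℝ] ℝ).continuous
    · rw [norm_mul, Complex.norm_real, Real.norm_eq_abs, pow_one]
      gcongr
      linarith [abs_coord_le_norm z l]
  have e3 : ∀ z, invHat g z * fderiv ℝ f x (-(h⁻¹ • z)) =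
      ∑ l, (-((h⁻¹ : ℝ) : ℂ) * pderiv l f x) * (((z l : ℝ) : ℂ) * invHat g z) := by
    intro z
    rw [fderiv_eq_sum_pderiv, Finset.mul_sum]
    refine Finset.sum_congr rfl fun l _ => ?_
    simp
    ring
  have i3 : Integrable fun z => invHat g z * fderiv ℝ f x (-(h⁻¹ • z)) := by
    simp_rw [e3]
    exact integrable_finsetSum _ fun l _ => (i3l l).const_mul _
  -- The moments of order zero and one of the kernel are `g 0` and `i ∂_l g(0)`, so the integral of
  -- the first-order Taylor polynomial is the stated main term.
  have e4 : g 0 * f x - (Complex.I * (h⁻¹ : ℝ)) * ∑ l, pderiv l g 0 * pderiv l f x =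
      (∫ z, invHat g z * f x) + ∫ z, invHat g z * fderiv ℝ f x (-(h⁻¹ • z)) := by
    rw [integral_mul_const, integral_invHat hg h0]
    simp_rw [e3]
    rw [integral_finsetSum _ fun l _ => (i3l l).const_mul _]
    simp_rw [integral_const_mul, integral_coord_mul_invHat hg h0]
    rw [sub_eq_add_neg, Finset.mul_sum, ← Finset.sum_neg_distrib]
    congr 1
    refine Finset.sum_congr rfl fun l _ => ?_
    ring
  have i23 : Integrable fun z => invHat g z * f x + invHat g z * fderiv ℝ f x (-(h⁻¹ • z)) :=
    i2.add i3
  rw [e4, e1, ← integral_add i2 i3, ← integral_sub i1 i23]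
  have hb : ∀ z, ‖invHat g z * f (x - h⁻¹ • z) -
      (invHat g z * f x + invHat g z * fderiv ℝ f x (-(h⁻¹ • z)))‖ ≤
      (n * M * h⁻¹ ^ 2) * ((1 + ‖z‖) ^ 2 * ‖invHat g z‖) := by
    intro z
    have ht := hf.taylor x (x - h⁻¹ • z)
    rw [sub_sub_cancel_left, norm_neg, norm_smul, Real.norm_of_nonneg (by positivity)] at ht
    have : invHat g z * f (x - h⁻¹ • z) -
        (invHat g z * f x + invHat g z * fderiv ℝ f x (-(h⁻¹ • z))) =
        invHat g z * (f (x - h⁻¹ • z) - f x - fderiv ℝ f x (-(h⁻¹ • z))) := by ring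
    rw [this, norm_mul]
    calc _ ≤ ‖invHat g z‖ * (n * M * (h⁻¹ * ‖z‖) ^ 2) := by gcongr
      _ = (n * M * h⁻¹ ^ 2) * (‖z‖ ^ 2 * ‖invHat g z‖) := by ring
      _ ≤ _ := by
        gcongr
        linarith
  refine (norm_integral_le_of_norm_le ((hw 2).const_mul _)
    (Filter.Eventually.of_forall hb)).trans (le_of_eq ?_)
  rw [integral_const_mul]
  ring

end Holder

/-! ### The class `C^{1,1}S^m_{1,0}`. -/

section Rough

/-- The class `C^{1,1} S^m_{1,0}`. -/
structure Rough (m : ℝ) (u : Rn n → Rn n → ℂ) : Prop where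
  smooth : ∀ x, ContDiff ℝ ∞ (u x)
  bdd : ∀ α : List (Fin n), ∃ C, 0 ≤ C ∧
    ∀ ξ, C11 (fun x => dxi α u x ξ) (C * bracket ξ ^ (m - α.length))

/-- With `s ∈ (0,1]` an integer `r` is split as `(r - 1) + 1`: one derivative, which is Lipschitz.
So `C^2_-` is `C^{1,1}`. -/
lemma intPart_two : intPart 2 = 1 := by
  simp [intPart]

lemma intPart_one : intPart 1 = 0 := by simp [intPart]

lemma holderPart_two : holderPart 2 = 1 := by rw [holderPart, intPart_two]; norm_num

lemma holderPart_one : holderPart 1 = 1 := by rw [holderPart, intPart_one]; norm_num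

lemma CrNormLE.c11 {f : Rn n → ℂ} {M : ℝ} (h : CrNormLE 2 f M) : C11 f M := by
  obtain ⟨h1, M₀, M₁, h0, h0', hM, hs, hl⟩ := h
  rw [intPart_two] at h1 hs hl
  rw [holderPart_two] at hl
  refine ⟨by exact_mod_cast h1, fun x => (hs [] (by simp) x).trans (by linarith),
    fun i x => (hs [i] (by simp) x).trans (by linarith), fun i x y => (hl [i] rfl x y).trans ?_⟩
  rw [Real.rpow_one]
  gcongr
  linarith

lemma crNormLE_two {f : Rn n → ℂ} {M₀ M₁ M : ℝ} (hc : ContDiff ℝ 1 f) (hM : M₀ + M₁ ≤ M)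
    (h0 : 0 ≤ M₀) (h1 : 0 ≤ M₁) (hs : ∀ x, ‖f x‖ ≤ M₀) (hd : ∀ i x, ‖pderiv i f x‖ ≤ M₀)
    (hl : ∀ i x y, ‖pderiv i f x - pderiv i f y‖ ≤ M₁ * ‖x - y‖) : CrNormLE 2 f M := by
  refine ⟨by rw [intPart_two]; exact_mod_cast hc, M₀, M₁, h0, h1, hM, fun w hw x => ?_,
    fun w hw x y => ?_⟩
  · rw [intPart_two] at hw
    match w, hw with
    | [], _ => exact hs x
    | [i], _ => exact hd i x
  · rw [intPart_two] at hw
    rw [holderPart_two, Real.rpow_one]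
    match w, hw with
    | [i], _ => exact hl i x y

lemma crNormLE_one {f : Rn n → ℂ} {M₀ M₁ M : ℝ} (hc : Continuous f) (hM : M₀ + M₁ ≤ M)
    (h0 : 0 ≤ M₀) (h1 : 0 ≤ M₁) (hs : ∀ x, ‖f x‖ ≤ M₀)
    (hl : ∀ x y, ‖f x - f y‖ ≤ M₁ * ‖x - y‖) : CrNormLE 1 f M := by
  refine ⟨by rw [intPart_one]; exact_mod_cast contDiff_zero.2 hc, M₀, M₁, h0, h1, hM,
    fun w hw x => ?_, fun w hw x y => ?_⟩
  · rw [intPart_one] at hw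
    match w, hw with
    | [], _ => exact hs x
  · rw [intPart_one] at hw
    rw [holderPart_one, Real.rpow_one]
    match w, hw with
    | [], _ => exact hl x y

/-- For `δ = 0` all bounds have the same right-hand order, and the one in `C^2_-` already contains
the others. -/
lemma IsRoughSymbol.rough {m : ℝ} {u : Rn n → Rn n → ℂ} (h : IsRoughSymbol 2 m 0 u) :
    Rough m u := by
  refine ⟨h.1, fun α => ?_⟩
  obtain ⟨C, hC, -, h2, -⟩ := h.2 α
  refine ⟨C, hC, fun ξ => ?_⟩
  simpa using (h2 ξ).c11

/-- Rough symbols of class `C^{1,1}` from bounds for the derivatives of order at most one and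
Lipschitz bounds for the derivatives of order one. -/
lemma isRoughSymbol_two {m δ : ℝ} {u : Rn n → Rn n → ℂ} (hδ : 0 ≤ δ)
    (hs : ∀ x, ContDiff ℝ ∞ (u x)) (hc : ∀ α ξ, ContDiff ℝ 1 fun x => dxi α u x ξ)
    (h0 : ∀ α : List (Fin n), ∃ C, 0 ≤ C ∧
      ∀ x ξ, ‖dxi α u x ξ‖ ≤ C * bracket ξ ^ (m - α.length))
    (h1 : ∀ α : List (Fin n), ∃ C, 0 ≤ C ∧ ∀ i x ξ,
      ‖pderiv i (fun x => dxi α u x ξ) x‖ ≤ C * bracket ξ ^ (m - α.length + δ))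
    (h2 : ∀ α : List (Fin n), ∃ C, 0 ≤ C ∧ ∀ i x y ξ,
      ‖pderiv i (fun x => dxi α u x ξ) x - pderiv i (fun x => dxi α u x ξ) y‖ ≤
        C * bracket ξ ^ (m - α.length + 2 * δ) * ‖x - y‖) :
    IsRoughSymbol 2 m δ u := by
  refine ⟨hs, fun α => ?_⟩
  obtain ⟨C0, hC0, h0⟩ := h0 α
  obtain ⟨C1, hC1, h1⟩ := h1 α
  obtain ⟨C2, hC2, h2⟩ := h2 α
  have hn : (0 : ℝ) ≤ n := Nat.cast_nonneg n
  have hmono : ∀ ξ : Rn n, ∀ s t : ℝ, s ≤ t → bracket ξ ^ s ≤ bracket ξ ^ t := fun ξ s t h =>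
    Real.rpow_le_rpow_of_exponent_le (one_le_bracket ξ) h
  have hpos : ∀ ξ : Rn n, ∀ s : ℝ, 0 ≤ bracket ξ ^ s := fun ξ s => (Real.rpow_nonneg (bracket_pos ξ).le s)
  have hr2 : ∀ ξ, CrNormLE 2 (fun x => dxi α u x ξ)
      ((C0 + C1 + C2 + n * C1) * bracket ξ ^ (m - α.length + 2 * δ)) := by
    intro ξ
    refine crNormLE_two (M₀ := (C0 + C1) * bracket ξ ^ (m - α.length + 2 * δ))
      (M₁ := C2 * bracket ξ ^ (m - α.length + 2 * δ)) (hc α ξ) ?_ ?_ ?_ (fun x => ?_) (fun i x => ?_)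
      (fun i x y => h2 i x y ξ)
    · have := hpos ξ (m - α.length + 2 * δ)
      have : 0 ≤ n * C1 * bracket ξ ^ (m - α.length + 2 * δ) := by positivity
      linarith
    · have := hpos ξ (m - α.length + 2 * δ); positivity
    · have := hpos ξ (m - α.length + 2 * δ); positivity
    · refine (h0 x ξ).trans (mul_le_mul (by linarith) (hmono ξ _ _ (by linarith)) (hpos _ _) (by linarith))
    · refine (h1 i x ξ).trans (mul_le_mul (by linarith) (hmono ξ _ _ (by linarith)) (hpos _ _) (by linarith))
  -- The summand `n * C1` is the Lipschitz constant obtained from the first derivatives; it is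
  -- needed for the norm with `j = 1`.
  refine ⟨C0 + C1 + C2 + n * C1, by positivity, fun x ξ => ?_, hr2, fun j hj1 hj2 ξ => ?_⟩
  · refine (h0 x ξ).trans (mul_le_mul_of_nonneg_right ?_ (hpos _ _))
    have : 0 ≤ n * C1 := by positivity
    linarith
  · have hj : j = 1 ∨ j = 2 := by
      have : j ≤ 2 := by exact_mod_cast hj2
      omega
    rcases hj with rfl | rfl
    · have := hpos ξ (m - α.length + δ)
      rw [Nat.cast_one, one_mul]
      refine crNormLE_one (M₀ := C0 * bracket ξ ^ (m - α.length + δ))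
        (M₁ := n * C1 * bracket ξ ^ (m - α.length + δ)) (hc α ξ).continuous ?_ (by positivity)
        (by positivity) (fun x => ?_) (fun x y => ?_)
      · have h3 : 0 ≤ (C1 + C2) * bracket ξ ^ (m - α.length + δ) := by positivity
        linarith
      · exact (h0 x ξ).trans (mul_le_mul_of_nonneg_left (hmono ξ _ _ (by linarith)) hC0)
      · have := norm_sub_le_of_pderiv_le ((hc α ξ).differentiable (by simp)) (by positivity)
          (fun i x => h1 i x ξ) x y
        refine this.trans (le_of_eq (by ring))
    · exact_mod_cast hr2 ξ

lemma Rough.isRoughSymbol {m : ℝ} {u : Rn n → Rn n → ℂ} (h : Rough m u) :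
    IsRoughSymbol 2 m 0 u := by
  choose C hC hb using h.bdd
  refine isRoughSymbol_two le_rfl h.smooth (fun α ξ => (hb α ξ).contDiff)
    (fun α => ⟨C α, hC α, fun x ξ => (hb α ξ).sup x⟩) (fun α => ⟨C α, hC α, fun i x ξ => ?_⟩)
    (fun α => ⟨C α, hC α, fun i x y ξ => ?_⟩)
  · simpa using (hb α ξ).sup_deriv i x
  · simpa using (hb α ξ).lip_deriv i x y

lemma Rough.norm_dxi_le {m : ℝ} {u : Rn n → Rn n → ℂ} (h : Rough m u) (α : List (Fin n)) :
    ∃ C, 0 ≤ C ∧ ∀ x ξ, ‖dxi α u x ξ‖ ≤ C * bracket ξ ^ (m - α.length) := by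
  obtain ⟨C, hC, hb⟩ := h.bdd α
  exact ⟨C, hC, fun x ξ => (hb ξ).sup x⟩

lemma Rough.lip_dxi {m : ℝ} {u : Rn n → Rn n → ℂ} (h : Rough m u) (α : List (Fin n)) :
    ∃ C, 0 ≤ C ∧ ∀ x y ξ, ‖dxi α u x ξ - dxi α u y ξ‖ ≤
      C * bracket ξ ^ (m - α.length) * ‖x - y‖ := by
  obtain ⟨C, hC, hb⟩ := h.bdd α
  refine ⟨n * C, by positivity, fun x y ξ => ?_⟩
  rw [mul_assoc (n : ℝ)]
  exact (hb ξ).lip x y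

lemma Rough.contDiff_dxi {m : ℝ} {u : Rn n → Rn n → ℂ} (h : Rough m u) (α : List (Fin n))
    (x : Rn n) : ContDiff ℝ ∞ (dxi α u x) := contDiff_wderiv (h.smooth x) α

/-- Lipschitz in `x` with a constant locally bounded in `ξ`, and continuous in `ξ` for fixed `x`:
together these give joint continuity. -/
lemma Rough.continuous_dxi {m : ℝ} {u : Rn n → Rn n → ℂ} (h : Rough m u) (α : List (Fin n)) :
    Continuous fun q : Rn n × Rn n => dxi α u q.1 q.2 := by
  obtain ⟨C, hC, hb⟩ := h.lip_dxi α
  rw [continuous_iff_continuousAt]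
  rintro ⟨y₀, ξ₀⟩
  rw [ContinuousAt, tendsto_iff_norm_sub_tendsto_zero]
  have hg : Continuous fun q : Rn n × Rn n => C * bracket q.2 ^ (m - α.length) * ‖q.1 - y₀‖ +
      ‖dxi α u y₀ q.2 - dxi α u y₀ ξ₀‖ := by
    refine Continuous.add (Continuous.mul (continuous_const.mul ?_) (by fun_prop)) ?_
    · exact (continuous_bracket.comp continuous_snd).rpow_const
        fun q => Or.inl (bracket_pos q.2).ne'
    · exact (((h.contDiff_dxi α y₀).continuous.comp continuous_snd).sub continuous_const).norm
  have h0 := hg.tendsto (y₀, ξ₀)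
  simp only [sub_self, norm_zero, mul_zero, add_zero] at h0
  refine squeeze_zero (fun _ => norm_nonneg _) (fun q => ?_) h0
  refine (norm_sub_le_norm_sub_add_norm_sub _ (dxi α u y₀ q.2) _).trans ?_
  gcongr
  exact hb _ _ _

end Rough

/-! ### Dyadic cut-offs and amplitudes that separate `η` from `(y, ξ)`. -/

section Dyadic

/-- Families of functions of `ξ` adapted to the dyadic decomposition. -/
structure Dyadic (χ : ℕ → Rn n → ℂ) : Prop where
  smooth : ∀ k, ContDiff ℝ ∞ (χ k)
  supp : ∀ k ξ, ξ ∉ Shell k → χ k ξ = 0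
  bdd : ∀ α : List (Fin n), ∃ C, 0 ≤ C ∧ ∀ k ξ,
    ‖pderivs α (χ k) ξ‖ ≤ C * lam k ^ (-(α.length : ℝ))

lemma Dyadic.pderivs_eq_zero {χ : ℕ → Rn n → ℂ} (hχ : Dyadic χ) (α : List (Fin n)) {k : ℕ}
    {ξ : Rn n} (h : ξ ∉ Shell k) : pderivs α (χ k) ξ = 0 :=
  wderiv_eq_zero_of_isClosed (isClosed_shell k) (hχ.supp k) α h

/-- The amplitude `g(η) v(y, ξ)`. -/
def sepAmp (g : Rn n → ℂ) (v : Rn n → Rn n → ℂ) (y : Rn n) (p : R3 n) : ℂ := g p.2.2 * v y p.2.1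

/-- For a separated amplitude the `η`-integral is the convolution kernel of the multiplier. This
places smoothing within the amplitude calculus. -/
lemma opT_sepAmp (g : Rn n → ℂ) (v : Rn n → Rn n → ℂ) (x ξ : Rn n) :
    opT (sepAmp g v) x ξ = fourierMultiplier g (fun y => v y ξ) x := by
  rw [opT, fourierMultiplier, ← integral_const_mul]
  congr 1 with y
  simp only [kerJ, sepAmp, invHat_eq, ← mul_assoc]
  rw [integral_mul_const]
  ring

lemma hasFDerivAt_sepAmp {g : Rn n → ℂ} {v : Rn n → Rn n → ℂ} (hg : ContDiff ℝ ∞ g) {y : Rn n}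
    (hv : ContDiff ℝ ∞ (v y)) (p : R3 n) (d : R3 n) :
    fderiv ℝ (sepAmp g v y) p d = g p.2.2 * fderiv ℝ (v y) p.2.1 d.2.1 +
      fderiv ℝ g p.2.2 d.2.2 * v y p.2.1 := by
  have h1 : HasFDerivAt (fun p : R3 n => p.2.2)
      ((ContinuousLinearMap.snd ℝ (Rn n) (Rn n)).comp (ContinuousLinearMap.snd ℝ (Rn n) _)) p :=
    hasFDerivAt_snd.comp p hasFDerivAt_snd
  have h2 : HasFDerivAt (fun p : R3 n => p.2.1)
      ((ContinuousLinearMap.fst ℝ (Rn n) (Rn n)).comp (ContinuousLinearMap.snd ℝ (Rn n) _)) p :=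
    hasFDerivAt_fst.comp p hasFDerivAt_snd
  have h3 := HasFDerivAt.comp (g := g) p (differentiable_of_smooth hg p.2.2).hasFDerivAt h1
  have h4 := HasFDerivAt.comp (g := v y) p (differentiable_of_smooth hv p.2.1).hasFDerivAt h2
  have h5 : HasFDerivAt (sepAmp g v y) _ p := h3.mul h4
  rw [h5.fderiv]
  simp [mul_comm]

lemma ampD_inl_sepAmp {g : Rn n → ℂ} {v : Rn n → Rn n → ℂ} (hg : ContDiff ℝ ∞ g)
    (hv : ∀ y, ContDiff ℝ ∞ (v y)) (l : Fin n) :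
    ampD (.inl l) (sepAmp g v) = sepAmp (fun η => (Complex.I * (η l : ℝ)) * g η) v := by
  funext y p
  simp only [ampD, wderiv_cons, wderiv_nil, hasFDerivAt_sepAmp hg (hv y), dir3]
  simp [sepAmp, mul_assoc]

lemma ampD_inr_sepAmp {g : Rn n → ℂ} {v : Rn n → Rn n → ℂ} (hg : ContDiff ℝ ∞ g)
    (hv : ∀ y, ContDiff ℝ ∞ (v y)) (l : Fin n) :
    ampD (.inr l) (sepAmp g v) = sepAmp g (dxi [l] v) := by
  funext y p
  simp only [ampD, wderiv_cons, wderiv_nil, hasFDerivAt_sepAmp hg (hv y), dir3]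
  simp [sepAmp, dxi, pderivs, pderiv, bv]

/-- The iterated version of `ampD`. -/
def ampDs (w : List (Fin n ⊕ Fin n)) (F : Rn n → R3 n → ℂ) : Rn n → R3 n → ℂ := w.foldr ampD F

lemma IsAmp.ampDs {m : ℝ} {M : ℕ} {F : ℕ → Rn n → R3 n → ℂ} (hF : IsAmp m M F)
    (w : List (Fin n ⊕ Fin n)) :
    IsAmp (m + wordWt (wt2 (1 / 2)) w) M (fun k => PsiDO.ampDs w (F k)) := by
  induction w with
  | nil => simpa [PsiDO.ampDs] using hF
  | cons i w ih =>
    have := ih.ampD i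
    rw [wordWt_cons, add_comm (wt2 _ i), ← add_assoc]
    exact this

lemma IsAmp.wderiv_opS {m : ℝ} {M : ℕ} {F : ℕ → Rn n → R3 n → ℂ} (hF : IsAmp m M F)
    (w : List (Fin n ⊕ Fin n)) :
    wderiv dir2 w (Function.uncurry (opS F)) =
      Function.uncurry (opS fun k => PsiDO.ampDs w (F k)) := by
  induction w with
  | nil => rfl
  | cons i w ih =>
    rw [wderiv_cons, ih]
    funext p
    exact ((hF.ampDs w).fderiv_opS p i).2

/-- The product of the linear functions `i η_l` over a word. -/
def etaPow (β : List (Fin n)) (η : Rn n) : ℂ := (β.map fun l => Complex.I * ((η l : ℝ) : ℂ)).prod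

@[simp] lemma etaPow_nil (η : Rn n) : etaPow [] η = 1 := rfl

lemma etaPow_cons (l : Fin n) (β : List (Fin n)) (η : Rn n) :
    etaPow (l :: β) η = Complex.I * ((η l : ℝ) : ℂ) * etaPow β η := by simp [etaPow]

lemma contDiff_coord (l : Fin n) : ContDiff ℝ ∞ fun η : Rn n => ((η l : ℝ) : ℂ) :=
  Complex.ofRealCLM.contDiff.comp (EuclideanSpace.proj l : Rn n →L[ℝ] ℝ).contDiff

lemma contDiff_etaPow (β : List (Fin n)) : ContDiff ℝ ∞ (etaPow β : Rn n → ℂ) := by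
  induction β with
  | nil => exact contDiff_const
  | cons l β ih =>
    have : (etaPow (l :: β) : Rn n → ℂ) = fun η => Complex.I * ((η l : ℝ) : ℂ) * etaPow β η :=
      funext fun η => etaPow_cons l β η
    rw [this]
    exact (contDiff_const.mul (contDiff_coord l)).mul ih

lemma etaPow_smul (β : List (Fin n)) (h : ℝ) (η : Rn n) :
    etaPow β (h • η) = ((h ^ β.length : ℝ) : ℂ) * etaPow β η := by
  induction β with
  | nil => simp
  | cons l β ih => rw [etaPow_cons, ih, etaPow_cons]; simp [pow_succ]; ring

lemma etaPow_zero {β : List (Fin n)} (hβ : β ≠ []) : etaPow β (0 : Rn n) = 0 := by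
  match β, hβ with
  | l :: β, _ => simp [etaPow_cons]

/-- Separation survives differentiation: derivatives in `x` multiply `g` by powers of `iη`,
derivatives in `ξ` fall on `v`. Derivatives of smoothed symbols are therefore again multipliers. -/
lemma ampDs_sepAmp {g : Rn n → ℂ} {v : Rn n → Rn n → ℂ} (hg : ContDiff ℝ ∞ g)
    (hv : ∀ y, ContDiff ℝ ∞ (v y)) (α β : List (Fin n)) :
    ampDs (α.map Sum.inr ++ β.map Sum.inl) (sepAmp g v) =
      sepAmp (fun η => etaPow β η * g η) (dxi α v) := by
  have h1 : ampDs (β.map Sum.inl) (sepAmp g v) = sepAmp (fun η => etaPow β η * g η) v := by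
    induction β with
    | nil => simp [ampDs]
    | cons l β ih =>
      have : ampDs ((l :: β).map Sum.inl) (sepAmp g v) =
        ampD (.inl l) (ampDs (β.map Sum.inl) (sepAmp g v)) := rfl
      rw [this, ih, ampD_inl_sepAmp ((contDiff_etaPow β).mul hg) hv]
      simp_rw [etaPow_cons, mul_assoc]
  rw [ampDs, List.foldr_append]
  change ampDs (α.map Sum.inr) (ampDs (β.map Sum.inl) (sepAmp g v)) = _
  rw [h1]
  induction α with
  | nil => rfl
  | cons l α ih =>
    have : ∀ G : Rn n → R3 n → ℂ, ampDs ((l :: α).map Sum.inr) G =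
      ampD (.inr l) (ampDs (α.map Sum.inr) G) := fun G => rfl
    have hd : ∀ y, ContDiff ℝ ∞ (dxi α v y) := fun y => by
      change ContDiff ℝ ∞ (pderivs α (v y))
      rw [pderivs_eq_wderiv_bv]
      exact contDiff_wderiv (hv y) α
    rw [this, ih, ampD_inr_sepAmp (v := dxi α v) ((contDiff_etaPow β).mul hg) hd]
    rfl

end Dyadic

/-! ### Pull-backs of weighted bounds and of joint continuity. -/

section Pullback

variable {E E' : Type*} [NormedAddCommGroup E] [NormedSpace ℝ E]
  [NormedAddCommGroup E'] [NormedSpace ℝ E'] {ι κ P : Type*}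

lemma prod_eq_zero_or_wordWt_le {s : ι → ℝ} {π : ι → κ} {wt : ι → ℝ} {wt' : κ → ℝ}
    (hs : ∀ i, s i = 0 ∨ s i = 1 ∧ wt' (π i) ≤ wt i) (w : List ι) :
    (w.map s).prod = 0 ∨ (w.map s).prod = 1 ∧ wordWt wt' (w.map π) ≤ wordWt wt w := by
  induction w with
  | nil => simp
  | cons i w ih =>
    simp only [List.map_cons, List.prod_cons, wordWt_cons]
    rcases hs i with h | ⟨h, h'⟩
    · simp [h]
    · rcases ih with ih | ⟨ih, ih'⟩
      · simp [ih]
      · exact Or.inr ⟨by simp [h, ih], by linarith⟩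

/-- Weighted bounds for pull-backs along linear maps that map directions to directions. -/
lemma WBdd.comp_clm {v : ι → E} {wt : ι → ℝ} {v' : κ → E'} {wt' : κ → ℝ} {Ω : P → Set E'}
    {base q : P → E' → ℝ} {m : ℝ} {M : ℕ} {f : P → E' → ℂ} (A : E →L[ℝ] E') (s : ι → ℝ) (π : ι → κ)
    (hA : ∀ i, A (v i) = s i • v' (π i)) (hs : ∀ i, s i = 0 ∨ s i = 1 ∧ wt' (π i) ≤ wt i)
    (hb : ∀ p x, 1 ≤ base p x) (hq : ∀ p x, 1 ≤ q p x) (hfs : ∀ p, ContDiff ℝ ∞ (f p))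
    (hf : WBdd v' wt' Ω base q m M f) :
    WBdd v wt (fun p => A ⁻¹' Ω p) (fun p x => base p (A x)) (fun p x => q p (A x)) m M
      (fun p x => f p (A x)) := by
  intro w
  obtain ⟨C, hC, h⟩ := hf (w.map π)
  refine ⟨C, hC, fun p x hx => ?_⟩
  rw [wderiv_comp_linear (hfs p), funext hA, wderiv_smul_dir (hfs p), norm_mul, Complex.norm_real]
  have hb' := hb p (A x)
  have hq' := hq p (A x)
  have h0 : 0 ≤ base p (A x) := by linarith
  rcases prod_eq_zero_or_wordWt_le hs w with h1 | ⟨h1, h2⟩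
  · rw [h1, norm_zero, zero_mul]
    positivity
  · rw [h1, norm_one, one_mul]
    refine (h p _ hx).trans ?_
    gcongr

/-- Families of functions whose derivatives are jointly continuous in the point and the
parameter. -/
def JCont {Y : Type*} [TopologicalSpace Y] (v : ι → E) (F : Y → E → ℂ) : Prop :=
  (∀ y, ContDiff ℝ ∞ (F y)) ∧ ∀ w, Continuous fun q : Y × E => wderiv v w (F q.1) q.2

variable {Y : Type*} [TopologicalSpace Y] {v : ι → E} {F G : Y → E → ℂ}

lemma JCont.mul (hF : JCont v F) (hG : JCont v G) : JCont v fun y x => F y x * G y x := by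
  refine ⟨fun y => (hF.1 y).mul (hG.1 y), fun w => ?_⟩
  simp_rw [fun q : Y × E => congrFun (wderiv_mul (v := v) (hF.1 q.1) (hG.1 q.1) w) q.2]
  generalize splits w = L
  induction L with
  | nil => simpa using continuous_const
  | cons s L ih =>
    simp only [List.map_cons, List.sum_cons]
    exact ((hF.2 s.1).mul (hG.2 s.2)).add ih

lemma JCont.const {f : E → ℂ} (hf : ContDiff ℝ ∞ f) : JCont v fun _ : Y => f :=
  ⟨fun _ => hf, fun w => (contDiff_wderiv hf w).continuous.comp continuous_snd⟩

lemma JCont.comp_clm {v' : κ → E'} {F : Y → E' → ℂ} (hF : JCont v' F) (A : E →L[ℝ] E') (s : ι → ℝ)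
    (π : ι → κ) (hA : ∀ i, A (v i) = s i • v' (π i)) : JCont v fun y x => F y (A x) := by
  refine ⟨fun y => (hF.1 y).comp A.contDiff, fun w => ?_⟩
  have h : (fun q : Y × E => wderiv v w (fun x => F q.1 (A x)) q.2) = fun q =>
      (((w.map s).prod : ℝ) : ℂ) * wderiv v' (w.map π) (F q.1) (A q.2) := by
    funext q
    rw [wderiv_comp_linear (hF.1 q.1), funext hA, wderiv_smul_dir (hF.1 q.1)]
  rw [h]
  exact continuous_const.mul ((hF.2 _).comp (continuous_fst.prodMk (A.continuous.comp continuous_snd)))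

/-- The projection of `(x, ξ, η)` to `ξ`. -/
def prXi : R3 n →L[ℝ] Rn n :=
  (ContinuousLinearMap.fst ℝ (Rn n) (Rn n)).comp (ContinuousLinearMap.snd ℝ (Rn n) _)

/-- The projection of `(x, ξ, η)` to `η`. -/
def prEta : R3 n →L[ℝ] Rn n :=
  (ContinuousLinearMap.snd ℝ (Rn n) (Rn n)).comp (ContinuousLinearMap.snd ℝ (Rn n) _)

/-- The coordinate index of a letter. -/
def idx3 : Fin n ⊕ Fin n ⊕ Fin n → Fin n := Sum.elim id (Sum.elim id id)

/-- Indicator of the letters for `ξ`. -/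
def isXi : Fin n ⊕ Fin n ⊕ Fin n → ℝ := Sum.elim 0 (Sum.elim 1 0)

/-- Indicator of the letters for `η`. -/
def isEta : Fin n ⊕ Fin n ⊕ Fin n → ℝ := Sum.elim 0 (Sum.elim 0 1)

lemma prXi_dir3 (i : Fin n ⊕ Fin n ⊕ Fin n) : prXi (dir3 i) = isXi i • bv (idx3 i) := by
  rcases i with i | i | i <;> simp [prXi, dir3, isXi, idx3]

lemma prEta_dir3 (i : Fin n ⊕ Fin n ⊕ Fin n) : prEta (dir3 i) = isEta i • bv (idx3 i) := by
  rcases i with i | i | i <;> simp [prEta, dir3, isEta, idx3]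

lemma isXi_wt (i : Fin n ⊕ Fin n ⊕ Fin n) :
    isXi i = 0 ∨ isXi i = 1 ∧ (fun _ : Fin n => (-1 : ℝ)) (idx3 i) ≤ wt3 i := by
  rcases i with i | i | i <;> simp [isXi, wt3]

lemma isEta_wt (i : Fin n ⊕ Fin n ⊕ Fin n) :
    isEta i = 0 ∨ isEta i = 1 ∧ (fun _ : Fin n => (-(1 / 2) : ℝ)) (idx3 i) ≤ wt3 i := by
  rcases i with i | i | i <;> simp [isEta, wt3]

lemma wordWt_const {ι : Type*} (c : ℝ) (w : List ι) : wordWt (fun _ => c) w = w.length * c := by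
  induction w with
  | nil => simp
  | cons i w ih => simp [ih]; ring

end Pullback

/-! ### The amplitudes of the smoothing. -/

section Smoothing

/-- The amplitude `φ(η / h_k) χ_k(ξ) u(y, ξ)`. -/
def smAmp (φ : Rn n → ℂ) (χ : ℕ → Rn n → ℂ) (u : Rn n → Rn n → ℂ) (k : ℕ) :
    Rn n → R3 n → ℂ :=
  sepAmp (fun η => φ ((hlf k)⁻¹ • η)) (fun y ξ => χ k ξ * u y ξ)

/-- Smooth functions supported in the unit ball. -/
structure UnitBump (φ : Rn n → ℂ) : Prop where
  smooth : ContDiff ℝ ∞ φ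
  supp : ∀ η, 1 < ‖η‖ → φ η = 0

lemma IsCutoff.unitBump {φ : Rn n → ℝ} (h : IsCutoff φ) : UnitBump fun η => (φ η : ℂ) :=
  ⟨Complex.ofRealCLM.contDiff.comp h.smooth, fun η hη => by simp [h.support η hη.le]⟩

lemma UnitBump.etaPow {φ : Rn n → ℂ} (h : UnitBump φ) (β : List (Fin n)) :
    UnitBump fun η => PsiDO.etaPow β η * φ η :=
  ⟨(contDiff_etaPow β).mul h.smooth, fun η hη => by rw [h.supp η hη, mul_zero]⟩

lemma UnitBump.bdd {φ : Rn n → ℂ} (h : UnitBump φ) (α : List (Fin n)) :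
    ∃ C, 0 ≤ C ∧ ∀ η, ‖pderivs α φ η‖ ≤ C := by
  have hc : Continuous (pderivs α φ) := (contDiff_wderiv h.smooth α).continuous
  have hs : HasCompactSupport (pderivs α φ) := by
    refine HasCompactSupport.intro (isCompact_closedBall (0 : Rn n) 1) fun η hη => ?_
    exact zero_off_ball_wderiv h.supp α η (by simpa using hη)
  obtain ⟨C, hC⟩ := hs.exists_bound_of_continuous hc
  exact ⟨C, (norm_nonneg _).trans (hC 0), hC⟩

lemma UnitBump.smooth_scaled {φ : Rn n → ℂ} (h : UnitBump φ) (s : ℝ) :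
    ContDiff ℝ ∞ fun η : Rn n => φ (s • η) := h.smooth.comp (contDiff_const_smul s)

lemma UnitBump.supp_scaled {φ : Rn n → ℂ} (h : UnitBump φ) (k : ℕ) (η : Rn n)
    (hη : hlf k < ‖η‖) : φ ((hlf k)⁻¹ • η) = 0 := by
  have hk := hlf_pos k
  refine h.supp _ ?_
  rw [norm_smul, norm_inv, Real.norm_of_nonneg hk.le, ← div_eq_inv_mul, one_lt_div hk]
  exact hη

lemma UnitBump.wbdd_scaled {φ : Rn n → ℂ} (h : UnitBump φ) {P : Type*} (κ : P → ℕ) :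
    WBdd bv (fun _ => -(1 / 2)) (fun _ => Set.univ) (fun p _ => lam (κ p)) (fun _ _ => 1) 0 0
      (fun (p : P) η => φ ((hlf (κ p))⁻¹ • η)) := by
  intro w
  obtain ⟨C, hC, hb⟩ := h.bdd w
  refine ⟨C, hC, fun p η _ => ?_⟩
  have h1 := wderiv_comp_linear (v := bv) h.smooth ((hlf (κ p))⁻¹ • ContinuousLinearMap.id ℝ (Rn n)) w
  have h2 := wderiv_smul_dir (v' := bv) h.smooth (fun _ : Fin n => (hlf (κ p))⁻¹) id w
  simp only [smul_apply, ContinuousLinearMap.id_apply] at h1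
  simp only [id_eq, List.map_const', List.prod_replicate] at h2
  rw [h1, h2, norm_mul, Complex.norm_real, wordWt_const, pow_zero, mul_one, zero_add, mul_comm C]
  have hk := hlf_pos (κ p)
  refine mul_le_mul (le_of_eq ?_) (by rw [List.map_id]; exact hb _) (norm_nonneg _) (by have := lam_pos (κ p); positivity)
  rw [Real.norm_of_nonneg (by positivity), inv_pow, hlf_pow, ← Real.rpow_neg (lam_pos _).le]
  ring_nf

lemma Dyadic.wbdd {χ : ℕ → Rn n → ℂ} (h : Dyadic χ) {P : Type*} (κ : P → ℕ) :
    WBdd bv (fun _ => -1) (fun p => Shell (κ p)) (fun p _ => lam (κ p)) (fun _ _ => 1) 0 0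
      (fun (p : P) => χ (κ p)) := by
  intro w
  obtain ⟨C, hC, hb⟩ := h.bdd w
  refine ⟨C, hC, fun p ξ _ => (hb (κ p) ξ).trans (le_of_eq ?_)⟩
  simp [wordWt_const]

lemma Rough.wbdd {m : ℝ} {u : Rn n → Rn n → ℂ} (h : Rough m u) :
    WBdd (P := ℕ × Rn n) bv (fun _ => -1) (fun p => Shell p.1) (fun p _ => lam p.1) (fun _ _ => 1) m 0
      (fun p => u p.2) := by
  intro w
  obtain ⟨C, hC, hb⟩ := h.norm_dxi_le w
  refine ⟨C * 4 ^ |m - w.length|, by positivity, fun p ξ hξ => (hb p.2 ξ).trans ?_⟩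
  rw [wordWt_const, pow_zero, mul_one, mul_assoc]
  refine mul_le_mul_of_nonneg_left ?_ hC
  rw [show m + w.length * (-1 : ℝ) = m - w.length by ring]
  exact bracket_rpow_le_of_mem_shell hξ _

lemma Rough.jcont {m : ℝ} {u : Rn n → Rn n → ℂ} (h : Rough m u) : JCont bv u :=
  ⟨h.smooth, fun w => h.continuous_dxi w⟩

lemma JCont.pull_xi {u : Rn n → Rn n → ℂ} (h : JCont bv u) :
    JCont dir3 fun y (p : R3 n) => u y p.2.1 :=
  h.comp_clm prXi isXi idx3 prXi_dir3

lemma JCont.pull_eta {u : Rn n → Rn n → ℂ} (h : JCont bv u) :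
    JCont dir3 fun y (p : R3 n) => u y p.2.2 :=
  h.comp_clm prEta isEta idx3 prEta_dir3

/-- On the shell `u(y,ξ)` has order `m` and `χ_k` order 0, while `φ(η/h_k)` gains 1/2 per
`η`-derivative. None of the factors depends on `x`, and regularity of `u` in `y` enters only through
continuity. -/
theorem isAmp_smAmp {φ : Rn n → ℂ} (hφ : UnitBump φ) {χ : ℕ → Rn n → ℂ} (hχ : Dyadic χ) {m : ℝ}
    {u : Rn n → Rn n → ℂ} (hu : Rough m u) : IsAmp m 0 (smAmp φ χ u) := by
  have hj : ∀ k, JCont dir3 (smAmp φ χ u k) := fun k =>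
    (JCont.pull_eta (JCont.const (hφ.smooth_scaled _))).mul
      ((JCont.pull_xi (JCont.const (hχ.smooth k))).mul hu.jcont.pull_xi)
  have hxi : ∀ k y (p : R3 n), p.2.1 ∉ Shell k → smAmp φ χ u k y p = 0 := fun k y p hp => by
    simp [smAmp, sepAmp, hχ.supp k _ hp]
  refine ⟨fun k => (hj k).1, fun k => (hj k).2, fun k y p hp => ?_, hxi, ?_⟩
  · simp only [smAmp, sepAmp]
    rw [hφ.supp_scaled k _ hp, zero_mul]
  · have h1 := WBdd.comp_clm (v := dir3) (wt := wt3) prEta isEta idx3 prEta_dir3 isEta_wt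
      (fun p _ => one_le_lam _) (fun _ _ => le_rfl) (fun p => hφ.smooth_scaled _)
      (hφ.wbdd_scaled (fun p : ℕ × Rn n => p.1))
    have h2 := WBdd.comp_clm (v := dir3) (wt := wt3) prXi isXi idx3 prXi_dir3 isXi_wt
      (fun p _ => one_le_lam _) (fun _ _ => le_rfl) (fun p => hχ.smooth _)
      (hχ.wbdd (fun p : ℕ × Rn n => p.1))
    have h3 := WBdd.comp_clm (v := dir3) (wt := wt3) prXi isXi idx3 prXi_dir3 isXi_wt
      (fun p _ => one_le_lam _) (fun _ _ => le_rfl) (fun p : ℕ × Rn n => hu.smooth p.2) hu.wbdd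
    have h4 := WBdd.mul (M := 0) (M' := 0) (fun p _ => lam_pos _) (fun _ _ => le_rfl)
      (fun p => (hχ.smooth _).comp prXi.contDiff) (fun p : ℕ × Rn n => (hu.smooth p.2).comp prXi.contDiff) h2 h3
    have h5 := WBdd.mul (M := 0) (M' := 0) (fun p _ => lam_pos _) (fun _ _ => le_rfl)
      (fun p => (hφ.smooth_scaled _).comp prEta.contDiff)
      (fun p : ℕ × Rn n => ((hχ.smooth _).comp prXi.contDiff).mul ((hu.smooth p.2).comp prXi.contDiff))
      (h1.mono_set fun p => (Set.subset_univ _ : prXi ⁻¹' Shell p.1 ⊆ _)) h4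
    have h6 := h5.univ (fun p _ => lam_pos _) (fun _ _ => le_rfl)
      (fun p : ℕ × Rn n => (isClosed_shell p.1).preimage prXi.continuous)
      (fun (p : ℕ × Rn n) x hx => hxi p.1 p.2 x hx)
    intro w
    obtain ⟨C, hC, h⟩ := h6 w
    refine ⟨C, hC, fun p x _ => ?_⟩
    have := h p x trivial
    simpa using this

end Smoothing

/-! ### Quantitative comparison of a symbol with its smoothing. -/

section SmoothingEstimates

/-- The main term of the derivative along `β` of a smoothed function. -/
def mainT : List (Fin n) → (Rn n → ℂ) → Rn n → ℂ
  | [], f => f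
  | [l], f => pderiv l f
  | _ :: _ :: _, _ => 0

lemma pderiv_etaPow_zero (l : Fin n) (β : List (Fin n)) :
    pderiv l (etaPow β) 0 = match β with
      | [j] => if j = l then Complex.I else 0
      | _ => 0 := by
  have hc : ∀ j : Fin n, HasFDerivAt (fun η : Rn n => Complex.I * ((η j : ℝ) : ℂ))
      (((EuclideanSpace.proj j : Rn n →L[ℝ] ℝ)).smulRight Complex.I) 0 := fun j => by
    have := (((EuclideanSpace.proj j : Rn n →L[ℝ] ℝ)).smulRight Complex.I).hasFDerivAt (x := 0)
    refine this.congr_of_eventuallyEq (Filter.Eventually.of_forall fun η => ?_)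
    simp [mul_comm]
  match β with
  | [] =>
    have : (etaPow [] : Rn n → ℂ) = fun _ => 1 := rfl
    simp [this, pderiv]
  | [j] =>
    have : (etaPow [j] : Rn n → ℂ) = fun η => Complex.I * ((η j : ℝ) : ℂ) := by
      funext η; simp [etaPow]
    rw [this, pderiv, (hc j).fderiv]
    by_cases h : j = l
    · subst h; simp
    · simp [h]
  | i :: j :: β =>
    have : (etaPow (i :: j :: β) : Rn n → ℂ) =
        fun η => Complex.I * ((η i : ℝ) : ℂ) * etaPow (j :: β) η :=
      funext fun η => etaPow_cons i _ η
    have h2 := (hc i).mul (differentiable_of_smooth (contDiff_etaPow (j :: β)) (0 : Rn n)).hasFDerivAt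
    rw [etaPow_zero (by simp)] at h2
    have h3 : HasFDerivAt (fun η : Rn n => Complex.I * ((η i : ℝ) : ℂ) * etaPow (j :: β) η) _ 0 := h2
    rw [this, pderiv, h3.fderiv]
    simp

/-- Smoothing at scale `h` approximates the identity and its derivatives. -/
lemma norm_multiplier_sub_mainT_le {φ : Rn n → ℂ} (hφ : UnitBump φ)
    (h1 : ∀ᶠ ζ in nhds (0 : Rn n), φ ζ = 1) (β : List (Fin n)) :
    ∃ C, 0 ≤ C ∧ ∀ (k : ℕ) (f : Rn n → ℂ) (M : ℝ), C11 f M → ∀ x,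
      ‖fourierMultiplier (fun η => etaPow β η * φ ((hlf k)⁻¹ • η)) f x - mainT β f x‖ ≤
        C * (lam k ^ ((β.length : ℝ) / 2 - 1) * M) := by
  obtain ⟨C, hC, hb⟩ := norm_multiplier_sub_le (hφ.etaPow β).smooth (hφ.etaPow β).supp
  refine ⟨C, hC, fun k f M hf x => ?_⟩
  have hk := hlf_pos k
  -- By homogeneity, a fixed profile `(iη)^β φ(η)` at scale `h` appears, times `h^{|β|}`. The Taylor
  -- error `h^{-2}` thus becomes `h^{|β|-2} = λ^{|β|/2-1}`.
  have e1 : ∀ η : Rn n, etaPow β η * φ ((hlf k)⁻¹ • η) =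
      ((hlf k ^ β.length : ℝ) : ℂ) * (etaPow β ((hlf k)⁻¹ • η) * φ ((hlf k)⁻¹ • η)) := fun η => by
    rw [← mul_assoc, ← etaPow_smul, smul_inv_smul₀ hk.ne']
  have e2 : fourierMultiplier (fun η => etaPow β η * φ ((hlf k)⁻¹ • η)) f x =
      ((hlf k ^ β.length : ℝ) : ℂ) * fourierMultiplier
        (fun η => etaPow β ((hlf k)⁻¹ • η) * φ ((hlf k)⁻¹ • η)) f x := by
    rw [fourierMultiplier, fourierMultiplier, ← integral_const_mul]
    congr 1 with y
    rw [← mul_assoc]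
    congr 1
    have e : ∀ η, osc (x - y) η * (etaPow β η * φ ((hlf k)⁻¹ • η)) = ((hlf k ^ β.length : ℝ) : ℂ) *
        (osc (x - y) η * (etaPow β ((hlf k)⁻¹ • η) * φ ((hlf k)⁻¹ • η))) := fun η => by
      rw [e1]; ring
    simp_rw [invHat_eq, e, integral_const_mul]
    ring
  have hnear : ∀ᶠ η in nhds (0 : Rn n), etaPow β η * φ η = etaPow β η := by
    filter_upwards [h1] with η hη
    rw [hη, mul_one]
  have hd : ∀ l, pderiv l (fun η => etaPow β η * φ η) 0 = pderiv l (etaPow β) 0 := fun l => by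
    rw [pderiv, pderiv, Filter.EventuallyEq.fderiv_eq hnear]
  -- As `φ = 1` near 0, the profile has the same value and gradient at 0 as `(iη)^β`: only `β = []`
  -- contributes a value and only a one-letter word a gradient.
  have e3 : mainT β f x = ((hlf k ^ β.length : ℝ) : ℂ) * ((etaPow β 0 * φ 0) * f x -
      (Complex.I * ((hlf k)⁻¹ : ℝ)) * ∑ l, pderiv l (fun η => etaPow β η * φ η) 0 * pderiv l f x) := by
    simp_rw [hd, pderiv_etaPow_zero, h1.self_of_nhds]
    match β with
    | [] => simp [mainT]
    | [j] =>
      have hk' : ((hlf k : ℝ) : ℂ) ≠ 0 := by exact_mod_cast hk.ne'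
      simp only [mainT, etaPow_zero (List.cons_ne_nil j []), ite_mul, zero_mul, Finset.sum_ite_eq,
        Finset.mem_univ, if_true]
      simp only [List.length_cons, List.length_nil, zero_add, pow_one, zero_sub]
      push_cast
      field_simp
      rw [Complex.I_sq]; ring
    | i :: j :: β => simp [mainT, etaPow_zero]
  rw [e2, e3, ← mul_sub, norm_mul, Complex.norm_real, Real.norm_of_nonneg (by positivity)]
  calc _ ≤ hlf k ^ β.length * (C * ((hlf k)⁻¹ ^ 2 * M)) := by
        gcongr
        exact hb _ hk f M hf x
    _ = _ := by
      rw [inv_pow, hlf_sq, hlf_pow, Real.rpow_sub (lam_pos k), Real.rpow_one]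
      ring

lemma C11.const_mul {f : Rn n → ℂ} {M : ℝ} (hf : C11 f M) (c : ℂ) :
    C11 (fun x => c * f x) (2 * (1 + n) * (‖c‖ * M)) := (C11.const c).mul hf

lemma dxi_mul_left {g : Rn n → ℂ} {u : Rn n → Rn n → ℂ} (hg : ContDiff ℝ ∞ g)
    (hu : ∀ y, ContDiff ℝ ∞ (u y)) (α : List (Fin n)) (y ξ : Rn n) :
    dxi α (fun y ξ => g ξ * u y ξ) y ξ =
      ((splits α).map fun p => pderivs p.1 g ξ * dxi p.2 u y ξ).sum :=
  congrFun (wderiv_mul hg (hu y) α) ξ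

variable {φ : Rn n → ℂ} {χ : ℕ → Rn n → ℂ} {m : ℝ} {u : Rn n → Rn n → ℂ}

lemma Dyadic.dxi_mul_eq_zero (hχ : Dyadic χ) (α : List (Fin n)) {k : ℕ}
    {ξ : Rn n} (h : ξ ∉ Shell k) (y : Rn n) : dxi α (fun y ξ => χ k ξ * u y ξ) y ξ = 0 :=
  wderiv_eq_zero_of_isClosed (isClosed_shell k)
    (fun x hx => by simp [hχ.supp k x hx]) α h

lemma Dyadic.c11_mul (hχ : Dyadic χ) (hu : Rough m u) (α : List (Fin n)) :
    ∃ C, 0 ≤ C ∧ ∀ k ξ, ξ ∈ Shell k → C11 (fun y => dxi α (fun y ξ => χ k ξ * u y ξ) y ξ)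
      (C * bracket ξ ^ (m - α.length)) := by
  choose A hA hχb using hχ.bdd
  choose B hB hub using hu.bdd
  let K : List (Fin n) × List (Fin n) → ℝ := fun p =>
    2 * (1 + n) * (A p.1 * 4 ^ |(-(p.1.length : ℝ))| * B p.2)
  refine ⟨((splits α).map K).sum, ?_, fun k ξ hξ => ?_⟩
  · refine List.sum_nonneg fun x hx => ?_
    obtain ⟨p, -, rfl⟩ := List.mem_map.1 hx
    have := hA p.1; have := hB p.2
    positivity
  · simp_rw [dxi_mul_left (hχ.smooth k) hu.smooth]
    have h := C11.list_sum (splits α) (f := fun p y => pderivs p.1 (χ k) ξ * dxi p.2 u y ξ)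
      (M := fun p => K p * bracket ξ ^ (m - α.length)) fun p hp => by
        refine ((hub p.2 ξ).const_mul _).mono ?_
        have h1 := (hχb p.1 k ξ).trans (mul_le_mul_of_nonneg_left
          (lam_rpow_le_of_mem_shell hξ _) (hA p.1))
        have h2 := hB p.2
        have h3 := bracket_pos ξ
        have h4 : bracket ξ ^ (m - α.length) =
            bracket ξ ^ (-(p.1.length : ℝ)) * bracket ξ ^ (m - p.2.length) := by
          rw [← Real.rpow_add h3]
          congr 1
          have : (p.1.length : ℝ) + p.2.length = α.length := by
            exact_mod_cast length_of_mem_splits hp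
          linarith
        rw [h4]
        calc _ ≤ 2 * (1 + (n : ℝ)) * ((A p.1 * (4 ^ |(-(p.1.length : ℝ))| *
              bracket ξ ^ (-(p.1.length : ℝ)))) * (B p.2 * bracket ξ ^ (m - p.2.length))) := by
              gcongr
          _ = _ := by ring
    rwa [List.sum_map_mul_right] at h

lemma dxi_dx_opS_smAmp (hφ : UnitBump φ) (hχ : Dyadic χ) (hu : Rough m u) (α β : List (Fin n))
    (x ξ : Rn n) :
    dxi α (dx β (opS (smAmp φ χ u))) x ξ = ∑' k, fourierMultiplier
      (fun η => etaPow β η * φ ((hlf k)⁻¹ • η))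
      (fun y => dxi α (fun y ξ => χ k ξ * u y ξ) y ξ) x := by
  have hA := isAmp_smAmp hφ hχ hu
  rw [dxi_dx_eq_wderiv hA.isSymbol_opS.1, hA.wderiv_opS]
  change opS _ x ξ = _
  rw [opS]
  congr 1 with k
  rw [smAmp, ampDs_sepAmp (hφ.smooth_scaled _) (fun y => (hχ.smooth k).mul (hu.smooth y)), opT_sepAmp]

lemma mainT_zero (β : List (Fin n)) : mainT β (fun _ : Rn n => (0 : ℂ)) = fun _ => 0 := by
  match β with
  | [] => rfl
  | [l] => funext x; simp [mainT, pderiv]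
  | _ :: _ :: _ => rfl

lemma mainT_sum {J : Type*} (β : List (Fin n)) (s : Finset J) {f : J → Rn n → ℂ}
    (hf : ∀ j ∈ s, Differentiable ℝ (f j)) (x : Rn n) :
    mainT β (fun y => ∑ j ∈ s, f j y) x = ∑ j ∈ s, mainT β (f j) x := by
  match β with
  | [] => rfl
  | [l] =>
    simp only [mainT, pderiv]
    rw [fderiv_fun_sum fun j hj => hf j hj x, sum_apply]
  | _ :: _ :: _ => simp [mainT]

lemma mainT_const_mul (β : List (Fin n)) (c : ℂ) {f : Rn n → ℂ} (hf : Differentiable ℝ f)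
    (x : Rn n) : mainT β (fun y => c * f y) x = c * mainT β f x := by
  match β with
  | [] => rfl
  | [l] =>
    simp only [mainT, pderiv]
    rw [fderiv_const_mul (hf x)]
    rfl
  | _ :: _ :: _ => simp [mainT]

lemma C11.norm_mainT_le {f : Rn n → ℂ} {M : ℝ} (hf : C11 f M) (β : List (Fin n)) (x : Rn n) :
    ‖mainT β f x‖ ≤ M := by
  match β with
  | [] => exact hf.sup x
  | [l] => exact hf.sup_deriv l x
  | _ :: _ :: _ => simpa [mainT] using hf.nonneg

/-- Smoothed symbols and their limits. -/
theorem norm_opS_smAmp_sub_le (hφ : UnitBump φ) (h1 : ∀ᶠ ζ in nhds (0 : Rn n), φ ζ = 1)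
    (hχ : Dyadic χ) {c : ℂ} (hc : ∀ ξ, ∑' k, χ k ξ = c) (hu : Rough m u) (α β : List (Fin n)) :
    ∃ C, 0 ≤ C ∧ ∀ x ξ, ‖dxi α (dx β (opS (smAmp φ χ u))) x ξ -
      c * mainT β (fun y => dxi α u y ξ) x‖ ≤
        C * bracket ξ ^ (m - α.length + ((β.length : ℝ) / 2 - 1)) := by
  obtain ⟨K, hK, hKb⟩ := norm_multiplier_sub_mainT_le hφ h1 β
  obtain ⟨B, hB, hBb⟩ := hχ.c11_mul hu α
  set t := (β.length : ℝ) / 2 - 1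
  refine ⟨4 * (K * (4 ^ |t| * B)), by positivity, fun x ξ => ?_⟩
  have hbr := bracket_pos ξ
  have hz : ∀ k, ξ ∉ Shell k → (fun y => dxi α (fun y ξ => χ k ξ * u y ξ) y ξ) = fun _ => 0 :=
    fun k hk => funext fun y => hχ.dxi_mul_eq_zero α hk y
  -- The cut-offs sum to the constant `c`, so the main terms of the pieces add up to `c` times that
  -- of `u`. The case `c = 1` is the smoothing; `c = 0` occurs for the radial derivatives of the
  -- cut-offs.
  have hmain : c * mainT β (fun y => dxi α u y ξ) x =
      ∑' k, mainT β (fun y => dxi α (fun y ξ => χ k ξ * u y ξ) y ξ) x := by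
    rw [tsum_eq_sum_scales (ξ := ξ) fun k hk => by rw [hz k hk, mainT_zero],
      ← mainT_sum _ _ fun k hk => (hBb k ξ (mem_scales.1 hk)).differentiable,
      ← mainT_const_mul _ _ ((hu.bdd α).choose_spec.2 ξ).differentiable]
    congr 1 with y
    rw [← tsum_eq_sum_scales (f := fun k => dxi α (fun y ξ => χ k ξ * u y ξ) y ξ)
      (fun k hk => congrFun (hz k hk) y)]
    have h := wderiv_tsum_shell (π := id) (F := fun k ξ => χ k ξ * u y ξ) continuous_id
      (fun k p hp => by rw [hχ.supp k p hp, zero_mul])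
      (fun k => (hχ.smooth k).mul (hu.smooth y)) bv α ξ
    refine Eq.trans ?_ h
    simp_rw [tsum_mul_right, hc]
    exact (congrFun (wderiv_const_mul (hu.smooth y) c α) ξ).symm
  rw [hmain, dxi_dx_opS_smAmp hφ hχ hu, tsum_eq_sum_scales (ξ := ξ) fun k hk => ?_,
    tsum_eq_sum_scales (ξ := ξ) fun k hk => by rw [hz k hk, mainT_zero],
    ← Finset.sum_sub_distrib]
  · have hS : ∀ k, ξ ∉ Shell k → fourierMultiplier (fun η => etaPow β η * φ ((hlf k)⁻¹ • η))
        (fun y => dxi α (fun y ξ => χ k ξ * u y ξ) y ξ) x -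
        mainT β (fun y => dxi α (fun y ξ => χ k ξ * u y ξ) y ξ) x = 0 := fun k hk => by
      rw [hz k hk, mainT_zero]; simp [fourierMultiplier]
    rw [← tsum_eq_sum_scales hS, mul_assoc]
    refine norm_tsum_le_of_shell (by positivity) hS fun k hk => ?_
    refine (hKb k _ _ (hBb k ξ hk) x).trans ?_
    rw [Real.rpow_add hbr]
    calc _ ≤ K * ((4 ^ |t| * bracket ξ ^ t) * (B * bracket ξ ^ (m - α.length))) := by
          gcongr
          exact lam_rpow_le_of_mem_shell hk t
      _ = _ := by ring
  · rw [hz k hk]; simp [fourierMultiplier]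

/-- The first two `x`-derivatives cost nothing and every further one costs 1/2. This gain of one
order for `|β| ≥ 2`, compared with `S^m_{1,1/2}`, is the source of `𝒜²`. -/
lemma norm_opS_smAmp_le (hφ : UnitBump φ) (h1 : ∀ᶠ ζ in nhds (0 : Rn n), φ ζ = 1)
    (hχ : Dyadic χ) {c : ℂ} (hc : ∀ ξ, ∑' k, χ k ξ = c) (hu : Rough m u) (α β : List (Fin n)) :
    ∃ C, 0 ≤ C ∧ ∀ x ξ, ‖dxi α (dx β (opS (smAmp φ χ u))) x ξ‖ ≤
        C * bracket ξ ^ (m - α.length + max ((β.length : ℝ) / 2 - 1) 0) := by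
  obtain ⟨C, hC, h⟩ := norm_opS_smAmp_sub_le hφ h1 hχ hc hu α β
  obtain ⟨B, hB, hBb⟩ := hu.bdd α
  refine ⟨C + ‖c‖ * B, by positivity, fun x ξ => ?_⟩
  have h2 := norm_sub_le_norm_sub_add_norm_sub (dxi α (dx β (opS (smAmp φ χ u))) x ξ)
    (c * mainT β (fun y => dxi α u y ξ) x) 0
  rw [sub_zero, sub_zero] at h2
  refine h2.trans ?_
  rw [add_mul]
  have hb := one_le_bracket ξ
  have hb0 := bracket_pos ξ
  refine add_le_add ((h x ξ).trans ?_) ?_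
  · gcongr
    exact le_max_left _ _
  · rw [norm_mul, mul_assoc]
    gcongr
    refine ((hBb ξ).norm_mainT_le β x).trans ?_
    gcongr
    linarith [le_max_right ((β.length : ℝ) / 2 - 1) 0]

end SmoothingEstimates

/-! ### The Littlewood–Paley functions as dyadic cut-offs. -/

section LittlewoodPaley

variable {ψ : ℕ → Rn n → ℝ}

lemma IsLittlewoodPaley.scaling' (hψ : IsLittlewoodPaley ψ) {k : ℕ} (hk : 1 ≤ k) (ξ : Rn n) :
    ψ k ξ = ψ 1 ((2 * (lam k)⁻¹) • ξ) := by
  have h : (2 : ℝ) ^ (1 - (k : ℤ)) = 2 * (lam k)⁻¹ := by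
    rw [zpow_sub₀ two_ne_zero, zpow_one, zpow_natCast, lam]; rfl
  rcases hk.eq_or_lt with rfl | hk
  · simp [lam]
  · rw [hψ.scaling k hk, h]

/-- For `k ≥ 1` the function `ψ_k` lives in `λ_k/4 ≤ |ξ| ≤ λ_k`, which is where the constants of
`Shell` come from; `ψ_0` lives in the unit ball. The bounds follow by scaling from `ψ_0` and `ψ_1`.
-/
lemma IsLittlewoodPaley.dyadic (hψ : IsLittlewoodPaley ψ) : Dyadic fun k ξ => (ψ k ξ : ℂ) := by
  have hsm : ∀ k, ContDiff ℝ ∞ fun ξ => (ψ k ξ : ℂ) := fun k =>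
    Complex.ofRealCLM.contDiff.comp (hψ.smooth k)
  have hsupp1 : ∀ ξ, 2 < ‖ξ‖ → (ψ 1 ξ : ℂ) = 0 := fun ξ hξ => by
    rw [hψ.support_one ξ fun h => absurd h.2 (not_le.2 hξ), Complex.ofReal_zero]
  have hbd : ∀ {g : Rn n → ℂ}, ContDiff ℝ ∞ g → ∀ R : ℝ, (∀ ξ, R < ‖ξ‖ → g ξ = 0) →
      ∀ α, ∃ C, 0 ≤ C ∧ ∀ ξ, ‖pderivs α g ξ‖ ≤ C := by
    intro g hg R h0 α
    have hs : HasCompactSupport (pderivs α g) := by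
      refine HasCompactSupport.intro (isCompact_closedBall (0 : Rn n) R) fun η hη => ?_
      exact zero_off_ball_wderiv h0 α η (by simpa using hη)
    obtain ⟨C, hC⟩ := hs.exists_bound_of_continuous (contDiff_wderiv hg α).continuous
    exact ⟨C, (norm_nonneg _).trans (hC 0), hC⟩
  refine ⟨hsm, fun k ξ hξ => ?_, fun α => ?_⟩
  · rcases Nat.eq_zero_or_pos k with rfl | hk
    · rw [hψ.support_zero ξ, Complex.ofReal_zero]
      by_contra h
      refine hξ ⟨?_, ?_⟩
      · have := one_le_bracket ξ
        simp [lam]; linarith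
      · have := bracket_le ξ
        simp [lam]; linarith
    · have hl := lam_pos k
      have hl2 : 2 ≤ lam k := by
        simpa [lam] using pow_le_pow_right₀ (one_le_two (α := ℝ)) hk
      rw [hψ.scaling' hk, hψ.support_one, Complex.ofReal_zero]
      rintro ⟨h1, h2⟩
      rw [norm_smul, Real.norm_of_nonneg (by positivity)] at h1 h2
      have e : lam k * (2 * (lam k)⁻¹ * ‖ξ‖) = 2 * ‖ξ‖ := by field_simp
      have h1' := mul_le_mul_of_nonneg_left h1 hl.le
      have h2' := mul_le_mul_of_nonneg_left h2 hl.le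
      rw [e] at h1' h2'
      refine hξ ⟨?_, ?_⟩
      · have := norm_le_bracket ξ
        linarith
      · have := bracket_le ξ
        linarith
  · obtain ⟨C0, hC0, h0⟩ := hbd (hsm 0) 1 (fun ξ h => by rw [hψ.support_zero ξ h]; simp) α
    obtain ⟨C1, hC1, h1⟩ := hbd (hsm 1) 2 hsupp1 α
    refine ⟨C0 + 2 ^ α.length * C1, by positivity, fun k ξ => ?_⟩
    have hl := lam_pos k
    rcases Nat.eq_zero_or_pos k with rfl | hk
    · refine (h0 ξ).trans ?_
      simp [lam]
      positivity
    · have e : (fun ξ => (ψ k ξ : ℂ)) = fun ξ => (ψ 1 ((2 * (lam k)⁻¹) • ξ) : ℂ) :=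
        funext fun ξ => by rw [hψ.scaling' hk]
      have e1 := wderiv_comp_linear (v := bv) (hsm 1)
        ((2 * (lam k)⁻¹) • ContinuousLinearMap.id ℝ (Rn n)) α
      have e2 := wderiv_smul_dir (v' := bv) (hsm 1) (fun _ : Fin n => 2 * (lam k)⁻¹) id α
      simp only [smul_apply, ContinuousLinearMap.id_apply] at e1
      simp only [id_eq, List.map_const', List.prod_replicate, List.map_id] at e2
      rw [e, pderivs_eq_wderiv_bv, e1, e2, norm_mul, Complex.norm_real,
        Real.norm_of_nonneg (by positivity), mul_pow, Real.rpow_neg hl.le, Real.rpow_natCast, inv_pow]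
      calc _ ≤ 2 ^ α.length * (lam k ^ α.length)⁻¹ * C1 := by
            gcongr
            exact h1 _
        _ = 2 ^ α.length * C1 * (lam k ^ α.length)⁻¹ := by ring
        _ ≤ _ := by
          gcongr
          linarith

lemma IsLittlewoodPaley.tsum_eq_one (hψ : IsLittlewoodPaley ψ) (ξ : Rn n) :
    ∑' k, (ψ k ξ : ℂ) = 1 := by
  have := (hψ.hasSum_one ξ).tsum_eq
  rw [← Complex.ofReal_tsum, this, Complex.ofReal_one]

lemma sharp_eq_opS (φ : Rn n → ℝ) (ψ : ℕ → Rn n → ℝ) (u : Rn n → Rn n → ℂ) :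
    sharp φ ψ u = opS (smAmp (fun η => (φ η : ℂ)) (fun k ξ => (ψ k ξ : ℂ)) u) := by
  funext x ξ
  rw [sharp, opS]
  congr 1 with k
  rw [smAmp, opT_sepAmp, fourierMultiplier, fourierMultiplier, ← integral_mul_const]
  simp_rw [two_rpow_eq_inv_hlf]
  congr 1 with y
  ring

end LittlewoodPaley

/-! ### Sums, products and derivatives of rough symbols. -/

section RoughAlgebra

variable {m m' : ℝ} {u v : Rn n → Rn n → ℂ}

lemma Rough.add (hu : Rough m u) (hv : Rough m v) : Rough m fun x ξ => u x ξ + v x ξ := by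
  refine ⟨fun x => (hu.smooth x).add (hv.smooth x), fun α => ?_⟩
  obtain ⟨C, hC, h⟩ := hu.bdd α
  obtain ⟨C', hC', h'⟩ := hv.bdd α
  refine ⟨C + C', add_nonneg hC hC', fun ξ => ?_⟩
  have e : (fun x => dxi α (fun x ξ => u x ξ + v x ξ) x ξ) = fun x => dxi α u x ξ + dxi α v x ξ :=
    funext fun x => congrFun (wderiv_add (hu.smooth x) (hv.smooth x) α) ξ
  rw [e, add_mul]
  exact (h ξ).add (h' ξ)

lemma dxi_mul (hu : ∀ y, ContDiff ℝ ∞ (u y)) (hv : ∀ y, ContDiff ℝ ∞ (v y)) (α : List (Fin n))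
    (y ξ : Rn n) : dxi α (fun y ξ => u y ξ * v y ξ) y ξ =
      ((splits α).map fun p => dxi p.1 u y ξ * dxi p.2 v y ξ).sum :=
  congrFun (wderiv_mul (hu y) (hv y) α) ξ

/-- The Leibniz rule for `C^{1,1}` bounds. -/
lemma exists_c11_dxi_mul (hus : ∀ y, ContDiff ℝ ∞ (u y)) (hvs : ∀ y, ContDiff ℝ ∞ (v y))
    (α : List (Fin n)) (hu : ∀ α' : List (Fin n), α'.length ≤ α.length → ∃ C, 0 ≤ C ∧
      ∀ ξ, C11 (fun x => dxi α' u x ξ) (C * bracket ξ ^ (m - α'.length)))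
    (hv : ∀ α' : List (Fin n), α'.length ≤ α.length → ∃ C, 0 ≤ C ∧
      ∀ ξ, C11 (fun x => dxi α' v x ξ) (C * bracket ξ ^ (m' - α'.length))) :
    ∃ C, 0 ≤ C ∧ ∀ ξ, C11 (fun x => dxi α (fun x ξ => u x ξ * v x ξ) x ξ)
      (C * bracket ξ ^ (m + m' - α.length)) := by
  choose! A hA hub using hu
  choose! B hB hvb using hv
  have hlen : ∀ p ∈ splits α, p.1.length ≤ α.length ∧ p.2.length ≤ α.length := fun p hp => by
    have := length_of_mem_splits hp
    omega
  refine ⟨((splits α).map fun p => 2 * (1 + n) * (A p.1 * B p.2)).sum, ?_, fun ξ => ?_⟩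
  · refine List.sum_nonneg fun x hx => ?_
    obtain ⟨p, hp, rfl⟩ := List.mem_map.1 hx
    have := hA p.1 (hlen p hp).1; have := hB p.2 (hlen p hp).2
    positivity
  · simp_rw [dxi_mul hus hvs]
    have h := C11.list_sum (splits α) (f := fun p y => dxi p.1 u y ξ * dxi p.2 v y ξ)
      (M := fun p => 2 * (1 + n) * (A p.1 * B p.2) * bracket ξ ^ (m + m' - α.length)) fun p hp => by
        refine ((hub p.1 (hlen p hp).1 ξ).mul (hvb p.2 (hlen p hp).2 ξ)).mono (le_of_eq ?_)
        have h4 : bracket ξ ^ (m + m' - α.length) =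
            bracket ξ ^ (m - p.1.length) * bracket ξ ^ (m' - p.2.length) := by
          rw [← Real.rpow_add (bracket_pos ξ)]
          congr 1
          have : (p.1.length : ℝ) + p.2.length = α.length := by
            exact_mod_cast length_of_mem_splits hp
          linarith
        rw [h4]
        ring
    rwa [List.sum_map_mul_right] at h

lemma Rough.mul (hu : Rough m u) (hv : Rough m' v) : Rough (m + m') fun x ξ => u x ξ * v x ξ :=
  ⟨fun x => (hu.smooth x).mul (hv.smooth x), fun α =>
    exists_c11_dxi_mul hu.smooth hv.smooth α (fun α' _ => hu.bdd α') (fun α' _ => hv.bdd α')⟩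

lemma dxi_append (α β : List (Fin n)) (u : Rn n → Rn n → ℂ) :
    dxi (α ++ β) u = dxi α (dxi β u) := by
  funext x ξ
  exact congrFun (wderiv_append bv α β (u x)) ξ

lemma Rough.dxi (hu : Rough m u) (β : List (Fin n)) : Rough (m - β.length) (PsiDO.dxi β u) := by
  refine ⟨fun x => contDiff_wderiv (hu.smooth x) β, fun α => ?_⟩
  obtain ⟨C, hC, h⟩ := hu.bdd (α ++ β)
  refine ⟨C, hC, fun ξ => ?_⟩
  have := h ξ
  rw [dxi_append] at this
  convert this using 3
  rw [List.length_append]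
  push_cast; ring

/-- Symbols that depend on `ξ` only. -/
lemma rough_of_xi {g : Rn n → ℂ} (hg : ContDiff ℝ ∞ g) (h : ∀ α : List (Fin n), ∃ C, 0 ≤ C ∧
    ∀ ξ, ‖pderivs α g ξ‖ ≤ C * bracket ξ ^ (m - α.length)) : Rough m fun _ => g := by
  refine ⟨fun _ => hg, fun α => ?_⟩
  obtain ⟨C, hC, h⟩ := h α
  exact ⟨C, hC, fun ξ => (C11.const (pderivs α g ξ)).mono (h ξ)⟩

lemma rough_coord (l : Fin n) : Rough 1 fun _ (ξ : Rn n) => ((ξ l : ℝ) : ℂ) := by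
  refine rough_of_xi (contDiff_coord l) fun α => ⟨1, zero_le_one, fun ξ => ?_⟩
  have e := wderiv_clm (Complex.ofRealCLM.comp (EuclideanSpace.proj l : Rn n →L[ℝ] ℝ)) bv α
  have e' : pderivs α (fun ξ : Rn n => ((ξ l : ℝ) : ℂ)) = _ := e
  rw [e', one_mul]
  have hb := bracket_pos ξ
  match α with
  | [] =>
    simp only [List.length_nil, Nat.cast_zero, sub_zero, Real.rpow_one]
    simpa using (abs_coord_le_norm ξ l).trans (norm_le_bracket ξ)
  | [i] =>
    simp only [List.length_cons, List.length_nil, zero_add, Nat.cast_one, sub_self, Real.rpow_zero]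
    have := abs_coord_le_norm (bv i) l
    rw [norm_bv] at this
    simpa using this
  | i :: j :: α =>
    simp only [norm_zero]
    positivity

lemma one_le_bracket_rpow_of_norm_le_one {ξ : Rn n} (hξ : ‖ξ‖ ≤ 1) (t : ℝ) :
    1 ≤ 2 ^ |t| * bracket ξ ^ t := by
  have h := rpow_le_of_comparable (t := bracket ξ) (u := 1) (K := 2) (bracket_pos ξ) (by norm_num)
    (by linarith [bracket_le ξ]) (by linarith [one_le_bracket ξ]) t
  rwa [Real.one_rpow] at h

lemma UnitBump.bdd_bracket {g : Rn n → ℂ} (hg : UnitBump g) (t : ℝ) (α : List (Fin n)) :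
    ∃ C, 0 ≤ C ∧ ∀ ξ, ‖pderivs α g ξ‖ ≤ C * bracket ξ ^ t := by
  obtain ⟨C, hC, h⟩ := hg.bdd α
  refine ⟨C * 2 ^ |t|, by positivity, fun ξ => ?_⟩
  have hb := bracket_pos ξ
  by_cases hξ : ‖ξ‖ ≤ 1
  · rw [mul_assoc]
    exact (h ξ).trans (le_mul_of_one_le_right hC (one_le_bracket_rpow_of_norm_le_one hξ t))
  · rw [pderivs_eq_wderiv_bv, zero_off_ball_wderiv hg.supp α ξ (not_le.1 hξ), norm_zero]
    positivity

lemma UnitBump.rough {g : Rn n → ℂ} (hg : UnitBump g) (m : ℝ) : Rough m fun _ => g :=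
  rough_of_xi hg.smooth fun α => hg.bdd_bracket _ α

lemma isSymbol_of_xi {δ : ℝ} {g : Rn n → ℂ} (hg : ContDiff ℝ ∞ g)
    (h : ∀ α : List (Fin n), ∃ C, 0 ≤ C ∧ ∀ ξ, ‖pderivs α g ξ‖ ≤ C * bracket ξ ^ (m - α.length)) :
    IsSymbol m δ fun _ => g := by
  refine ⟨hg.comp contDiff_snd, fun α β => ?_⟩
  rcases eq_or_ne β [] with rfl | hβ
  · obtain ⟨C, hC, h⟩ := h α
    refine ⟨C, hC, fun x ξ => ?_⟩
    change ‖pderivs α g ξ‖ ≤ _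
    simpa using h ξ
  · refine ⟨0, le_rfl, fun x ξ => ?_⟩
    have e : dx β (fun _ : Rn n => g) = fun _ _ => 0 := by
      funext x ξ
      exact congrFun (wderiv_const bv hβ (g ξ)) x
    have e' : dxi α (fun _ _ : Rn n => (0 : ℂ)) x ξ = 0 := congrFun (wderiv_zero bv α) ξ
    rw [e, e']
    simp

lemma UnitBump.isSymbol {g : Rn n → ℂ} (hg : UnitBump g) (m δ : ℝ) : IsSymbol m δ fun _ => g :=
  isSymbol_of_xi hg.smooth fun α => hg.bdd_bracket _ α

/-- The order of a symbol supported in the unit ball is irrelevant. -/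
lemma Rough.of_supp (hu : Rough m u) (h : ∀ x ξ, 1 < ‖ξ‖ → u x ξ = 0) (m' : ℝ) : Rough m' u := by
  refine ⟨hu.smooth, fun α => ?_⟩
  obtain ⟨C, hC, hb⟩ := hu.bdd α
  refine ⟨C * 2 ^ |m| * 2 ^ |m' - α.length| * 2 ^ |m - α.length|, by positivity, fun ξ => ?_⟩
  have hbr := bracket_pos ξ
  by_cases hξ : ‖ξ‖ ≤ 1
  · refine (hb ξ).mono ?_
    have h1 := one_le_bracket_rpow_of_norm_le_one hξ (m' - α.length)
    have h2 := one_le_bracket_rpow_of_norm_le_one hξ (-(m - α.length))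
    rw [abs_neg, Real.rpow_neg hbr.le, ← div_eq_mul_inv, one_le_div (by positivity)] at h2
    have h3 : (1 : ℝ) ≤ 2 ^ |m| := Real.one_le_rpow (by norm_num) (abs_nonneg m)
    calc C * bracket ξ ^ (m - α.length) ≤ C * 2 ^ |m - α.length| := by gcongr
      _ = (C * 2 ^ |m - α.length|) * 1 := by ring
      _ ≤ (C * 2 ^ |m - α.length|) * (2 ^ |m| * (2 ^ |m' - α.length| * bracket ξ ^ (m' - α.length))) := by
        gcongr
        exact one_le_mul_of_one_le_of_one_le h3 h1
      _ = _ := by ring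
  · have e : (fun x => PsiDO.dxi α u x ξ) = fun _ => 0 := funext fun x =>
      zero_off_ball_wderiv (h x) α ξ (not_le.1 hξ)
    rw [e]
    exact C11.zero.mono (by positivity)

end RoughAlgebra

/-! ### Real powers of elliptic rough symbols. -/

section Powers

lemma pderiv_rpow {f : Rn n → ℝ} {x : Rn n} (hf : DifferentiableAt ℝ (fun x => (f x : ℂ)) x)
    (h : 0 < f x) (s : ℝ) (i : Fin n) :
    DifferentiableAt ℝ (fun x => ((f x ^ s : ℝ) : ℂ)) x ∧
    pderiv i (fun x => ((f x ^ s : ℝ) : ℂ)) x =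
      (s : ℂ) * (((f x ^ (s - 1) : ℝ) : ℂ) * pderiv i (fun x => (f x : ℂ)) x) := by
  have hr : DifferentiableAt ℝ f x := by
    have := (Complex.reCLM.differentiableAt (x := (f x : ℂ))).comp x hf
    exact this
  have h1 := (hr.hasFDerivAt).rpow_const (p := s) (Or.inl h.ne')
  have h2 : HasFDerivAt (fun x => ((f x ^ s : ℝ) : ℂ)) _ x :=
    HasFDerivAt.comp (g := fun t : ℝ => (t : ℂ)) x Complex.ofRealCLM.hasFDerivAt h1
  have h3 : HasFDerivAt (fun x => (f x : ℂ)) _ x :=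
    HasFDerivAt.comp (g := fun t : ℝ => (t : ℂ)) x Complex.ofRealCLM.hasFDerivAt hr.hasFDerivAt
  refine ⟨h2.differentiableAt, ?_⟩
  rw [pderiv, pderiv, h2.fderiv, h3.fderiv]
  simp
  ring

/-- The quotient `f / Λ` takes values in a fixed compact subset of `(0, ∞)` and has `C^{1,1}` bound
`B`; since powers are homogeneous, the constant depends on neither `f` nor `Λ`. -/
lemma exists_c11_rpow {c B : ℝ} (hc : 0 < c) (hB : 0 ≤ B) (s : ℝ) : ∃ C, 0 ≤ C ∧
    ∀ (f : Rn n → ℝ) (Λ : ℝ), 0 < Λ → (∀ x, c * Λ ≤ f x) → C11 (fun x => (f x : ℂ)) (B * Λ) →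
      C11 (fun x => ((f x ^ s : ℝ) : ℂ)) (C * Λ ^ s) := by
  set K := 1 + B + c⁻¹
  have hK : 1 ≤ K := by
    have : 0 < c⁻¹ := by positivity
    simp only [K]; linarith
  have hK0 : 0 < K := by linarith
  let D : ℝ → ℝ := fun s => K ^ |s|
  have hD : ∀ s, 0 ≤ D s := fun s => by positivity
  have h01 := hD s
  have h02 := hD (s - 1)
  have h03 := hD (s - 1 - 1)
  refine ⟨D s + |s| * (D (s - 1) * B) + |s| * (n * (|s - 1| * (D (s - 1 - 1) * B)) * B + D (s - 1) * B),
    by positivity, fun f Λ hΛ hlow hf => ?_⟩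
  have hpos : ∀ x, 0 < f x := fun x => (mul_pos hc hΛ).trans_le (hlow x)
  have hsup : ∀ s x, ‖((f x ^ s : ℝ) : ℂ)‖ ≤ D s * Λ ^ s := fun s x => by
    have hp := hpos x
    rw [Complex.norm_real, Real.norm_of_nonneg (by positivity)]
    refine rpow_le_of_comparable hΛ hK ?_ ?_ s
    · have h1 : Λ ≤ c⁻¹ * f x := by
        rw [← div_eq_inv_mul, le_div_iff₀ hc]; linarith [hlow x]
      refine h1.trans (mul_le_mul_of_nonneg_right ?_ hp.le)
      simp only [K]; linarith
    · have h1 := hf.sup x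
      rw [Complex.norm_real, Real.norm_of_nonneg hp.le] at h1
      refine h1.trans (mul_le_mul_of_nonneg_right ?_ hΛ.le)
      have : 0 < c⁻¹ := by positivity
      simp only [K]; linarith
  have hdf := fun s i x => (pderiv_rpow (hf.differentiable x) (hpos x) s i)
  have hΛs : ∀ s : ℝ, Λ ^ s = Λ ^ (s - 1) * Λ := fun s => by
    rw [Real.rpow_sub_one hΛ.ne']; field_simp
  have hder : ∀ s i x, ‖pderiv i (fun x => ((f x ^ s : ℝ) : ℂ)) x‖ ≤ |s| * (D (s - 1) * B) * Λ ^ s := by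
    intro s i x
    rw [(hdf s i x).2, norm_mul, norm_mul, Complex.norm_real, Real.norm_eq_abs, hΛs s]
    calc _ ≤ |s| * ((D (s - 1) * Λ ^ (s - 1)) * (B * Λ)) := by
          gcongr
          · exact hsup _ x
          · exact hf.sup_deriv i x
      _ = _ := by ring
  have hsm : ContDiff ℝ 1 (fun x => ((f x ^ s : ℝ) : ℂ)) := by
    have hr : ContDiff ℝ 1 f := Complex.reCLM.contDiff.comp hf.contDiff
    exact Complex.ofRealCLM.contDiff.comp (hr.rpow_const_of_ne fun x => (hpos x).ne')
  have hΛ0 : 0 ≤ Λ ^ s := by positivity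
  have t1 : 0 ≤ D s * Λ ^ s := by positivity
  have t2 : 0 ≤ |s| * (D (s - 1) * B) * Λ ^ s := by positivity
  have t3 : 0 ≤ |s| * (n * (|s - 1| * (D (s - 1 - 1) * B)) * B + D (s - 1) * B) * Λ ^ s := by positivity
  refine ⟨hsm, fun x => (hsup s x).trans ?_, fun i x => (hder s i x).trans ?_, fun i x y => ?_⟩
  · rw [add_mul, add_mul]; linarith
  · rw [add_mul, add_mul]; linarith
  · rw [(hdf s i x).2, (hdf s i y).2, ← mul_sub, norm_mul, Complex.norm_real, Real.norm_eq_abs]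
    have hl := norm_sub_le_of_pderiv_le (fun x => (hdf (s - 1) i x).1)
      (by have := hD (s - 1 - 1); positivity) (fun j x => hder (s - 1) j x) x y
    have h4 := norm_mul_sub_mul_le (hsup (s - 1) y) (hf.sup_deriv i x) hl (hf.lip_deriv i x y)
    calc _ ≤ |s| * _ := mul_le_mul_of_nonneg_left h4 (abs_nonneg s)
      _ = |s| * (n * (|s - 1| * (D (s - 1 - 1) * B)) * B + D (s - 1) * B) * (Λ ^ (s - 1) * Λ) * ‖x - y‖ := by
        ring
      _ ≤ _ := by
        rw [← hΛs]
        gcongr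
        have : 0 ≤ D s + |s| * (D (s - 1) * B) := by positivity
        linarith

/-- Powers of positive elliptic rough symbols. -/
theorem rough_rpow {A : Rn n → Rn n → ℝ} (hA : Rough 2 fun x ξ => (A x ξ : ℂ)) {c : ℝ} (hc : 0 < c)
    (hlow : ∀ x ξ, c * bracket ξ ^ 2 ≤ A x ξ) (s : ℝ) :
    Rough (2 * s) fun x ξ => ((A x ξ ^ s : ℝ) : ℂ) := by
  have hpos : ∀ x ξ, 0 < A x ξ := fun x ξ =>
    (mul_pos hc (pow_pos (bracket_pos ξ) 2)).trans_le (hlow x ξ)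
  have hsm : ∀ (s : ℝ) x, ContDiff ℝ ∞ fun ξ => ((A x ξ ^ s : ℝ) : ℂ) := fun s x => by
    have hr : ContDiff ℝ ∞ (A x) := Complex.reCLM.contDiff.comp (hA.smooth x)
    exact Complex.ofRealCLM.contDiff.comp (hr.rpow_const_of_ne fun ξ => (hpos x ξ).ne')
  refine ⟨hsm s, fun α => ?_⟩
  -- Induction on the order with the exponent free: the innermost derivative gives `s A^{s-1} ∂_i
  -- A`, and the remaining word is distributed by Leibniz, with lower-order derivatives of
  -- `A^{s-1}`.
  induction hN : α.length using Nat.strong_induction_on generalizing α s with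
  | _ N ih =>
    subst hN
    rcases α.eq_nil_or_concat with rfl | ⟨w, i, rfl⟩
    · obtain ⟨B, hB, hb⟩ := hA.bdd []
      obtain ⟨C, hC, h⟩ := exists_c11_rpow (n := n) hc hB s
      refine ⟨C, hC, fun ξ => ?_⟩
      have hb' := bracket_pos ξ
      have := h (fun x => A x ξ) (bracket ξ ^ 2) (by positivity) (fun x => hlow x ξ) ?_
      · rw [← Real.rpow_natCast, ← Real.rpow_mul hb'.le] at this
        have e : (2 : ℝ) * s - (([] : List (Fin n)).length : ℝ) = ((2 : ℕ) : ℝ) * s := by simp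
        rw [e]
        exact this
      · have := hb ξ
        simp only [List.length_nil, Nat.cast_zero, sub_zero] at this
        rw [show (2 : ℝ) = ((2 : ℕ) : ℝ) by norm_num, Real.rpow_natCast] at this
        exact this
    · rw [List.concat_eq_append]
      rw [List.concat_eq_append] at ih
      have e1 : ∀ x, pderivs [i] (fun ξ => ((A x ξ ^ s : ℝ) : ℂ)) =
          fun ξ => (s : ℂ) * (((A x ξ ^ (s - 1) : ℝ) : ℂ) * dxi [i] (fun x ξ => (A x ξ : ℂ)) x ξ) :=
        fun x => funext fun ξ => (pderiv_rpow
          (differentiable_of_smooth (hA.smooth x) ξ) (hpos x ξ) s i).2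
      have hd := hA.dxi [i]
      have e2 : ∀ x ξ, dxi (w ++ [i]) (fun x ξ => ((A x ξ ^ s : ℝ) : ℂ)) x ξ =
          s * dxi w (fun x ξ => ((A x ξ ^ (s - 1) : ℝ) : ℂ) *
            dxi [i] (fun x ξ => (A x ξ : ℂ)) x ξ) x ξ := by
        intro x ξ
        rw [dxi_append]
        have := congrFun (wderiv_const_mul (v := bv) ((hsm (s - 1) x).mul (hd.smooth x)) (s : ℂ) w) ξ
        refine Eq.trans ?_ this
        change wderiv bv w (pderivs [i] _) ξ = _
        rw [e1]
      obtain ⟨C, hC, h⟩ := exists_c11_dxi_mul (hsm (s - 1)) hd.smooth w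
        (fun α' hα' => ih α'.length (by simp; omega) (s - 1) α' rfl) (fun α' _ => hd.bdd α')
      refine ⟨2 * (1 + n) * (|s| * C), by positivity, fun ξ => ?_⟩
      simp_rw [e2]
      refine ((h ξ).const_mul (s : ℂ)).mono (le_of_eq ?_)
      rw [Complex.norm_real, Real.norm_eq_abs]
      have : 2 * (s - 1) + (2 - (([i] : List (Fin n)).length : ℝ)) - w.length =
        2 * s - ((w ++ [i]).length : ℝ) := by simp; ring
      rw [this]
      ring

end Powers

/-! ### The regularised square root. -/

section SquareRoot

/-- A bump function that is positive exactly in the open unit ball. -/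
def bump (ξ : Rn n) : ℝ := expNegInvGlue (1 - ‖ξ‖ ^ 2)

lemma unitBump_bump : UnitBump fun ξ : Rn n => (bump ξ : ℂ) := by
  refine ⟨?_, fun ξ hξ => ?_⟩
  · refine Complex.ofRealCLM.contDiff.comp (g := fun t : ℝ => (t : ℂ)) ?_
    exact (expNegInvGlue.contDiff (n := ⊤)).comp (contDiff_const.sub (contDiff_norm_sq ℝ))
  · rw [bump, expNegInvGlue.zero_of_nonpos (by nlinarith), Complex.ofReal_zero]

lemma bump_eq_zero {ξ : Rn n} (hξ : 1 ≤ ‖ξ‖) : bump ξ = 0 :=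
  expNegInvGlue.zero_of_nonpos (by nlinarith)

variable {A : Rn n → Rn n → ℝ}

/-- Scaling `ξ` by `1 + R` moves it into the region where ellipticity is known; homogeneity brings
the bound back with the same `κ`. -/
lemma IsElliptic.lower_bound (h0 : ∀ x ξ, 0 ≤ A x ξ) (he : IsElliptic 2 fun x ξ => (A x ξ : ℂ))
    (hh : IsHomogeneous 2 fun x ξ => (A x ξ : ℂ)) :
    ∃ κ, 0 < κ ∧ ∀ x ξ, 1 ≤ ‖ξ‖ → κ * ‖ξ‖ ^ 2 ≤ A x ξ := by
  obtain ⟨κ, R, hκ, hR, h⟩ := he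
  refine ⟨κ, hκ, fun x ξ hξ => ?_⟩
  have ht : 1 ≤ 1 + R := by linarith
  have h1 := h x ((1 + R) • ξ) (by
    rw [norm_smul, Real.norm_of_nonneg (by linarith)]; nlinarith)
  rw [hh x ξ (1 + R) ht hξ, norm_mul, norm_smul, Complex.norm_real, Complex.norm_real,
    Real.norm_of_nonneg (h0 x ξ), Real.norm_of_nonneg (show 0 ≤ 1 + R by linarith),
    Real.norm_of_nonneg (show 0 ≤ (1 + R) ^ (2 : ℝ) by positivity)] at h1
  rw [Real.rpow_two, Real.rpow_two, mul_pow] at h1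
  have h2 : 0 < (1 + R) ^ 2 := by positivity
  nlinarith

/-- The bump degenerates at the unit sphere, so in a thin shell inside it the bound for `A` on the
sphere is carried inwards by Lipschitz continuity in `ξ`. Deeper inside, the bump is bounded below.
-/
lemma exists_lower_bound (hA : Rough 2 fun x ξ => (A x ξ : ℂ)) (h0 : ∀ x ξ, 0 ≤ A x ξ) {κ : ℝ}
    (hκ : 0 < κ) (h : ∀ x ξ, 1 ≤ ‖ξ‖ → κ * ‖ξ‖ ^ 2 ≤ A x ξ) :
    ∃ c, 0 < c ∧ ∀ x ξ, c * bracket ξ ^ 2 ≤ A x ξ + bump ξ := by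
  choose C hC hb using fun i : Fin n => hA.norm_dxi_le [i]
  set L := n * ((∑ i, C i) * 2) + κ
  have hS : 0 ≤ ∑ i, C i := Finset.sum_nonneg fun i _ => hC i
  have hL : κ ≤ L := by
    have : 0 ≤ n * ((∑ i, C i) * 2) := by positivity
    linarith
  have hL0 : 0 < L := hκ.trans_le hL
  -- Chosen so that the Lipschitz loss `L δ` is half of the bound `κ` on the sphere. As `⟨ξ⟩² ≤ 2`
  -- in the unit ball, `κ/4` and `q/2` are then admissible constants.
  set δ := κ / (2 * L)
  have hδ : 0 < δ := by positivity
  have hδ2 : δ ≤ 1 / 2 := by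
    rw [div_le_div_iff₀ (by positivity) (by norm_num)]; linarith
  have hLδ : L * δ = κ / 2 := by simp only [δ]; field_simp
  set q := expNegInvGlue (1 - (1 - δ) ^ 2)
  have hq : 0 < q := expNegInvGlue.pos_of_pos (by nlinarith)
  refine ⟨min (κ / 4) (q / 2), lt_min (by positivity) (by positivity), fun x ξ => ?_⟩
  have hbr := bracket_sq ξ
  have hn0 := norm_nonneg ξ
  have hbump : 0 ≤ bump ξ := expNegInvGlue.nonneg _
  rcases le_or_gt 1 ‖ξ‖ with h1 | h1
  · calc _ ≤ κ / 4 * bracket ξ ^ 2 := by gcongr; exact min_le_left _ _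
      _ ≤ A x ξ + bump ξ := by
        have hs : 1 ≤ ‖ξ‖ ^ 2 := one_le_pow₀ h1
        rw [hbr]; nlinarith [h x ξ h1, mul_le_mul_of_nonneg_left hs hκ.le]
  · have hs : ‖ξ‖ ^ 2 ≤ 1 := pow_le_one₀ hn0 h1.le
    rcases le_or_gt (1 - δ) ‖ξ‖ with h2 | h2
    · have hpos : 0 < ‖ξ‖ := by linarith
      set ζ := ‖ξ‖⁻¹ • ξ
      have hζ : ‖ζ‖ = 1 := by simp [ζ, norm_smul, hpos.ne']
      have hd : ‖ζ - ξ‖ ≤ δ := by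
        have e : ζ - ξ = (‖ξ‖⁻¹ - 1) • ξ := by rw [sub_smul, one_smul]
        have h3 : 0 ≤ ‖ξ‖⁻¹ - 1 := by
          have := (one_le_inv₀ hpos).2 h1.le
          linarith
        rw [e, norm_smul, Real.norm_of_nonneg h3, sub_mul, inv_mul_cancel₀ hpos.ne']
        linarith
      have hlip := Convex.norm_image_sub_le_of_norm_fderiv_le (𝕜 := ℝ) (f := fun ξ => (A x ξ : ℂ))
        (s := Metric.closedBall 0 1) (C := L) (x := ξ) (y := ζ)
        (fun z _ => differentiable_of_smooth (hA.smooth x) z) (fun z hz => ?_)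
        (convex_closedBall _ _) (by simpa using h1.le) (by simp [hζ])
      · rw [← Complex.ofReal_sub, Complex.norm_real, Real.norm_eq_abs] at hlip
        have h4 := (le_abs_self _).trans (hlip.trans (mul_le_mul_of_nonneg_left hd hL0.le))
        have h5 := h x ζ hζ.ge
        rw [hζ] at h5
        calc _ ≤ κ / 4 * bracket ξ ^ 2 := by gcongr; exact min_le_left _ _
          _ ≤ A x ξ + bump ξ := by rw [hbr]; nlinarith [mul_le_mul_of_nonneg_left hs hκ.le]
      · have hz' : ‖z‖ ≤ 1 := by simpa using hz
        refine (norm_clm_le_sum _ (B := (∑ i, C i) * 2) (by positivity) fun i => ?_).trans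
          (by simp only [L]; linarith)
        refine (hb i x z).trans ?_
        have h6 := bracket_le z
        have h7 := bracket_pos z
        have h8 : bracket z ^ ((2 : ℝ) - (([i] : List (Fin n)).length : ℝ)) = bracket z := by
          simp; norm_num
        rw [h8]
        have := Finset.single_le_sum (f := C) (fun i _ => hC i) (Finset.mem_univ i)
        have := hC i
        nlinarith
    · have h3 : q ≤ bump ξ := expNegInvGlue.monotone (by nlinarith)
      calc _ ≤ q / 2 * bracket ξ ^ 2 := by gcongr; exact min_le_right _ _
        _ ≤ A x ξ + bump ξ := by rw [hbr]; nlinarith [h0 x ξ, mul_le_mul_of_nonneg_left hs hq.le]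

/-- The square root of a non-negative elliptic homogeneous symbol, modified for small `ξ`. -/
theorem exists_sqrt_symbol (hA : Rough 2 fun x ξ => (A x ξ : ℂ)) (h0 : ∀ x ξ, 0 ≤ A x ξ)
    (he : IsElliptic 2 fun x ξ => (A x ξ : ℂ)) (hh : IsHomogeneous 2 fun x ξ => (A x ξ : ℂ)) :
    ∃ a : Rn n → Rn n → ℝ, (Rough 1 fun x ξ => (a x ξ : ℂ)) ∧
      (∀ x ξ, a x ξ ^ 2 = A x ξ + bump ξ) ∧ (∀ x ξ, 1 ≤ ‖ξ‖ → a x ξ = Real.sqrt (A x ξ)) ∧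
      (IsHomogeneous 1 fun x ξ => (a x ξ : ℂ)) ∧ ∃ c, 0 < c ∧ ∀ x ξ, c * bracket ξ ≤ a x ξ := by
  obtain ⟨κ, hκ, hκb⟩ := IsElliptic.lower_bound h0 he hh
  obtain ⟨c, hc, hcb⟩ := exists_lower_bound hA h0 hκ hκb
  have hA1 : Rough 2 fun x ξ => ((A x ξ + bump ξ : ℝ) : ℂ) := by
    simpa using hA.add (unitBump_bump.rough 2)
  have hpos : ∀ x ξ, 0 ≤ A x ξ + bump ξ := fun x ξ => add_nonneg (h0 x ξ) (expNegInvGlue.nonneg _)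
  refine ⟨fun x ξ => Real.sqrt (A x ξ + bump ξ), ?_, fun x ξ => Real.sq_sqrt (hpos x ξ),
    fun x ξ hξ => by simp [bump_eq_zero hξ], fun x ξ t ht hξ => ?_, Real.sqrt c,
    Real.sqrt_pos.2 hc, fun x ξ => ?_⟩
  · simp_rw [Real.sqrt_eq_rpow]
    have := rough_rpow hA1 hc hcb (1 / 2)
    rwa [show (2 : ℝ) * (1 / 2) = 1 by norm_num] at this
  · have h1 : 1 ≤ ‖t • ξ‖ := by
      rw [norm_smul, Real.norm_of_nonneg (by linarith)]; nlinarith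
    have h2 := hh x ξ t ht hξ
    have h3 : A x (t • ξ) = t ^ 2 * A x ξ := by
      dsimp only at h2
      rw [Real.rpow_two] at h2; exact_mod_cast h2
    dsimp only
    rw [bump_eq_zero h1, bump_eq_zero hξ, add_zero, add_zero, h3, Real.sqrt_mul (by positivity),
      Real.sqrt_sq (by linarith), Real.rpow_one, Complex.ofReal_mul]
  · refine Real.le_sqrt_of_sq_le ?_
    rw [mul_pow, Real.sq_sqrt hc.le]
    exact hcb x ξ

end SquareRoot

/-! ### Smoothing preserves real-valuedness. -/

section Reality

lemma IsCutoff.neg {φ : Rn n → ℝ} (hφ : IsCutoff φ) (η : Rn n) : φ (-η) = φ η :=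
  hφ.radial _ _ (norm_neg η)

lemma conj_osc (z η : Rn n) : (starRingEnd ℂ) (osc z η) = osc z (-η) := by
  rw [osc, osc, ← Complex.exp_conj, map_mul, Complex.conj_I, Complex.conj_ofReal, inner_neg_right]
  push_cast; ring_nf

/-- Conjugation turns `η` into `-η`, so evenness makes the kernel real. Radiality of `φ` supplies
the evenness. -/
lemma conj_invHat {g : Rn n → ℝ} (hg : ∀ η, g (-η) = g η) (z : Rn n) :
    (starRingEnd ℂ) (invHat (fun η => (g η : ℂ)) z) = invHat (fun η => (g η : ℂ)) z := by
  rw [invHat_eq, map_mul, map_inv₀, Complex.conj_ofReal, ← integral_conj]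
  congr 1
  rw [← integral_neg_eq_self]
  congr 1 with η
  rw [map_mul, Complex.conj_ofReal, conj_osc, neg_neg, hg]

/-- Smoothing a real-valued symbol gives a real-valued symbol. -/
lemma sharp_ofReal {φ : Rn n → ℝ} (hφ : IsCutoff φ) (ψ : ℕ → Rn n → ℝ) (a : Rn n → Rn n → ℝ)
    (x ξ : Rn n) :
    ((sharp φ ψ (fun x ξ => (a x ξ : ℂ)) x ξ).re : ℂ) = sharp φ ψ (fun x ξ => (a x ξ : ℂ)) x ξ := by
  rw [sharp]
  have h : ∀ k : ℕ, fourierMultiplier (fun η => (φ (((2 : ℝ) ^ (-(k : ℝ) / 2)) • η) : ℂ))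
      (fun y => (a y ξ : ℂ)) x * (ψ k ξ : ℂ) =
      (((fourierMultiplier (fun η => (φ (((2 : ℝ) ^ (-(k : ℝ) / 2)) • η) : ℂ))
      (fun y => (a y ξ : ℂ)) x).re * ψ k ξ : ℝ) : ℂ) := by
    intro k
    rw [Complex.ofReal_mul]
    congr 1
    refine (Complex.conj_eq_iff_re.1 ?_).symm
    rw [fourierMultiplier, ← integral_conj]
    congr 1 with y
    rw [map_mul, Complex.conj_ofReal, conj_invHat]
    intro η
    rw [smul_neg, hφ.neg]
  simp_rw [h]
  rw [← Complex.ofReal_tsum, Complex.ofReal_re]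

end Reality

/-! ### The class, the ellipticity and the approximation order of smoothed symbols. -/

section SharpSymbol

variable {φ : Rn n → ℝ} {ψ : ℕ → Rn n → ℝ} {m : ℝ} {u : Rn n → Rn n → ℂ}

lemma IsCutoff.near_zero' (hφ : IsCutoff φ) : ∀ᶠ ζ in nhds (0 : Rn n), (φ ζ : ℂ) = 1 := by
  filter_upwards [hφ.near_zero] with ζ h
  rw [h, Complex.ofReal_one]

lemma isSymbol_sharp (hφ : IsCutoff φ) (hψ : IsLittlewoodPaley ψ) (hu : Rough m u) :
    IsSymbol m (1 / 2) (sharp φ ψ u) := by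
  rw [sharp_eq_opS]
  exact (isAmp_smAmp hφ.unitBump hψ.dyadic hu).isSymbol_opS

lemma norm_sharp_sub_le (hφ : IsCutoff φ) (hψ : IsLittlewoodPaley ψ) (hu : Rough m u)
    (α β : List (Fin n)) : ∃ C, 0 ≤ C ∧ ∀ x ξ,
      ‖dxi α (dx β (sharp φ ψ u)) x ξ - mainT β (fun y => dxi α u y ξ) x‖ ≤
        C * bracket ξ ^ (m - α.length + ((β.length : ℝ) / 2 - 1)) := by
  rw [sharp_eq_opS]
  simpa using norm_opS_smAmp_sub_le hφ.unitBump hφ.near_zero' hψ.dyadic hψ.tsum_eq_one hu α β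

lemma norm_sharp_le (hφ : IsCutoff φ) (hψ : IsLittlewoodPaley ψ) (hu : Rough m u)
    (α β : List (Fin n)) : ∃ C, 0 ≤ C ∧ ∀ x ξ, ‖dxi α (dx β (sharp φ ψ u)) x ξ‖ ≤
        C * bracket ξ ^ (m - α.length + max ((β.length : ℝ) / 2 - 1) 0) := by
  rw [sharp_eq_opS]
  exact norm_opS_smAmp_le hφ.unitBump hφ.near_zero' hψ.dyadic hψ.tsum_eq_one hu α β

lemma pderivs_dxi {b : Rn n → Rn n → ℂ} (hb : ContDiff ℝ ∞ (Function.uncurry b))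
    (α β : List (Fin n)) (x ξ : Rn n) :
    pderivs β (fun x => dxi α b x ξ) x = dxi α (dx β b) x ξ :=
  congrFun (congrFun (dx_dxi_comm hb α β) x) ξ

lemma contDiff_dxi_slice {b : Rn n → Rn n → ℂ} (hb : ContDiff ℝ ∞ (Function.uncurry b))
    (α : List (Fin n)) (ξ : Rn n) : ContDiff ℝ ∞ fun x => dxi α b x ξ :=
  (contDiff_dxi hb α).comp (contDiff_id.prodMk contDiff_const)

lemma contDiff_slice_right {b : Rn n → Rn n → ℂ} (hb : ContDiff ℝ ∞ (Function.uncurry b))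
    (x : Rn n) : ContDiff ℝ ∞ (b x) :=
  hb.comp (contDiff_const.prodMk contDiff_id)

lemma exists_uniform_word (N : ℕ) {Q : List (Fin n) → ℝ → Prop}
    (hm : ∀ w C C', C ≤ C' → Q w C → Q w C') (h : ∀ w, ∃ C, 0 ≤ C ∧ Q w C) :
    ∃ C, 0 ≤ C ∧ ∀ w : List (Fin n), w.length ≤ N → Q w C := by
  choose C hC hQ using h
  have hf := List.finite_length_le (Fin n) N
  refine ⟨∑ w ∈ hf.toFinset, C w, Finset.sum_nonneg fun w _ => hC w, fun w hw => ?_⟩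
  refine hm w _ _ ?_ (hQ w)
  exact Finset.single_le_sum (f := C) (fun w _ => hC w) (hf.mem_toFinset.2 hw)

/-- Applied to a difference of derivatives, with a sup bound as `X` and a Lipschitz bound as `Y`, it
yields a Hölder bound. -/
lemma le_interpolate {t X Y σ : ℝ} (ht : 0 ≤ t) (h1 : t ≤ X) (h2 : t ≤ Y) (hσ : 0 ≤ σ)
    (hσ1 : σ ≤ 1) : t ≤ X ^ (1 - σ) * Y ^ σ := by
  calc t = t ^ (1 - σ) * t ^ σ := by
        rw [← Real.rpow_add_of_nonneg ht (by linarith) hσ]; simp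
    _ ≤ _ := by
      gcongr
      exact Real.rpow_nonneg (ht.trans h1) _

lemma intPart_add_holderPart {r : ℝ} (hr : 1 < r) : 1 ≤ intPart r ∧ (intPart r : ℝ) + holderPart r = r ∧
    0 < holderPart r ∧ holderPart r ≤ 1 := by
  have h1 : 1 < ⌈r⌉₊ := Nat.lt_ceil.2 (by simpa using hr)
  have h2 := Nat.le_ceil r
  have h3 := Nat.ceil_lt_add_one (show 0 ≤ r by linarith)
  have h4 : (intPart r : ℝ) = ⌈r⌉₊ - 1 := by
    rw [intPart, Nat.cast_sub h1.le, Nat.cast_one]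
  refine ⟨by unfold intPart; omega, by rw [holderPart]; ring, ?_, ?_⟩ <;>
    rw [holderPart, h4] <;> linarith

/-- The derivatives of orders `l` and `l + 1` grow like the powers `l/2 - 1` and `(l+1)/2 - 1` of
`⟨ξ⟩` when `l ≥ 2`. Interpolating at `σ` gives `(l + σ)/2 - 1 = s/2` for the Hölder seminorm. -/
theorem isASymbol_sharp (hφ : IsCutoff φ) (hψ : IsLittlewoodPaley ψ) (hu : Rough m u) :
    IsASymbol 2 m (1 / 2) (sharp φ ψ u) := by
  have hb := isSymbol_sharp hφ hψ hu
  refine ⟨hb, fun α s hs => ?_⟩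
  obtain ⟨hl1, hsum, hσ0, hσ1⟩ := intPart_add_holderPart (r := 2 + s) (by linarith)
  set l := intPart (2 + s)
  set σ := holderPart (2 + s)
  obtain ⟨K, hK, hKb⟩ := exists_uniform_word (l + 1)
    (Q := fun β C => ∀ x ξ, ‖dxi α (dx β (sharp φ ψ u)) x ξ‖ ≤
        C * bracket ξ ^ (m - α.length + max ((β.length : ℝ) / 2 - 1) 0))
    (fun w C C' hC h x ξ => (h x ξ).trans (by have := bracket_pos ξ; gcongr))
    (norm_sharp_le hφ hψ hu α)
  have hl1' : (1 : ℝ) ≤ l := by exact_mod_cast hl1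
  refine ⟨K + (n + 2) * K, by positivity, fun ξ => ⟨?_, K * bracket ξ ^ (m - α.length + 1 / 2 * s),
    (n + 2) * K * bracket ξ ^ (m - α.length + 1 / 2 * s), ?_, ?_, ?_, fun w hw x => ?_,
    fun w hw x y => ?_⟩⟩
  · exact (contDiff_dxi_slice hb.1 α ξ).of_le (by exact_mod_cast le_top)
  · have := bracket_pos ξ; positivity
  · have := bracket_pos ξ; positivity
  · exact (add_mul _ _ _).ge
  · rw [pderivs_dxi hb.1]
    refine (hKb w (by omega) x ξ).trans ?_
    have := one_le_bracket ξ
    gcongr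
    rw [max_le_iff]
    have : (w.length : ℝ) ≤ l := by exact_mod_cast hw
    constructor <;> linarith
  · have hbr := bracket_pos ξ
    set D := fun x => pderivs w (fun x => dxi α (sharp φ ψ u) x ξ) x
    have h1 : ∀ x, ‖D x‖ ≤ K * bracket ξ ^ (m - α.length + max ((l : ℝ) / 2 - 1) 0) := fun x => by
      simp only [D]
      rw [pderivs_dxi hb.1, show l = w.length from hw.symm]
      exact hKb w (by omega) x ξ
    have h2 : ∀ i x, ‖pderiv i D x‖ ≤ K * bracket ξ ^ (m - α.length + (((l : ℝ) + 1) / 2 - 1)) := by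
      intro i x
      have e : pderiv i D x = dxi α (dx (i :: w) (sharp φ ψ u)) x ξ := by
        rw [← pderivs_dxi hb.1]; rfl
      rw [e]
      refine (hKb (i :: w) (by simp; omega) x ξ).trans (le_of_eq ?_)
      rw [List.length_cons, hw, max_eq_left (by push_cast; linarith)]
      push_cast; rfl
    have hD : Differentiable ℝ D :=
      differentiable_of_smooth (contDiff_wderiv (contDiff_dxi_slice hb.1 α ξ) w)
    have h3 := norm_sub_le_of_pderiv_le hD (by positivity) h2 x y
    have h4 : ‖D x - D y‖ ≤ (n + 2) * K * bracket ξ ^ (m - α.length + max ((l : ℝ) / 2 - 1) 0) := by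
      have : 0 ≤ n * K * bracket ξ ^ (m - α.length + max ((l : ℝ) / 2 - 1) 0) := by positivity
      linarith [norm_sub_le (D x) (D y), h1 x, h1 y]
    have h5 : ‖D x - D y‖ ≤ (n + 2) * K * bracket ξ ^ (m - α.length + (((l : ℝ) + 1) / 2 - 1)) *
        ‖x - y‖ := by
      refine h3.trans ?_
      rw [← mul_assoc]
      gcongr
      linarith
    refine (le_interpolate (norm_nonneg _) h4 h5 hσ0.le hσ1).trans (le_of_eq ?_)
    have hnK : 0 ≤ (n + 2) * K := by positivity
    rw [Real.mul_rpow hnK (by positivity), Real.mul_rpow (by positivity) (norm_nonneg _),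
      Real.mul_rpow hnK (by positivity), ← Real.rpow_mul hbr.le, ← Real.rpow_mul hbr.le]
    have e1 : ((n + 2) * K) ^ (1 - σ) * ((n + 2) * K) ^ σ = (n + 2) * K := by
      rw [← Real.rpow_add_of_nonneg hnK (by linarith) hσ0.le]; simp
    have e2 : bracket ξ ^ ((m - α.length + max ((l : ℝ) / 2 - 1) 0) * (1 - σ)) *
        bracket ξ ^ ((m - α.length + (((l : ℝ) + 1) / 2 - 1)) * σ) =
        bracket ξ ^ (m - α.length + 1 / 2 * s) := by
      rw [← Real.rpow_add hbr]
      congr 1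
      have hs' : s = l + σ - 2 := by linarith
      -- If `l = 1` the maximum is 0 rather than `l/2 - 1`, but then `l + σ = 2 + s` forces `σ = 1`
      -- and `s = 0`.
      rcases Nat.lt_or_ge l 2 with h | h
      · have hl : (l : ℝ) = 1 := by exact_mod_cast (by omega : l = 1)
        have hσ' : σ = 1 := by linarith
        have hs0 : s = 0 := by linarith
        rw [hl, hσ', hs0]; norm_num
      · have hl : (2 : ℝ) ≤ l := by exact_mod_cast h
        rw [max_eq_left (by linarith), hs']
        ring
    calc _ = (((n + 2) * K) ^ (1 - σ) * ((n + 2) * K) ^ σ) *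
          (bracket ξ ^ ((m - α.length + max ((l : ℝ) / 2 - 1) 0) * (1 - σ)) *
        bracket ξ ^ ((m - α.length + (((l : ℝ) + 1) / 2 - 1)) * σ)) * ‖x - y‖ ^ σ := by ring
      _ = _ := by rw [e1, e2]

/-- A symbol and its smoothing differ by a symbol of lower order. -/
theorem isRoughSymbol_sub_sharp (hφ : IsCutoff φ) (hψ : IsLittlewoodPaley ψ) (hu : Rough m u) :
    IsRoughSymbol 2 (m - 1) (1 / 2) fun x ξ => u x ξ - sharp φ ψ u x ξ := by
  have hb := isSymbol_sharp hφ hψ hu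
  have e : ∀ α x ξ, dxi α (fun x ξ => u x ξ - sharp φ ψ u x ξ) x ξ =
      dxi α u x ξ - dxi α (sharp φ ψ u) x ξ := fun α x ξ =>
    congrFun (wderiv_sub (hu.smooth x) (contDiff_slice_right hb.1 x) α) ξ
  choose Cu hCu hub using hu.bdd
  have hds : ∀ α ξ x, DifferentiableAt ℝ (fun x => dxi α (sharp φ ψ u) x ξ) x := fun α ξ x =>
    differentiable_of_smooth (contDiff_dxi_slice hb.1 α ξ) x
  have e' : ∀ α i x ξ, pderiv i (fun x => dxi α (fun x ξ => u x ξ - sharp φ ψ u x ξ) x ξ) x =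
      pderiv i (fun x => dxi α u x ξ) x - dxi α (dx [i] (sharp φ ψ u)) x ξ := fun α i x ξ => by
    simp_rw [e]
    rw [pderiv, fderiv_fun_sub ((hub α ξ).differentiable x) (hds α ξ x), ← pderivs_dxi hb.1]
    rfl
  refine isRoughSymbol_two (by norm_num)
    (fun x => (hu.smooth x).sub (contDiff_slice_right hb.1 x)) (fun α ξ => ?_) (fun α => ?_)
    (fun α => ?_) (fun α => ?_)
  · simp_rw [e]
    exact (hub α ξ).contDiff.sub ((contDiff_dxi_slice hb.1 α ξ).of_le (by exact_mod_cast le_top))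
  · obtain ⟨C, hC, h⟩ := norm_sharp_sub_le hφ hψ hu α []
    refine ⟨C, hC, fun x ξ => ?_⟩
    rw [e, norm_sub_rev]
    refine (h x ξ).trans (le_of_eq ?_)
    congr 2
    simp; ring
  · choose C hC h using fun i : Fin n => norm_sharp_sub_le hφ hψ hu α [i]
    refine ⟨∑ i, C i, Finset.sum_nonneg fun i _ => hC i, fun i x ξ => ?_⟩
    rw [e', norm_sub_rev]
    have := bracket_pos ξ
    refine (h i x ξ).trans ?_
    have e2 : m - α.length + ((([i] : List (Fin n)).length : ℝ) / 2 - 1) = m - 1 - α.length + 1 / 2 := by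
      simp; ring
    rw [e2]
    gcongr
    exact Finset.single_le_sum (f := C) (fun i _ => hC i) (Finset.mem_univ i)
  · choose C hC h using fun i j : Fin n => norm_sharp_le hφ hψ hu α [i, j]
    have hS : 0 ≤ ∑ i, ∑ j, C i j := Finset.sum_nonneg fun i _ => Finset.sum_nonneg fun j _ => hC i j
    have hle : ∀ i j, C i j ≤ ∑ i, ∑ j, C i j := fun i j =>
      (Finset.single_le_sum (f := C i) (fun j _ => hC i j) (Finset.mem_univ j)).trans
      (Finset.single_le_sum (f := fun i => ∑ j, C i j)
        (fun i _ => Finset.sum_nonneg fun j _ => hC i j) (Finset.mem_univ i))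
    refine ⟨Cu α + n * ∑ i, ∑ j, C i j, by have := hCu α; positivity, fun i x y ξ => ?_⟩
    -- At this level no cancellation is needed: `2δ = 1` restores the order lost in `m - 1`, so both
    -- parts are estimated separately.
    have e2 : m - 1 - α.length + 2 * (1 / 2) = m - α.length := by ring
    have hbr := bracket_pos ξ
    rw [e', e', sub_sub_sub_comm, e2, add_mul, add_mul]
    refine (norm_sub_le _ _).trans (add_le_add ((hub α ξ).lip_deriv i x y) ?_)
    have h3 := norm_sub_le_of_pderiv_le (f := fun x => dxi α (dx [i] (sharp φ ψ u)) x ξ)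
      (B := (∑ i, ∑ j, C i j) * bracket ξ ^ (m - α.length))
      (differentiable_of_smooth (contDiff_dxi_slice (contDiff_dx hb.1 [i]) α ξ)) (by positivity)
      (fun j z => ?_) x y
    · refine h3.trans (le_of_eq (by ring))
    · have e3 : pderiv j (fun x => dxi α (dx [i] (sharp φ ψ u)) x ξ) z =
          dxi α (dx [j, i] (sharp φ ψ u)) z ξ := by
        rw [← pderivs_dxi hb.1]
        simp_rw [← pderivs_dxi hb.1]
        rfl
      rw [e3]
      refine (h j i z ξ).trans ?_
      have e4 : m - α.length + max ((([j, i] : List (Fin n)).length : ℝ) / 2 - 1) 0 = m - α.length := by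
        simp
      rw [e4]
      gcongr
      exact hle j i

/-- Smoothing changes a symbol of order 1 by a bounded amount only, which is smaller than `c|ξ|/2`
for large `ξ`. -/
lemma isElliptic_sharp {a : Rn n → Rn n → ℝ} (hφ : IsCutoff φ) (hψ : IsLittlewoodPaley ψ)
    (ha : Rough 1 fun x ξ => (a x ξ : ℂ)) {c : ℝ} (hc : 0 < c) (h : ∀ x ξ, c * bracket ξ ≤ a x ξ) :
    IsElliptic 1 (sharp φ ψ fun x ξ => (a x ξ : ℂ)) := by
  obtain ⟨C, hC, hb⟩ := norm_sharp_sub_le hφ hψ ha [] []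
  refine ⟨c / 2, 1 + 2 * C / c, by positivity, by positivity, fun x ξ hξ => ?_⟩
  have h1 := hb x ξ
  simp only [List.length_nil, Nat.cast_zero, zero_div, sub_zero, zero_sub, add_neg_cancel,
    Real.rpow_zero, mul_one] at h1
  have h2 : ‖sharp φ ψ (fun x ξ => (a x ξ : ℂ)) x ξ - (a x ξ : ℂ)‖ ≤ C := h1
  have h3 := norm_sub_norm_le (a x ξ : ℂ) (sharp φ ψ (fun x ξ => (a x ξ : ℂ)) x ξ)
  rw [norm_sub_rev] at h3
  have h4 : a x ξ ≤ ‖(a x ξ : ℂ)‖ := by rw [Complex.norm_real]; exact le_abs_self _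
  have h5 := h x ξ
  have h6 := norm_le_bracket ξ
  have h7 : c / 2 * (1 + 2 * C / c) ≤ c / 2 * ‖ξ‖ := by gcongr
  have h8 : c / 2 * (1 + 2 * C / c) = c / 2 + C := by field_simp
  rw [Real.rpow_one]
  nlinarith

end SharpSymbol

/-! ### Asymptotic homogeneity of smoothed symbols. -/

section AsymptoticHomogeneity

lemma rough_zero (m : ℝ) : Rough m fun _ _ : Rn n => (0 : ℂ) := by
  refine rough_of_xi contDiff_const fun α => ⟨0, le_rfl, fun ξ => ?_⟩
  rw [pderivs_eq_wderiv_bv, wderiv_zero]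
  simp

lemma Rough.sum {m : ℝ} {J : Type*} (s : Finset J) {u : J → Rn n → Rn n → ℂ}
    (hu : ∀ j ∈ s, Rough m (u j)) : Rough m fun x ξ => ∑ j ∈ s, u j x ξ := by
  classical
  induction s using Finset.induction_on with
  | empty => simpa using rough_zero m
  | insert j s hj ih =>
    simp only [Finset.sum_insert hj]
    exact (hu j (by simp)).add (ih fun i hi => hu i (by simp [hi]))

lemma rough_const (c : ℂ) : Rough 0 fun _ _ : Rn n => c := by
  refine rough_of_xi contDiff_const fun α => ⟨‖c‖, norm_nonneg c, fun ξ => ?_⟩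
  rcases eq_or_ne α [] with rfl | h
  · simp [pderivs]
  · rw [pderivs_eq_wderiv_bv, wderiv_const bv h]
    have := bracket_pos ξ
    simp; positivity

lemma Rough.sub {m : ℝ} {u v : Rn n → Rn n → ℂ} (hu : Rough m u) (hv : Rough m v) :
    Rough m fun x ξ => u x ξ - v x ξ := by
  have h := (rough_const (-1)).mul hv
  rw [zero_add] at h
  simpa [sub_eq_add_neg] using hu.add h

/-- The radial derivative `ξ · ∂_ξ u`. -/
def radial (u : Rn n → Rn n → ℂ) (x ξ : Rn n) : ℂ := ∑ l, ((ξ l : ℝ) : ℂ) * dxi [l] u x ξ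

lemma fderiv_eq_radial (u : Rn n → Rn n → ℂ) (x ξ : Rn n) :
    fderiv ℝ (u x) ξ ξ = radial u x ξ := fderiv_eq_sum_pderiv (u x) ξ ξ

lemma Rough.radial {m : ℝ} {u : Rn n → Rn n → ℂ} (hu : Rough m u) : Rough m (PsiDO.radial u) := by
  refine Rough.sum _ fun l _ => ?_
  have h := (rough_coord l).mul (hu.dxi [l])
  convert h using 1
  simp

/-- The Euler identity. -/
lemma IsHomogeneous.radial_eq {m : ℝ} {u : Rn n → Rn n → ℂ} (hu : IsHomogeneous m u)
    {x ξ : Rn n} (hd : DifferentiableAt ℝ (u x) ξ) (hξ : 1 ≤ ‖ξ‖) : radial u x ξ = m * u x ξ := by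
  rw [← fderiv_eq_radial]
  have h1 : HasDerivAt (fun t : ℝ => t • ξ) ((1 : ℝ) • ξ) 1 := (hasDerivAt_id' 1).smul_const ξ
  have hd' : HasFDerivAt (u x) (fderiv ℝ (u x) ξ) ((1 : ℝ) • ξ) := by
    rw [one_smul]; exact hd.hasFDerivAt
  have h2 : HasDerivAt (fun t : ℝ => u x (t • ξ)) (fderiv ℝ (u x) ξ ((1 : ℝ) • ξ)) 1 :=
    HasFDerivAt.comp_hasDerivAt 1 hd' h1
  have h3 : HasDerivAt (fun t : ℝ => ((t ^ m : ℝ) : ℂ) * u x ξ) (((m * 1 ^ (m - 1) : ℝ) : ℂ) * u x ξ) 1 :=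
    (HasDerivAt.ofReal_comp (Real.hasDerivAt_rpow_const (Or.inl one_ne_zero))).mul_const _
  -- Homogeneity is only available for `t ≥ 1`, so the derivative at `t = 1` is compared from the
  -- right.
  have h4 : HasDerivWithinAt (fun t : ℝ => u x (t • ξ)) (((m * 1 ^ (m - 1) : ℝ) : ℂ) * u x ξ)
      (Set.Ici 1) 1 :=
    h3.hasDerivWithinAt.congr (fun t ht => hu x ξ t ht hξ) (hu x ξ 1 le_rfl hξ)
  have h5 := (uniqueDiffWithinAt_Ici (1 : ℝ)).eq_deriv _ h2.hasDerivWithinAt h4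
  simpa using h5

variable {φ : Rn n → ℂ} {χ : ℕ → Rn n → ℂ} {m : ℝ} {u : Rn n → Rn n → ℂ}

lemma dyadic_of_wbdd (hs : ∀ k, ContDiff ℝ ∞ (χ k)) (h0 : ∀ k ξ, ξ ∉ Shell k → χ k ξ = 0)
    (hb : WBdd bv (fun _ => -1) (fun k => Shell k) (fun k _ => lam k) (fun _ _ => 1) 0 0 χ) :
    Dyadic χ := by
  refine ⟨hs, h0, fun α => ?_⟩
  obtain ⟨C, hC, h⟩ := hb.univ (fun k _ => lam_pos k) (fun _ _ => le_rfl)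
    (fun k => isClosed_shell k) h0 α
  refine ⟨C, hC, fun k ξ => ?_⟩
  have := h k ξ trivial
  rw [pderivs_eq_wderiv_bv]
  simpa [wordWt_const] using this

lemma Dyadic.sum {J : Type*} (s : Finset J) {χ : J → ℕ → Rn n → ℂ} (h : ∀ j ∈ s, Dyadic (χ j)) :
    Dyadic fun k ξ => ∑ j ∈ s, χ j k ξ := by
  refine ⟨fun k => ContDiff.sum fun j hj => (h j hj).smooth k,
    fun k ξ hξ => Finset.sum_eq_zero fun j hj => (h j hj).supp k ξ hξ, fun α => ?_⟩
  choose! C hC hb using fun j hj => (h j hj).bdd α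
  refine ⟨∑ j ∈ s, C j, Finset.sum_nonneg hC, fun k ξ => ?_⟩
  rw [pderivs_eq_wderiv_bv, wderiv_sum s fun j hj => (h j hj).smooth k, Finset.sum_mul]
  exact (norm_sum_le _ _).trans (Finset.sum_le_sum fun j hj => hb j hj k ξ)

/-- The family `ξ · ∂_ξ χ_k`. -/
def radialFam (χ : ℕ → Rn n → ℂ) (k : ℕ) (ξ : Rn n) : ℂ :=
  ∑ l, ((ξ l : ℝ) : ℂ) * pderivs [l] (χ k) ξ

lemma Dyadic.radial (hχ : Dyadic χ) : Dyadic (radialFam χ) := by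
  refine Dyadic.sum _ fun l _ => dyadic_of_wbdd (fun k => (contDiff_coord l).mul
    (contDiff_wderiv (hχ.smooth k) [l])) (fun k ξ hξ => ?_) ?_
  · rw [hχ.pderivs_eq_zero [l] hξ, mul_zero]
  · have h1 := (hχ.wbdd (fun k : ℕ => k)).wderiv [l]
    have h2 : WBdd bv (fun _ => -1) (fun k => Shell k) (fun k _ => lam k) (fun _ _ => 1) 1 0
        (fun (_ : ℕ) (ξ : Rn n) => ((ξ l : ℝ) : ℂ)) := by
      intro w
      obtain ⟨C, hC, h⟩ := (rough_coord l).wbdd w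
      exact ⟨C, hC, fun k ξ hξ => h (k, 0) ξ hξ⟩
    have h3 := WBdd.mul (M := 0) (M' := 0) (fun k _ => lam_pos k) (fun _ _ => le_rfl)
      (fun _ => contDiff_coord l) (fun k => contDiff_wderiv (hχ.smooth k) [l]) h2 h1
    simp_rw [pderivs_eq_wderiv_bv]
    simpa [wordWt_const] using h3

/-- The radial derivative of the constant function `∑ χ_k`, taken termwise. -/
lemma Dyadic.tsum_radial (hχ : Dyadic χ) {c : ℂ} (hc : ∀ ξ, ∑' k, χ k ξ = c) (ξ : Rn n) :
    ∑' k, radialFam χ k ξ = 0 := by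
  rw [tsum_eq_sum_scales fun k hk => hχ.radial.supp k ξ hk]
  simp only [radialFam]
  rw [Finset.sum_comm]
  refine Finset.sum_eq_zero fun l _ => ?_
  rw [← Finset.mul_sum, ← tsum_eq_sum_scales fun k hk => hχ.pderivs_eq_zero [l] hk]
  have h := wderiv_tsum_shell (π := id) (F := χ) continuous_id hχ.supp hχ.smooth bv [l] ξ
  simp_rw [hc] at h
  rw [wderiv_const bv (by simp)] at h
  rw [show (∑' k, pderivs [l] (χ k) ξ) = _ from h.symm, mul_zero]

lemma integrable_multiplier {g f : Rn n → ℂ} (hg : Integrable (invHat g)) (hf : Continuous f) {B : ℝ}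
    (hB : ∀ y, ‖f y‖ ≤ B) (x : Rn n) : Integrable fun y => invHat g (x - y) * f y := by
  have h := hg.comp_sub_left x
  exact h.mul_bdd (c := B) hf.aestronglyMeasurable (Filter.Eventually.of_forall hB)

lemma UnitBump.integrable_invHat (hφ : UnitBump φ) (k : ℕ) :
    Integrable (invHat fun η => φ ((hlf k)⁻¹ • η)) :=
  PsiDO.integrable_invHat (hφ.smooth_scaled _) (hφ.supp_scaled k)

/-- The radial derivative of a smoothed symbol. -/
lemma radial_opS_smAmp (hφ : UnitBump φ) (hχ : Dyadic χ) (hu : Rough m u) (x ξ : Rn n) :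
    radial (opS (smAmp φ χ u)) x ξ =
      opS (smAmp φ (radialFam χ) u) x ξ + opS (smAmp φ χ (radial u)) x ξ := by
  have e0 : ∀ k (f : Rn n → ℂ), fourierMultiplier (fun η => etaPow [] η * φ ((hlf k)⁻¹ • η)) f x =
      fourierMultiplier (fun η => φ ((hlf k)⁻¹ • η)) f x := fun k f => by simp
  have e1 : ∀ l, dxi [l] (opS (smAmp φ χ u)) x ξ = ∑' k, fourierMultiplier
      (fun η => φ ((hlf k)⁻¹ • η)) (fun y => dxi [l] (fun y ξ => χ k ξ * u y ξ) y ξ) x := fun l => by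
    have := dxi_dx_opS_smAmp hφ hχ hu [l] [] x ξ
    simp_rw [e0] at this
    exact this
  have hz : ∀ l k, ξ ∉ Shell k → fourierMultiplier
      (fun η => φ ((hlf k)⁻¹ • η)) (fun y => dxi [l] (fun y ξ => χ k ξ * u y ξ) y ξ) x = 0 :=
    fun l k hk => by simp [hχ.dxi_mul_eq_zero [l] hk, fourierMultiplier]
  rw [radial]
  simp_rw [e1, fun l => tsum_eq_sum_scales (hz l), Finset.mul_sum]
  rw [Finset.sum_comm, opS, opS, tsum_eq_sum_scales (ξ := ξ)
    fun k hk => (isAmp_smAmp hφ hχ.radial hu).opT_eq_zero hk, tsum_eq_sum_scales (ξ := ξ)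
    fun k hk => (isAmp_smAmp hφ hχ hu.radial).opT_eq_zero hk, ← Finset.sum_add_distrib]
  refine Finset.sum_congr rfl fun k hk => ?_
  rw [smAmp, smAmp, opT_sepAmp, opT_sepAmp]
  have hg := hφ.integrable_invHat k
  have hξ := mem_scales.1 hk
  obtain ⟨B1, hB1, hb1⟩ := hχ.radial.c11_mul hu []
  obtain ⟨B2, hB2, hb2⟩ := hχ.c11_mul hu.radial []
  choose B hB hb using fun l : Fin n => hχ.c11_mul hu [l]
  have i1 := integrable_multiplier hg (hb1 k ξ hξ).differentiable.continuous (hb1 k ξ hξ).sup x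
  have i2 := integrable_multiplier hg (hb2 k ξ hξ).differentiable.continuous (hb2 k ξ hξ).sup x
  have i3 := fun l => integrable_multiplier hg (hb l k ξ hξ).differentiable.continuous (hb l k ξ hξ).sup x
  simp only [fourierMultiplier]
  refine Eq.trans ?_ (integral_add i1 i2)
  simp_rw [← integral_const_mul]
  rw [← integral_finsetSum _ fun l _ => (i3 l).const_mul _]
  congr 1 with y
  have e2 : ∀ l, dxi [l] (fun y ξ => χ k ξ * u y ξ) y ξ =
      pderivs [l] (χ k) ξ * u y ξ + χ k ξ * dxi [l] u y ξ := fun l => by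
    rw [dxi_mul_left (hχ.smooth k) hu.smooth]
    simp [splits, dxi, pderivs]
  simp_rw [e2]
  simp only [dxi, pderivs, radialFam, radial]
  rw [Finset.sum_mul, Finset.mul_sum, Finset.mul_sum, Finset.mul_sum, ← Finset.sum_add_distrib]
  refine Finset.sum_congr rfl fun l _ => ?_
  ring

lemma opS_smAmp_sub (hφ : UnitBump φ) (hχ : Dyadic χ) {v : Rn n → Rn n → ℂ} (hu : Rough m u)
    (hv : Rough m v) (x ξ : Rn n) :
    opS (smAmp φ χ fun x ξ => u x ξ - v x ξ) x ξ =
      opS (smAmp φ χ u) x ξ - opS (smAmp φ χ v) x ξ := by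
  rw [opS, opS, opS, tsum_eq_sum_scales (ξ := ξ)
    fun k hk => (isAmp_smAmp hφ hχ (hu.sub hv)).opT_eq_zero hk, tsum_eq_sum_scales (ξ := ξ)
    fun k hk => (isAmp_smAmp hφ hχ hu).opT_eq_zero hk, tsum_eq_sum_scales (ξ := ξ)
    fun k hk => (isAmp_smAmp hφ hχ hv).opT_eq_zero hk, ← Finset.sum_sub_distrib]
  refine Finset.sum_congr rfl fun k hk => ?_
  have hξ := mem_scales.1 hk
  have hg := hφ.integrable_invHat k
  obtain ⟨B1, hB1, hb1⟩ := hχ.c11_mul hu []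
  obtain ⟨B2, hB2, hb2⟩ := hχ.c11_mul hv []
  have i1 := integrable_multiplier hg (hb1 k ξ hξ).differentiable.continuous (hb1 k ξ hξ).sup x
  have i2 := integrable_multiplier hg (hb2 k ξ hξ).differentiable.continuous (hb2 k ξ hξ).sup x
  rw [smAmp, smAmp, smAmp, opT_sepAmp, opT_sepAmp, opT_sepAmp]
  simp only [fourierMultiplier]
  refine Eq.trans ?_ (integral_sub i1 i2)
  congr 1 with y
  change _ * (χ k ξ * (u y ξ - v y ξ)) = _ * (χ k ξ * u y ξ) - _ * (χ k ξ * v y ξ)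
  rw [← mul_sub, ← mul_sub]

/-- The smoothing of a homogeneous symbol is asymptotically homogeneous. -/
theorem isAsympHomogeneous_sharp {φ : Rn n → ℝ} {ψ : ℕ → Rn n → ℝ} (hφ : IsCutoff φ)
    (hψ : IsLittlewoodPaley ψ) (hu : Rough m u) (hh : IsHomogeneous m u) :
    IsAsympHomogeneous 2 m (1 / 2) (sharp φ ψ u) u := by
  refine ⟨isSymbol_sharp hφ hψ hu, hu.isRoughSymbol, hh, ?_, isRoughSymbol_sub_sharp hφ hψ hu⟩
  have hm : Rough m fun x ξ => (m : ℂ) * u x ξ := by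
    have h := (rough_const (m : ℂ)).mul hu
    rwa [zero_add] at h
  -- By Euler's identity this symbol vanishes for `|ξ| > 1`, so it may be given the order `m - 1`.
  have hw := (hu.radial.sub hm).of_supp (fun x ξ hξ => by
    rw [hh.radial_eq (differentiable_of_smooth (hu.smooth x) ξ) hξ.le, sub_self]) (m - 1)
  have e : (fun x ξ => fderiv ℝ (sharp φ ψ u x) ξ ξ - (m : ℂ) * sharp φ ψ u x ξ) = fun x ξ =>
      opS (smAmp (fun η => (φ η : ℂ)) (radialFam fun k ξ => (ψ k ξ : ℂ)) u) x ξ +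
      opS (smAmp (fun η => (φ η : ℂ)) (fun k ξ => (ψ k ξ : ℂ))
        fun x ξ => radial u x ξ - (m : ℂ) * u x ξ) x ξ := by
    funext x ξ
    rw [fderiv_eq_radial, sharp_eq_opS, radial_opS_smAmp hφ.unitBump hψ.dyadic hu,
      opS_smAmp_sub hφ.unitBump hψ.dyadic hu.radial hm, add_sub_assoc]
    congr 2
    rw [opS, opS, ← tsum_mul_left]
    congr 1 with k
    rw [smAmp, smAmp, opT_sepAmp, opT_sepAmp, fourierMultiplier, fourierMultiplier,
      ← integral_const_mul]
    congr 1 with y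
    ring
  rw [e]
  refine IsSymbol.add ?_ (isAmp_smAmp hφ.unitBump hψ.dyadic hw).isSymbol_opS
  refine ⟨(isAmp_smAmp hφ.unitBump hψ.dyadic.radial hu).isSymbol_opS.1, fun α β => ?_⟩
  -- The radial derivatives of the cut-offs sum to `c = 0`; no main term is left, and the error
  -- estimate alone gives order `m - 1`.
  obtain ⟨C, hC, h⟩ := norm_opS_smAmp_sub_le hφ.unitBump hφ.near_zero' hψ.dyadic.radial
    (hψ.dyadic.tsum_radial hψ.tsum_eq_one) hu α β
  refine ⟨C, hC, fun x ξ => ?_⟩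
  have := h x ξ
  rw [zero_mul, sub_zero] at this
  refine this.trans (le_of_eq ?_)
  congr 2
  ring

end AsymptoticHomogeneity

/-! ### Products and linear operations for amplitudes. -/

section AmplitudeProducts

/-- The region in which the amplitudes at scale `k` live. -/
def ampSet (k : ℕ) : Set (R3 n) := {p | p.2.1 ∈ Shell k ∧ ‖p.2.2‖ ≤ hlf k}

lemma isClosed_ampSet (k : ℕ) : IsClosed (ampSet k : Set (R3 n)) :=
  ((isClosed_shell k).preimage prXi.continuous).inter
    (isClosed_le prEta.continuous.norm continuous_const)

/-- Bounds for the factors of amplitudes. -/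
def AmpBdd (m : ℝ) (M : ℕ) (G : ℕ → Rn n → R3 n → ℂ) : Prop :=
  WBdd (P := ℕ × Rn n) dir3 wt3 (fun q => ampSet q.1) (fun q _ => lam q.1)
    (fun q p => 1 + hlf q.1 * ‖p.1 - q.2‖) m M (fun q => G q.1 q.2)

/-- The additional factor needs bounds only where `ξ ∈ Shell k` and `‖η‖ ≤ h_k`, since `F` vanishes
elsewhere. -/
lemma IsAmp.mul {m m' : ℝ} {M M' : ℕ} {F G : ℕ → Rn n → R3 n → ℂ} (hF : IsAmp m M F)
    (hG : ∀ k, JCont dir3 (G k)) (hb : AmpBdd m' M' G) :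
    IsAmp (m + m') (M + M') fun k y p => F k y p * G k y p := by
  have hj : ∀ k, JCont dir3 fun y p => F k y p * G k y p := fun k =>
    JCont.mul ⟨hF.smooth k, hF.cont k⟩ (hG k)
  refine ⟨fun k => (hj k).1, fun k => (hj k).2, fun k y p hp => ?_, fun k y p hp => ?_, ?_⟩
  · rw [hF.supp_eta k y p hp, zero_mul]
  · rw [hF.supp_xi k y p hp, zero_mul]
  · have h1 := WBdd.mul (fun (q : ℕ × Rn n) _ => lam_pos q.1) one_le_q (fun q => hF.smooth q.1 q.2)
      (fun q => (hG q.1).1 q.2) (hF.bdd.mono_set fun q => Set.subset_univ (ampSet q.1)) hb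
    refine h1.univ (fun q _ => lam_pos q.1) one_le_q (fun q => isClosed_ampSet q.1) fun q p hp => ?_
    by_cases h : p.2.1 ∈ Shell q.1
    · rw [hF.supp_eta q.1 q.2 p (not_le.1 fun h' => hp ⟨h, h'⟩), zero_mul]
    · rw [hF.supp_xi q.1 q.2 p h, zero_mul]

lemma IsAmp1.integrable_slice {R : ℝ} {M : ℕ} {F : Rn n → R3 n → ℂ} (hF : IsAmp1 R M F)
    (x ξ y : Rn n) : Integrable fun η => osc (x - y) η * F y (x, ξ, η) :=
  integrable_of_continuous_of_zero_off_ball (hF.continuous_slice (x, ξ) y)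
    fun η hη => by rw [hF.supp y (x, ξ, η) hη, mul_zero]

lemma opT_sub {R : ℝ} {M M' : ℕ} {F G : Rn n → R3 n → ℂ} (hR : 1 ≤ R) (hF : IsAmp1 R M F)
    (hG : IsAmp1 R M' G) (x ξ : Rn n) :
    opT (fun y p => F y p - G y p) x ξ = opT F x ξ - opT G x ξ := by
  rw [opT, opT, opT, ← mul_sub, ← integral_sub (hF.integrable_kerJ hR x ξ) (hG.integrable_kerJ hR x ξ)]
  congr 2 with y
  simp only [kerJ, mul_sub]
  exact integral_sub (hF.integrable_slice x ξ y) (hG.integrable_slice x ξ y)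

lemma opT_mul_left (F : Rn n → R3 n → ℂ) (g : Rn n → Rn n → ℂ) (x ξ : Rn n) :
    opT (fun y p => g p.1 p.2.1 * F y p) x ξ = g x ξ * opT F x ξ := by
  rw [opT, opT, mul_left_comm, ← integral_const_mul (g x ξ)]
  congr 2 with y
  simp only [kerJ]
  rw [← integral_const_mul]
  congr 1 with η
  ring

/-- Amplitudes that do not depend on `y`. -/
lemma opT_of_const {G : R3 n → ℂ} {x ξ : Rn n} (hG : ContDiff ℝ ∞ fun η => G (x, ξ, η)) {R : ℝ}
    (h0 : ∀ η, R < ‖η‖ → G (x, ξ, η) = 0) : opT (fun _ => G) x ξ = G (x, ξ, 0) := by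
  rw [opT, ← integral_const_mul, ← integral_invHat hG h0,
    ← integral_sub_left_eq_self (invHat fun η => G (x, ξ, η)) volume x]
  rfl

end AmplitudeProducts

/-! ### Shifted symbols as factors of amplitudes. -/

section SymbolFactors

/-- The map `(x, ξ, η) ↦ (x, ξ + τ η)`. -/
def shiftMap (τ : ℝ) : R3 n →L[ℝ] Rn n × Rn n :=
  (ContinuousLinearMap.fst ℝ (Rn n) (Rn n × Rn n)).prod (prXi + τ • prEta)

lemma shiftMap_apply (τ : ℝ) (p : R3 n) : shiftMap τ p = (p.1, p.2.1 + τ • p.2.2) := rfl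

/-- The letter of `dir2` that corresponds to a letter of `dir3`. -/
def letter2 : Fin n ⊕ Fin n ⊕ Fin n → Fin n ⊕ Fin n := Sum.elim .inl (Sum.elim .inr .inr)

/-- The factor of a letter of `dir3` under `shiftMap τ`. -/
def shiftWt (τ : ℝ) : Fin n ⊕ Fin n ⊕ Fin n → ℝ := Sum.elim 1 (Sum.elim 1 fun _ => τ)

lemma shiftMap_dir3 (τ : ℝ) (i : Fin n ⊕ Fin n ⊕ Fin n) :
    shiftMap τ (dir3 i) = shiftWt τ i • dir2 (letter2 i) := by
  rcases i with i | i | i <;> simp [shiftMap_apply, dir3, dir2, shiftWt, letter2]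

lemma abs_prod_shiftWt_le {τ : ℝ} (hτ : |τ| ≤ 1) (w : List (Fin n ⊕ Fin n ⊕ Fin n)) :
    |(w.map (shiftWt τ)).prod| ≤ 1 := by
  induction w with
  | nil => simp
  | cons i w ih =>
    rw [List.map_cons, List.prod_cons, abs_mul]
    refine mul_le_one₀ ?_ (abs_nonneg _) ih
    rcases i with i | i | i <;> simp [shiftWt, hτ]

/-- Sorting the letters of a word; `e` is the number of letters for `η`. -/
lemma exists_sorted_word (w : List (Fin n ⊕ Fin n ⊕ Fin n)) : ∃ (α β : List (Fin n)) (e : ℕ),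
    (w.map letter2).Perm (α.map Sum.inr ++ β.map Sum.inl) ∧
    wordWt wt3 w = (β.length : ℝ) / 2 - α.length + (e : ℝ) / 2 ∧
    (β = [] → e = 0 → w = α.map fun i => .inr (.inl i)) := by
  induction w with
  | nil => exact ⟨[], [], 0, by simp⟩
  | cons i w ih =>
    obtain ⟨α, β, e, h1, h2, h3⟩ := ih
    rcases i with i | i | i
    · refine ⟨α, i :: β, e, ?_, ?_, by simp⟩
      · exact (h1.cons _).trans List.perm_middle.symm
      · rw [wordWt_cons, h2, List.length_cons, wt3]; push_cast; ring
    · refine ⟨i :: α, β, e, h1.cons _, ?_, fun hβ he => by rw [h3 hβ he]; rfl⟩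
      rw [wordWt_cons, h2, List.length_cons, wt3]; push_cast; ring
    · refine ⟨i :: α, β, e + 1, h1.cons _, ?_, by simp⟩
      rw [wordWt_cons, h2, List.length_cons, wt3]; push_cast; ring

lemma prod_isXi_eq_zero (w : List (Fin n ⊕ Fin n ⊕ Fin n)) :
    (w.map isXi).prod = 0 ∨ ∃ α : List (Fin n), w = α.map fun i => .inr (.inl i) := by
  induction w with
  | nil => exact Or.inr ⟨[], rfl⟩
  | cons i w ih =>
    rcases i with i | i | i
    · simp [isXi]
    · rcases ih with h | ⟨α, h⟩
      · simp [h]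
      · exact Or.inr ⟨i :: α, by rw [h]; rfl⟩
    · simp [isXi]

variable {b : Rn n → Rn n → ℂ}

lemma wderiv_shift (hb : ContDiff ℝ ∞ (Function.uncurry b)) (τ : ℝ)
    (w : List (Fin n ⊕ Fin n ⊕ Fin n)) (p : R3 n) :
    wderiv dir3 w (fun p : R3 n => b p.1 (p.2.1 + τ • p.2.2)) p =
      (((w.map (shiftWt τ)).prod : ℝ) : ℂ) *
        wderiv dir2 (w.map letter2) (Function.uncurry b) (p.1, p.2.1 + τ • p.2.2) := by
  have h := wderiv_comp_linear (v := dir3) hb (shiftMap τ) w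
  rw [funext (shiftMap_dir3 τ), wderiv_smul_dir hb] at h
  exact congrFun h p

lemma contDiff_shift (hb : ContDiff ℝ ∞ (Function.uncurry b)) (τ : ℝ) :
    ContDiff ℝ ∞ fun p : R3 n => b p.1 (p.2.1 + τ • p.2.2) :=
  hb.comp (shiftMap τ).contDiff

lemma norm_smul_le_hlf {τ : ℝ} (hτ : |τ| ≤ 1) {k : ℕ} {η : Rn n} (h : ‖η‖ ≤ hlf k) :
    ‖τ • η‖ ≤ hlf k := by
  rw [norm_smul, Real.norm_eq_abs]
  exact (mul_le_of_le_one_left (norm_nonneg _) hτ).trans h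

/-- Bounds for a derivative of `b(x, ξ + τη)` at the scale `k`. -/
lemma norm_wderiv_shift_le (hb : ContDiff ℝ ∞ (Function.uncurry b)) {τ : ℝ} (hτ : |τ| ≤ 1)
    {w : List (Fin n ⊕ Fin n ⊕ Fin n)} {α β : List (Fin n)}
    (hw : (w.map letter2).Perm (α.map Sum.inr ++ β.map Sum.inl)) {C t t' : ℝ} (hC : 0 ≤ C)
    (h : ∀ x ξ, ‖dxi α (dx β b) x ξ‖ ≤ C * bracket ξ ^ t) (ht : t ≤ t') {k : ℕ} {p : R3 n}
    (hp : p ∈ ampSet k) :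
    ‖wderiv dir3 w (fun p : R3 n => b p.1 (p.2.1 + τ • p.2.2)) p‖ ≤ C * 64 ^ |t| * lam k ^ t' := by
  rw [wderiv_shift hb, norm_mul, Complex.norm_real, Real.norm_eq_abs, wderiv_perm hb hw,
    ← dxi_dx_eq_wderiv hb]
  have h1 := bracket_add_rpow_le_of_mem_shell hp.1 (norm_smul_le_hlf hτ hp.2) t
  have hl := one_le_lam k
  calc _ ≤ 1 * (C * bracket (p.2.1 + τ • p.2.2) ^ t) :=
        mul_le_mul (abs_prod_shiftWt_le hτ w) (h _ _) (norm_nonneg _) zero_le_one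
    _ ≤ C * (64 ^ |t| * lam k ^ t) := by rw [one_mul]; gcongr
    _ ≤ _ := by rw [mul_assoc]; gcongr

/-- Since `|τη| ≤ h_k`, the bracket at `ξ + τη` is still comparable to `λ_k`. A derivative in `η`
acts as one in `ξ` and gains 1 where only 1/2 is asked for; the surplus is `e/2`. -/
lemma IsSymbol.ampBdd_shift {m : ℝ} (hb : IsSymbol m (1 / 2) b) {τ : ℝ} (hτ : |τ| ≤ 1) :
    AmpBdd m 0 fun (_ : ℕ) (_ : Rn n) (p : R3 n) => b p.1 (p.2.1 + τ • p.2.2) := by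
  intro w
  obtain ⟨α, β, e, h1, h2, -⟩ := exists_sorted_word w
  obtain ⟨C, hC, h⟩ := hb.2 α β
  refine ⟨C * 64 ^ |m - α.length + β.length * (1 / 2)|, by positivity, fun q p hp => ?_⟩
  rw [pow_zero, mul_one]
  refine norm_wderiv_shift_le hb.1 hτ h1 hC h ?_ hp
  rw [h2]
  have : (0 : ℝ) ≤ e := Nat.cast_nonneg e
  linarith

lemma jcont_shift (hb : ContDiff ℝ ∞ (Function.uncurry b)) (τ : ℝ) (k : ℕ) :
    JCont dir3 ((fun (_ : ℕ) (_ : Rn n) (p : R3 n) => b p.1 (p.2.1 + τ • p.2.2)) k) :=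
  JCont.const (contDiff_shift hb τ)

lemma JCont.sub {E ι Y : Type*} [NormedAddCommGroup E] [NormedSpace ℝ E] [TopologicalSpace Y]
    {v : ι → E} {F G : Y → E → ℂ} (hF : JCont v F) (hG : JCont v G) :
    JCont v fun y x => F y x - G y x := by
  refine ⟨fun y => (hF.1 y).sub (hG.1 y), fun w => ?_⟩
  simp_rw [fun q : Y × E => congrFun (wderiv_sub (v := v) (hF.1 q.1) (hG.1 q.1) w) q.2]
  exact (hF.2 w).sub (hG.2 w)

end SymbolFactors

/-! ### The difference factors of order 1/2. -/

section Difference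

variable {φ : Rn n → ℝ} {ψ : ℕ → Rn n → ℝ} {a : Rn n → Rn n → ℂ}

/-- The factor `a(y, ξ) - b(x, ξ + τη)` with the smoothing `b` of `a`. -/
def diffAmp (φ : Rn n → ℝ) (ψ : ℕ → Rn n → ℝ) (a : Rn n → Rn n → ℂ) (τ : ℝ) (_ : ℕ) (y : Rn n)
    (p : R3 n) : ℂ := a y p.2.1 - sharp φ ψ a p.1 (p.2.1 + τ • p.2.2)

lemma jcont_diffAmp (hφ : IsCutoff φ) (hψ : IsLittlewoodPaley ψ) (ha : Rough 1 a) (τ : ℝ) (k : ℕ) :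
    JCont dir3 (diffAmp φ ψ a τ k) :=
  ha.jcont.pull_xi.sub (jcont_shift (isSymbol_sharp hφ hψ ha).1 τ k)

lemma wderiv_pull_xi {f : Rn n → ℂ} (hf : ContDiff ℝ ∞ f) (w : List (Fin n ⊕ Fin n ⊕ Fin n))
    (p : R3 n) : wderiv dir3 w (fun p : R3 n => f p.2.1) p =
      (((w.map isXi).prod : ℝ) : ℂ) * wderiv bv (w.map idx3) f p.2.1 := by
  have h := wderiv_comp_linear (v := dir3) hf prXi w
  rw [funext prXi_dir3, wderiv_smul_dir hf] at h
  exact congrFun h p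

lemma map_prod_one {ι : Type*} (α : List ι) (s : ι → ℝ) (hs : ∀ i, s i = 1) :
    (α.map s).prod = 1 := by
  induction α with
  | nil => rfl
  | cons i α ih => simp [hs, ih]

/-- For words in `ξ` alone there is cancellation between `a` and its smoothing. Any other letter
annihilates `a(y,ξ)`, and the derivative of the smoothing is small enough by itself. -/
theorem ampBdd_diffAmp (hφ : IsCutoff φ) (hψ : IsLittlewoodPaley ψ) (ha : Rough 1 a) {τ : ℝ}
    (hτ : |τ| ≤ 1) : AmpBdd (1 / 2) 1 (diffAmp φ ψ a τ) := by
  have hb := isSymbol_sharp hφ hψ ha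
  intro w
  by_cases hw : ∃ α : List (Fin n), w = α.map fun i => .inr (.inl i)
  · obtain ⟨α, rfl⟩ := hw
    obtain ⟨C1, hC1, h1⟩ := ha.lip_dxi α
    obtain ⟨C2, hC2, h2⟩ := norm_sharp_sub_le hφ hψ ha α []
    choose C3 hC3 h3 using fun l : Fin n => hb.2 (l :: α) []
    have hS : 0 ≤ ∑ l, C3 l := Finset.sum_nonneg fun l _ => hC3 l
    set s : ℝ := 1 - α.length
    set t : ℝ := -(α.length : ℝ)
    refine ⟨C1 * 4 ^ |s| + C2 * 4 ^ |t| + n * ((∑ l, C3 l) * 64 ^ |t|), by positivity,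
      fun q p hp => ?_⟩
    obtain ⟨k, y⟩ := q
    obtain ⟨x, ξ, η⟩ := p
    have hξ : ξ ∈ Shell k := hp.1
    have hη : ‖η‖ ≤ hlf k := hp.2
    have hl := lam_pos k
    have hl1 := one_le_lam k
    have hh := hlf_pos k
    have e1 : wderiv dir3 (α.map fun i => .inr (.inl i)) (diffAmp φ ψ a τ k y) (x, ξ, η) =
        dxi α a y ξ - dxi α (sharp φ ψ a) x (ξ + τ • η) := by
      have := congrFun (wderiv_sub (v := dir3) (ha.jcont.pull_xi.1 y) (contDiff_shift hb.1 τ)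
        (α.map fun i => .inr (.inl i))) (x, ξ, η)
      refine this.trans ?_
      rw [wderiv_pull_xi (ha.smooth y), wderiv_shift hb.1, List.map_map, List.map_map,
        List.map_map, List.map_map, map_prod_one α (isXi ∘ fun i => .inr (.inl i)) fun i => rfl,
        map_prod_one α (shiftWt τ ∘ fun i => .inr (.inl i)) fun i => rfl]
      simp only [Complex.ofReal_one, one_mul]
      congr 1
      · have : (α.map (idx3 ∘ fun i => .inr (.inl i)) : List (Fin n)) = α := by
          conv_rhs => rw [← List.map_id α]
          rfl
        rw [this]; rfl
      · exact (congrFun (dxi_eq_wderiv hb.1 α) (x, ξ + τ • η)).symm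
    have hwt : wordWt wt3 (α.map fun i => (.inr (.inl i) : Fin n ⊕ Fin n ⊕ Fin n)) = t := by
      simp [wordWt, Function.comp_def, wt3, t]
    change ‖wderiv dir3 _ (diffAmp φ ψ a τ k y) (x, ξ, η)‖ ≤ _ * lam k ^ _ * (1 + hlf k * ‖x - y‖) ^ 1
    rw [e1, hwt, pow_one]
    have b1 : ‖dxi α a y ξ - dxi α a x ξ‖ ≤
        C1 * 4 ^ |s| * lam k ^ (1 / 2 + t) * (hlf k * ‖x - y‖) := by
      rw [norm_sub_rev]
      refine (h1 x y ξ).trans ?_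
      have : lam k ^ s = lam k ^ (1 / 2 + t) * hlf k := by
        rw [hlf, ← Real.rpow_add hl]; congr 1; simp only [s, t]; ring
      calc _ ≤ C1 * (4 ^ |s| * lam k ^ s) * ‖x - y‖ := by
            gcongr
            exact bracket_rpow_le_of_mem_shell hξ s
        _ = _ := by rw [this]; ring
    have b2 : ‖dxi α (sharp φ ψ a) x ξ - dxi α a x ξ‖ ≤ C2 * 4 ^ |t| * lam k ^ (1 / 2 + t) := by
      refine (h2 x ξ).trans ?_
      have : (1 : ℝ) - α.length + ((([] : List (Fin n)).length : ℝ) / 2 - 1) = t := by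
        simp [t]; ring
      rw [this, mul_assoc]
      refine mul_le_mul_of_nonneg_left ((bracket_rpow_le_of_mem_shell hξ t).trans ?_) hC2
      gcongr
      linarith
    have b3 : ‖dxi α (sharp φ ψ a) x (ξ + τ • η) - dxi α (sharp φ ψ a) x ξ‖ ≤
        n * ((∑ l, C3 l) * 64 ^ |t|) * lam k ^ (1 / 2 + t) := by
      have hd : ∀ z, DifferentiableAt ℝ (dxi α (sharp φ ψ a) x) z := fun z =>
        differentiable_of_smooth (contDiff_slice_right (contDiff_dxi hb.1 α) x) z
      have hmv := Convex.norm_image_sub_le_of_norm_fderiv_le (𝕜 := ℝ)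
        (f := dxi α (sharp φ ψ a) x) (s := Metric.closedBall ξ (hlf k))
        (C := n * ((∑ l, C3 l) * (64 ^ |t| * lam k ^ t))) (x := ξ) (y := ξ + τ • η)
        (fun z _ => hd z) (fun z hz => ?_) (convex_closedBall _ _)
        (Metric.mem_closedBall_self hh.le)
        (by simpa using norm_smul_le_hlf hτ hη)
      · refine hmv.trans ?_
        rw [add_sub_cancel_left]
        calc _ ≤ n * ((∑ l, C3 l) * (64 ^ |t| * lam k ^ t)) * hlf k := by
              gcongr
              exact norm_smul_le_hlf hτ hη
          _ = n * ((∑ l, C3 l) * 64 ^ |t|) * (lam k ^ (1 / 2 : ℝ) * lam k ^ t) := by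
              rw [← show hlf k = lam k ^ (1 / 2 : ℝ) from rfl]; ring
          _ = _ := by rw [← Real.rpow_add hl]
      · refine norm_clm_le_sum _ (by positivity) fun l => ?_
        have hz' : ‖z - ξ‖ ≤ hlf k := by simpa [dist_eq_norm] using hz
        have h4 := bracket_add_rpow_le_of_mem_shell hξ hz' t
        rw [add_sub_cancel] at h4
        have h5 := h3 l x z
        have e : (1 : ℝ) - ((l :: α).length : ℝ) + (([] : List (Fin n)).length : ℝ) * (1 / 2) = t := by
          simp [t]
        rw [e] at h5
        have h6 : ‖fderiv ℝ (dxi α (sharp φ ψ a) x) z (bv l)‖ ≤ C3 l * bracket z ^ t := h5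
        refine h6.trans ?_
        gcongr
        · have := bracket_pos z; positivity
        · exact Finset.single_le_sum (f := C3) (fun i _ => hC3 i) (Finset.mem_univ l)
    -- From `y` to `x`, from `a` to its smoothing, from `ξ` to `ξ + τη`: relative to the weight of
    -- `α` the costs are `λ^{1/2}·h|x-y|`, `1` and `h = λ^{1/2}`. The first is the reason for `M =
    -- 1`.
    have hsplit : dxi α a y ξ - dxi α (sharp φ ψ a) x (ξ + τ • η) =
        (dxi α a y ξ - dxi α a x ξ) - (dxi α (sharp φ ψ a) x ξ - dxi α a x ξ) -
        (dxi α (sharp φ ψ a) x (ξ + τ • η) - dxi α (sharp φ ψ a) x ξ) := by ring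
    rw [hsplit]
    refine (norm_sub_le _ _).trans ((add_le_add ((norm_sub_le _ _).trans (add_le_add b1 b2)) b3).trans ?_)
    have hX : 0 ≤ lam k ^ (1 / 2 + t) := by positivity
    have hY : 0 ≤ hlf k * ‖x - y‖ := by positivity
    have p1 : 0 ≤ C1 * 4 ^ |s| * lam k ^ (1 / 2 + t) := by positivity
    have p2 : 0 ≤ C2 * 4 ^ |t| * lam k ^ (1 / 2 + t) * (hlf k * ‖x - y‖) := by positivity
    have p3 : 0 ≤ n * ((∑ l, C3 l) * 64 ^ |t|) * lam k ^ (1 / 2 + t) * (hlf k * ‖x - y‖) := by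
      positivity
    nlinarith
  -- At least one letter for `x` or `η` is present, so its weight 1/2 (for `x`), or its surplus gain
  -- 1/2 (for `η`), makes up for the order 1 of the symbol; the saving for `|β| ≥ 2` handles longer
  -- words in `x`.
  · obtain ⟨α, β, e, h1, h2, h3⟩ := exists_sorted_word w
    obtain ⟨C, hC, h⟩ := norm_sharp_le hφ hψ ha α β
    refine ⟨C * 64 ^ |1 - (α.length : ℝ) + max ((β.length : ℝ) / 2 - 1) 0|, by positivity, fun q p hp => ?_⟩
    have e1 : wderiv dir3 w (diffAmp φ ψ a τ q.1 q.2) p =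
        -wderiv dir3 w (fun p : R3 n => sharp φ ψ a p.1 (p.2.1 + τ • p.2.2)) p := by
      have := congrFun (wderiv_sub (v := dir3) (ha.jcont.pull_xi.1 q.2) (contDiff_shift hb.1 τ) w) p
      refine this.trans ?_
      rw [wderiv_pull_xi (ha.smooth q.2), (prod_isXi_eq_zero w).resolve_right hw]
      simp
    have hl := lam_pos q.1
    rw [e1, norm_neg]
    refine (norm_wderiv_shift_le hb.1 hτ h1 hC h (t' := 1 / 2 + wordWt wt3 w) ?_ hp).trans ?_
    · rw [h2]
      have he : (0 : ℝ) ≤ e := Nat.cast_nonneg e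
      rcases Nat.lt_or_ge β.length 1 with hβ | hβ
      · have hβ' : β = [] := List.length_eq_zero_iff.1 (by omega)
        have he1 : (1 : ℝ) ≤ e := by
          by_contra hlt
          have : e = 0 := by
            by_contra h0
            exact hlt (by exact_mod_cast Nat.one_le_iff_ne_zero.2 h0)
          exact hw ⟨α, h3 hβ' this⟩
        subst hβ'
        simp only [List.length_nil, Nat.cast_zero, zero_div, zero_sub]
        rw [max_eq_right (by norm_num)]
        linarith
      · have hβ' : (1 : ℝ) ≤ β.length := by exact_mod_cast hβ
        rcases le_total ((β.length : ℝ) / 2 - 1) 0 with hc | hc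
        · rw [max_eq_right hc]; linarith
        · rw [max_eq_left hc]; linarith
    · refine le_mul_of_one_le_right (by positivity) ?_
      rw [pow_one]
      exact one_le_q q p

end Difference

/-! ### The error amplitude and the identity behind the square. -/

section ErrorSymbol

variable {φ : Rn n → ℝ} {ψ : ℕ → Rn n → ℝ} {a : Rn n → Rn n → ℂ}

/-- The amplitudes `ψ_k(ξ) φ(η / h_k) u(y, ξ)` of the smoothing of `u`. -/
abbrev sharpAmp (φ : Rn n → ℝ) (ψ : ℕ → Rn n → ℝ) (u : Rn n → Rn n → ℂ) : ℕ → Rn n → R3 n → ℂ :=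
  smAmp (fun η => (φ η : ℂ)) (fun k ξ => (ψ k ξ : ℂ)) u

lemma isAmp_sharpAmp (hφ : IsCutoff φ) (hψ : IsLittlewoodPaley ψ) {m : ℝ} {u : Rn n → Rn n → ℂ}
    (hu : Rough m u) : IsAmp m 0 (sharpAmp φ ψ u) := isAmp_smAmp hφ.unitBump hψ.dyadic hu

/-- The amplitudes of the square of the operator with symbol `sharp φ ψ a`. -/
def sqAmp (φ : Rn n → ℝ) (ψ : ℕ → Rn n → ℝ) (a : Rn n → Rn n → ℂ) (k : ℕ) (y : Rn n) (p : R3 n) : ℂ :=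
  sharpAmp φ ψ a k y p * sharp φ ψ a p.1 (p.2.1 + (1 : ℝ) • p.2.2)

/-- The amplitudes of the error term. -/
def errAmp (φ : Rn n → ℝ) (ψ : ℕ → Rn n → ℝ) (a : Rn n → Rn n → ℂ) (k : ℕ) (y : Rn n) (p : R3 n) : ℂ :=
  sharpAmp φ ψ (fun _ _ => 1) k y p * diffAmp φ ψ a 0 k y p * diffAmp φ ψ a 1 k y p

lemma isAmp_sqAmp (hφ : IsCutoff φ) (hψ : IsLittlewoodPaley ψ) (ha : Rough 1 a) :
    IsAmp (1 + 1) (0 + 0) (sqAmp φ ψ a) :=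
  (isAmp_sharpAmp hφ hψ ha).mul (jcont_shift (isSymbol_sharp hφ hψ ha).1 1)
    ((isSymbol_sharp hφ hψ ha).ampBdd_shift (by simp))

lemma isAmp_errAmp (hφ : IsCutoff φ) (hψ : IsLittlewoodPaley ψ) (ha : Rough 1 a) :
    IsAmp (0 + 1 / 2 + 1 / 2) (0 + 1 + 1) (errAmp φ ψ a) :=
  ((isAmp_sharpAmp hφ hψ (rough_const 1)).mul (jcont_diffAmp hφ hψ ha 0)
    (ampBdd_diffAmp hφ hψ ha (by simp))).mul (jcont_diffAmp hφ hψ ha 1)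
    (ampBdd_diffAmp hφ hψ ha (by simp))

/-- A symbol independent of `x` meets the multiplier only at frequency zero, where `φ = 1`. -/
lemma sharp_of_xi (hφ : IsCutoff φ) (hψ : IsLittlewoodPaley ψ) (g : Rn n → ℂ) (x ξ : Rn n) :
    sharp φ ψ (fun _ => g) x ξ = g ξ := by
  rw [sharp_eq_opS, opS]
  have h : ∀ k, opT (sharpAmp φ ψ (fun _ => g) k) x ξ = ψ k ξ * g ξ := fun k => by
    have := opT_of_const (G := sharpAmp φ ψ (fun _ => g) k 0) (x := x) (ξ := ξ) (R := hlf k) ?_ ?_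
    · refine this.trans ?_
      simp [smAmp, sepAmp, hφ.near_zero.self_of_nhds]
    · exact (hφ.unitBump.smooth_scaled _).mul (contDiff_const (c := (ψ k ξ : ℂ) * g ξ))
    · intro η hη
      simp only [smAmp, sepAmp]
      rw [hφ.unitBump.supp_scaled k η hη, zero_mul]
  simp_rw [h]
  rw [tsum_mul_right, hψ.tsum_eq_one, one_mul]

/-- With `b` the smoothing of `a`, the product of the two differences is `a(y,ξ)² - a(y,ξ) b(x,ξ+η)
- b(x,ξ)(a(y,ξ) - b(x,ξ+η))`. The factor `b(x,ξ)` leaves the integral. -/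
lemma opT_errAmp (hφ : IsCutoff φ) (hψ : IsLittlewoodPaley ψ) (ha : Rough 1 a) (k : ℕ) (x ξ : Rn n) :
    opT (errAmp φ ψ a k) x ξ = opT (sharpAmp φ ψ (fun y ξ => a y ξ * a y ξ) k) x ξ -
      opT (sqAmp φ ψ a k) x ξ - sharp φ ψ a x ξ *
        (opT (sharpAmp φ ψ a k) x ξ - ψ k ξ * sharp φ ψ a x ξ) := by
  have hR := one_le_hlf k
  have hb := isSymbol_sharp hφ hψ ha
  have h1 := (isAmp_sharpAmp hφ hψ (ha.mul ha)).amp1 k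
  have h2 := (isAmp_sqAmp hφ hψ ha).amp1 k
  have h3 := ((isAmp_sharpAmp hφ hψ ha).mul (jcont_shift hb.1 0) (hb.ampBdd_shift (by simp))).amp1 k
  have h4 := (((isAmp_sharpAmp hφ hψ (rough_const 1)).mul (jcont_shift hb.1 1)
    (hb.ampBdd_shift (by simp))).mul (jcont_shift hb.1 0) (hb.ampBdd_shift (by simp))).amp1 k
  have hs : ∀ p : R3 n, sharp φ ψ a p.1 (p.2.1 + (0 : ℝ) • p.2.2) = sharp φ ψ a p.1 p.2.1 :=
    fun p => by rw [zero_smul, add_zero]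
  simp only [hs] at h3 h4
  have e3 := opT_mul_left (sharpAmp φ ψ a k) (sharp φ ψ a) x ξ
  have e4 := opT_mul_left (fun y p => sharpAmp φ ψ (fun _ _ => 1) k y p *
    sharp φ ψ a p.1 (p.2.1 + (1 : ℝ) • p.2.2)) (sharp φ ψ a) x ξ
  -- Without the factor `a(y,ξ)` the amplitude is independent of `y`, so Fourier inversion evaluates
  -- it at `η = 0`.
  have e5 : opT (fun y p => sharpAmp φ ψ (fun _ _ => 1) k y p *
      sharp φ ψ a p.1 (p.2.1 + (1 : ℝ) • p.2.2)) x ξ = ψ k ξ * sharp φ ψ a x ξ := by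
    have := opT_of_const (G := fun p => sharpAmp φ ψ (fun _ _ => 1) k 0 p *
      sharp φ ψ a p.1 (p.2.1 + (1 : ℝ) • p.2.2)) (x := x) (ξ := ξ) (R := hlf k) ?_ ?_
    · refine this.trans ?_
      simp [smAmp, sepAmp, hφ.near_zero.self_of_nhds]
    · refine ContDiff.mul ((hφ.unitBump.smooth_scaled _).mul (contDiff_const (c := (ψ k ξ : ℂ) * 1))) ?_
      exact (contDiff_shift hb.1 1).comp (contDiff_const.prodMk (contDiff_const.prodMk contDiff_id))
    · intro η hη
      simp only [smAmp, sepAmp]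
      rw [hφ.unitBump.supp_scaled k η hη, zero_mul, zero_mul]
  rw [mul_sub, ← e5, ← e3, ← e4]
  have e6 : errAmp φ ψ a k = fun y p =>
      (sharpAmp φ ψ (fun y ξ => a y ξ * a y ξ) k y p - sqAmp φ ψ a k y p) -
      (sharpAmp φ ψ a k y p * sharp φ ψ a p.1 p.2.1 - sharpAmp φ ψ (fun _ _ => 1) k y p *
        sharp φ ψ a p.1 (p.2.1 + (1 : ℝ) • p.2.2) * sharp φ ψ a p.1 p.2.1) := by
    funext y p
    simp only [errAmp, diffAmp, sqAmp, smAmp, sepAmp, hs]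
    ring
  have hsub : ∀ {M M' : ℕ} {F G : Rn n → R3 n → ℂ}, IsAmp1 (hlf k) M F → IsAmp1 (hlf k) M' G →
      Integrable (kerJ (fun y p => F y p - G y p) x ξ) ∧
      ∀ y, Integrable fun η => osc (x - y) η * (F y (x, ξ, η) - G y (x, ξ, η)) := by
    intro M M' F G hF hG
    have hi : ∀ y, Integrable fun η => osc (x - y) η * (F y (x, ξ, η) - G y (x, ξ, η)) := fun y => by
      simp_rw [mul_sub]
      exact (hF.integrable_slice x ξ y).sub (hG.integrable_slice x ξ y)
    refine ⟨?_, hi⟩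
    have : kerJ (fun y p => F y p - G y p) x ξ = fun y => kerJ F x ξ y - kerJ G x ξ y := by
      funext y
      simp only [kerJ, mul_sub]
      exact integral_sub (hF.integrable_slice x ξ y) (hG.integrable_slice x ξ y)
    rw [this]
    exact (hF.integrable_kerJ hR x ξ).sub (hG.integrable_kerJ hR x ξ)
  rw [e6, opT]
  have i1 := hsub h1 h2
  have i2 := hsub h3 h4
  have e7 : kerJ (fun y p =>
      (sharpAmp φ ψ (fun y ξ => a y ξ * a y ξ) k y p - sqAmp φ ψ a k y p) -
      (sharpAmp φ ψ a k y p * sharp φ ψ a p.1 p.2.1 - sharpAmp φ ψ (fun _ _ => 1) k y p *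
        sharp φ ψ a p.1 (p.2.1 + (1 : ℝ) • p.2.2) * sharp φ ψ a p.1 p.2.1)) x ξ = fun y =>
      kerJ (fun y p => sharpAmp φ ψ (fun y ξ => a y ξ * a y ξ) k y p - sqAmp φ ψ a k y p) x ξ y -
      kerJ (fun y p => sharpAmp φ ψ a k y p * sharp φ ψ a p.1 p.2.1 -
        sharpAmp φ ψ (fun _ _ => 1) k y p *
        sharp φ ψ a p.1 (p.2.1 + (1 : ℝ) • p.2.2) * sharp φ ψ a p.1 p.2.1) x ξ y := by
    funext y
    simp only [kerJ]
    rw [← integral_sub (i1.2 y) (i2.2 y)]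
    congr 1 with η
    ring
  rw [e7, integral_sub i1.1 i2.1, mul_sub]
  have e8 := opT_sub hR h1 h2 x ξ
  have e9 := opT_sub hR h3 h4 x ξ
  rw [opT] at e8 e9
  rw [e8, e9]
  simp only [mul_comm (sharp φ ψ a _ _)]

/-- The smoothing of `a² - g` and the square of the operator with symbol `sharp φ ψ a`. -/
theorem sharp_sub_eq (hφ : IsCutoff φ) (hψ : IsLittlewoodPaley ψ) (ha : Rough 1 a)
    {g : Rn n → ℂ} (hg : UnitBump g) (x ξ : Rn n) :
    sharp φ ψ (fun x ξ => a x ξ * a x ξ - g ξ) x ξ =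
      opS (sqAmp φ ψ a) x ξ + (opS (errAmp φ ψ a) x ξ - g ξ) := by
  have h1 : opS (errAmp φ ψ a) x ξ = opS (sharpAmp φ ψ fun x ξ => a x ξ * a x ξ) x ξ -
      opS (sqAmp φ ψ a) x ξ := by
    have z1 := fun k hk => (isAmp_errAmp hφ hψ ha).opT_eq_zero (k := k) (x := x) (ξ := ξ) hk
    have z2 := fun k hk => (isAmp_sharpAmp hφ hψ (ha.mul ha)).opT_eq_zero (k := k) (x := x) (ξ := ξ) hk
    have z3 := fun k hk => (isAmp_sqAmp hφ hψ ha).opT_eq_zero (k := k) (x := x) (ξ := ξ) hk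
    have z4 := fun k hk => (isAmp_sharpAmp hφ hψ ha).opT_eq_zero (k := k) (x := x) (ξ := ξ) hk
    have z5 : ∀ k, ξ ∉ Shell k → (ψ k ξ : ℂ) = 0 := fun k hk => hψ.dyadic.supp k ξ hk
    have e1 : ∑ k ∈ scales ξ, opT (sharpAmp φ ψ a k) x ξ = sharp φ ψ a x ξ := by
      rw [sharp_eq_opS, opS, tsum_eq_sum_scales z4]
    have e2 : ∑ k ∈ scales ξ, (ψ k ξ : ℂ) = 1 := by
      rw [← tsum_eq_sum_scales z5, hψ.tsum_eq_one]
    rw [opS, opS, opS, tsum_eq_sum_scales z1, tsum_eq_sum_scales z2, tsum_eq_sum_scales z3]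
    -- Summed over the scales, the bracket multiplied by `b(x,ξ)` becomes `b - 1·b = 0`; it does not
    -- vanish scale by scale.
    simp_rw [opT_errAmp hφ hψ ha]
    rw [Finset.sum_sub_distrib, Finset.sum_sub_distrib, ← Finset.mul_sum, Finset.sum_sub_distrib,
      ← Finset.sum_mul, e1, e2]
    ring
  have h2 := opS_smAmp_sub hφ.unitBump hψ.dyadic (ha.mul ha) (hg.rough (1 + 1)) x ξ
  rw [← sharp_eq_opS, ← sharp_eq_opS, ← sharp_eq_opS, sharp_of_xi hφ hψ] at h2
  rw [h2, h1, ← sharp_eq_opS]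
  ring

lemma isSymbol_err (hφ : IsCutoff φ) (hψ : IsLittlewoodPaley ψ) (ha : Rough 1 a) {g : Rn n → ℂ}
    (hg : UnitBump g) : IsSymbol 1 (1 / 2) fun x ξ => opS (errAmp φ ψ a) x ξ - g ξ := by
  have h1 := (isAmp_errAmp hφ hψ ha).isSymbol_opS
  rw [show (0 : ℝ) + 1 / 2 + 1 / 2 = 1 by norm_num] at h1
  have h2 := (hg.isSymbol 1 (1 / 2)).const_mul (-1)
  simpa [sub_eq_add_neg] using h1.add h2

end ErrorSymbol

/-! ### Oscillatory integrals with symbols of order `-∞`. -/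

section Rapid

lemma isSymbol_coord (l : Fin n) (δ : ℝ) : IsSymbol 1 δ fun _ (ξ : Rn n) => ((ξ l : ℝ) : ℂ) :=
  isSymbol_of_xi (contDiff_coord l) fun α => by
    obtain ⟨C, hC, h⟩ := (rough_coord l).norm_dxi_le α
    exact ⟨C, hC, fun ξ => h 0 ξ⟩

lemma integrable_bracket : Integrable fun ξ : Rn n => bracket ξ ^ (-(n + 1 : ℝ)) := by
  refine ((integrable_inv_one_add_norm_pow (n := n)).const_mul (2 ^ (n + 1))).mono' ?_
    (Filter.Eventually.of_forall fun ξ => ?_)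
  · exact (continuous_bracket.rpow_const fun ξ => Or.inl (bracket_pos ξ).ne').aestronglyMeasurable
  · have h := bracket_pos ξ
    rw [Real.norm_of_nonneg (by positivity), Real.rpow_neg h.le, ← div_eq_mul_inv,
      show (n + 1 : ℝ) = ((n + 1 : ℕ) : ℝ) by push_cast; ring, Real.rpow_natCast, inv_eq_one_div,
      div_le_div_iff₀ (by positivity) (by positivity), one_mul, ← mul_pow]
    exact pow_le_pow_left₀ (by positivity) (one_add_norm_le_bracket ξ) _

/-- Symbols of order `-∞`. -/
def Rapid (p : Rn n → Rn n → ℂ) : Prop := ∀ m, IsSymbol m (1 / 2) p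

lemma Rapid.norm_dxi_le {p : Rn n → Rn n → ℂ} (hp : Rapid p) (α : List (Fin n)) (m : ℝ) :
    ∃ C, 0 ≤ C ∧ ∀ x ξ, ‖dxi α p x ξ‖ ≤ C * bracket ξ ^ m := by
  obtain ⟨C, hC, h⟩ := (hp (m + α.length)).2 α []
  refine ⟨C, hC, fun x ξ => (h x ξ).trans (le_of_eq ?_)⟩
  congr 2
  simp

lemma Rapid.mul {m : ℝ} {b p : Rn n → Rn n → ℂ} (hb : IsSymbol m (1 / 2) b) (hp : Rapid p) :
    Rapid fun x ξ => b x ξ * p x ξ := fun m' => by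
  have := hb.mul (hp (m' - m))
  rwa [add_sub_cancel] at this

/-- The amplitude of the derivative of `∫ e^{i x·ξ} p(x, ξ) dξ`. -/
def stepSym (l : Fin n) (p : Rn n → Rn n → ℂ) (x ξ : Rn n) : ℂ :=
  Complex.I * (((ξ l : ℝ) : ℂ) * p x ξ) + dx [l] p x ξ

lemma Rapid.stepSym {p : Rn n → Rn n → ℂ} (hp : Rapid p) (l : Fin n) : Rapid (PsiDO.stepSym l p) := by
  intro m
  have h1 := ((isSymbol_coord l (1 / 2)).mul (hp (m - 1))).const_mul Complex.I
  have h2 := (hp (m - 1 / 2)).dx [l]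
  rw [add_sub_cancel] at h1
  rw [show m - 1 / 2 + (([l] : List (Fin n)).length : ℝ) * (1 / 2) = m by simp] at h2
  exact h1.add h2

/-- The oscillatory integral `∫ e^{i x·ξ} p(x, ξ) dξ`. -/
def oscInt (p : Rn n → Rn n → ℂ) (x : Rn n) : ℂ := ∫ ξ, osc x ξ * p x ξ

variable {p : Rn n → Rn n → ℂ}

lemma contDiff_osc_mul (hp : ContDiff ℝ ∞ (Function.uncurry p)) :
    ContDiff ℝ ∞ (Function.uncurry fun x ξ => osc x ξ * p x ξ) := contDiff_osc.mul hp

lemma fderiv_osc_mul (hp : ContDiff ℝ ∞ (Function.uncurry p)) (l : Fin n) (x ξ : Rn n) :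
    fderiv ℝ (fun x => osc x ξ * p x ξ) x (bv l) = osc x ξ * stepSym l p x ξ := by
  have hd : DifferentiableAt ℝ (fun x => p x ξ) x :=
    differentiable_of_smooth (hp.comp (contDiff_id.prodMk contDiff_const)) x
  rw [fderiv_fun_mul (hasFDerivAt_osc_left x ξ).differentiableAt hd, (hasFDerivAt_osc_left x ξ).fderiv]
  have : fderiv ℝ (fun x => p x ξ) x (bv l) = dx [l] p x ξ := rfl
  simp only [add_apply, smul_apply, smul_eq_mul, ContinuousLinearMap.smulRight_apply,
    innerSL_apply_apply, inner_bv, this, stepSym, Complex.real_smul]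
  ring

lemma Rapid.integrable (hp : Rapid p) (x : Rn n) : Integrable fun ξ => osc x ξ * p x ξ := by
  obtain ⟨C, hC, h⟩ := hp.norm_dxi_le [] (-(n + 1 : ℝ))
  refine (integrable_bracket.const_mul C).mono' ?_ (Filter.Eventually.of_forall fun ξ => ?_)
  · exact (contDiff_slice_right (contDiff_osc_mul (hp 0).1) x).continuous.aestronglyMeasurable
  · rw [norm_mul, norm_osc, one_mul]
    exact h x ξ

lemma Rapid.hasFDerivAt (hp : Rapid p) (x : Rn n) :
    DifferentiableAt ℝ (oscInt p) x ∧ ∀ l, pderiv l (oscInt p) x = oscInt (PsiDO.stepSym l p) x := by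
  choose C hC h using fun l => (hp.stepSym l).norm_dxi_le [] (-(n + 1 : ℝ))
  have hS : 0 ≤ ∑ l, C l := Finset.sum_nonneg fun l _ => hC l
  have hsm := contDiff_osc_mul (hp 0).1
  have hbound : ∀ x ξ, ‖fderiv ℝ (fun x => osc x ξ * p x ξ) x‖ ≤
      n * (∑ l, C l) * bracket ξ ^ (-(n + 1 : ℝ)) := fun x ξ => by
    have hb := bracket_pos ξ
    rw [mul_assoc]
    refine norm_clm_le_sum _ (by positivity) fun l => ?_
    rw [fderiv_osc_mul (hp 0).1, norm_mul, norm_osc, one_mul]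
    refine (h l x ξ).trans ?_
    gcongr
    exact Finset.single_le_sum (f := C) (fun i _ => hC i) (Finset.mem_univ l)
  have hcont : Continuous fun ξ => fderiv ℝ (fun x => osc x ξ * p x ξ) x := by
    have e : (fun ξ => fderiv ℝ (fun x => osc x ξ * p x ξ) x) = fun ξ =>
        (fderiv ℝ (Function.uncurry fun x ξ => osc x ξ * p x ξ) (x, ξ)).comp
          (ContinuousLinearMap.inl ℝ (Rn n) (Rn n)) := by
      funext ξ
      refine ContinuousLinearMap.ext fun u => ?_
      exact fderiv_uncurry_fst (f := fun x ξ => osc x ξ * p x ξ) (differentiable_of_smooth hsm _)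
    rw [e]
    have h1 := hsm.continuous_fderiv (by simp)
    exact (h1.comp (continuous_const.prodMk continuous_id)).clm_comp continuous_const
  have hint := (integrable_bracket (n := n)).const_mul (n * ∑ l, C l)
  have key := hasFDerivAt_integral_of_dominated_of_fderiv_le (𝕜 := ℝ) (μ := volume)
    (F := fun x ξ => osc x ξ * p x ξ) (F' := fun x ξ => fderiv ℝ (fun x => osc x ξ * p x ξ) x)
    (x₀ := x) (s := Set.univ) (bound := fun ξ => n * (∑ l, C l) * bracket ξ ^ (-(n + 1 : ℝ)))
    Filter.univ_mem (Filter.Eventually.of_forall fun x => (hp.integrable x).aestronglyMeasurable)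
    (hp.integrable x) hcont.aestronglyMeasurable
    (Filter.Eventually.of_forall fun ξ x _ => hbound x ξ) hint
    (Filter.Eventually.of_forall fun ξ x _ => (differentiable_of_smooth
      (hsm.comp (contDiff_id.prodMk contDiff_const)) x).hasFDerivAt)
  refine ⟨key.differentiableAt, fun l => ?_⟩
  have hi : Integrable fun ξ => fderiv ℝ (fun x => osc x ξ * p x ξ) x :=
    hint.mono' hcont.aestronglyMeasurable (Filter.Eventually.of_forall fun ξ => hbound x ξ)
  have e : fderiv ℝ (oscInt p) x = _ := key.fderiv
  rw [pderiv, e, ContinuousLinearMap.integral_apply hi]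
  exact integral_congr_ae (Filter.Eventually.of_forall fun ξ => fderiv_osc_mul (hp 0).1 l x ξ)

lemma Rapid.contDiff_oscInt (hp : Rapid p) : ContDiff ℝ ∞ (oscInt p) := by
  rw [contDiff_infty]
  intro N
  induction N generalizing p with
  | zero =>
    refine contDiff_zero.2 (continuous_iff_continuousAt.2 fun x => ?_)
    exact (hp.hasFDerivAt x).1.continuousAt
  | succ N ih =>
    rw [show ((N + 1 : ℕ) : WithTop ℕ∞) = (N : WithTop ℕ∞) + 1 by push_cast; rfl,
      contDiff_succ_iff_fderiv]
    refine ⟨fun x => (hp.hasFDerivAt x).1, by simp, ?_⟩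
    have e : fderiv ℝ (oscInt p) = fun x => ∑ l, (EuclideanSpace.proj l : Rn n →L[ℝ] ℝ).smulRight
        (oscInt (PsiDO.stepSym l p) x) := by
      funext x
      refine ContinuousLinearMap.ext fun u => ?_
      rw [fderiv_eq_sum_pderiv, sum_apply]
      refine Finset.sum_congr rfl fun l _ => ?_
      rw [(hp.hasFDerivAt x).2 l]
      simp
    rw [e]
    exact ContDiff.sum fun l _ => contDiff_const.smulRight (ih (hp.stepSym l))

lemma Rapid.exists_pderivs (hp : Rapid p) (w : List (Fin n)) :
    ∃ q, Rapid q ∧ pderivs w (oscInt p) = oscInt q := by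
  induction w with
  | nil => exact ⟨p, hp, rfl⟩
  | cons l w ih =>
    obtain ⟨q, hq, e⟩ := ih
    refine ⟨PsiDO.stepSym l q, hq.stepSym l, ?_⟩
    rw [pderivs_cons, e]
    funext x
    exact (hq.hasFDerivAt x).2 l

/-- Integration by parts in `ξ` only; the uniform bounds in `x` for the `ξ`-derivatives provide the
integrable majorants. -/
lemma Rapid.decay (hp : Rapid p) (N : ℕ) :
    ∃ C, ∀ x, (1 + ‖x‖) ^ N * ‖oscInt p x‖ ≤ C := by
  choose C hC h using fun w => hp.norm_dxi_le w (-(n + 1 : ℝ))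
  have hint := integrable_bracket (n := n)
  set K := ∫ ξ : Rn n, bracket ξ ^ (-(n + 1 : ℝ))
  have hK : 0 ≤ K := integral_nonneg fun ξ => by have := bracket_pos ξ; positivity
  have hi : ∀ w x, Integrable (pderivs w (p x)) := fun w x =>
    (hint.const_mul (C w)).mono'
      (contDiff_slice_right (contDiff_dxi (hp 0).1 w) x).continuous.aestronglyMeasurable
      (Filter.Eventually.of_forall fun ξ => h w x ξ)
  have hle : ∀ w x, ∫ ξ, ‖pderivs w (p x) ξ‖ ≤ C w * K := fun w x => by
    rw [← integral_const_mul]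
    exact integral_mono (hi w x).norm (hint.const_mul (C w)) fun ξ => h w x ξ
  have hS : 0 ≤ ∑ j, C (List.replicate N j) := Finset.sum_nonneg fun l _ => hC _
  refine ⟨2 ^ N * (1 + n ^ N * n) * ((C [] + ∑ j, C (List.replicate N j)) * K), fun x => ?_⟩
  have := weighted_norm_integral_osc_le (contDiff_slice_right (hp 0).1 x) N
    (fun j N' _ => hi _ x) (s := 1) (L := (C [] + ∑ j, C (List.replicate N j)) * K) one_pos ?_
    (fun j => ?_) x
  · rw [one_mul] at this
    exact this
  · refine (hle [] x).trans ?_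
    gcongr
    linarith
  · rw [one_pow, one_mul]
    refine (hle _ x).trans ?_
    gcongr
    have := Finset.single_le_sum (f := fun j => C (List.replicate N j)) (fun i _ => hC _)
      (Finset.mem_univ j)
    linarith [hC []]

end Rapid

/-! ### Pseudodifferential operators on Schwartz functions. -/

section Schwartz

/-- Smooth functions whose partial derivatives decay are Schwartz functions. -/
lemma exists_schwartz {g : Rn n → ℂ} (hg : ContDiff ℝ ∞ g)
    (h : ∀ w N, ∃ C, ∀ x, (1 + ‖x‖) ^ N * ‖pderivs w g x‖ ≤ C) : ∃ G : 𝓢(Rn n, ℂ), ⇑G = g := by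
  have key : ∀ (k : ℕ) (g : Rn n → ℂ), ContDiff ℝ ∞ g →
      (∀ w N, ∃ C, ∀ x, (1 + ‖x‖) ^ N * ‖pderivs w g x‖ ≤ C) →
      ∀ N : ℕ, ∃ C, ∀ x, (1 + ‖x‖) ^ N * ‖iteratedFDeriv ℝ k g x‖ ≤ C := by
    intro k
    induction k with
    | zero =>
      intro g hg h N
      obtain ⟨C, hC⟩ := h [] N
      exact ⟨C, fun x => by rw [norm_iteratedFDeriv_zero]; exact hC x⟩
    | succ k ih =>
      intro g hg h N
      have hl : ∀ l : Fin n, ∃ C, ∀ x, (1 + ‖x‖) ^ N * ‖iteratedFDeriv ℝ k (pderivs [l] g) x‖ ≤ C :=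
        fun l => ih _ (contDiff_wderiv hg [l]) (fun w N => by
          obtain ⟨C, hC⟩ := h (w ++ [l]) N
          refine ⟨C, fun x => ?_⟩
          have := hC x
          rwa [pderivs_eq_wderiv_bv, wderiv_append] at this) N
      choose C hC using hl
      let L : Fin n → ℂ →L[ℝ] (Rn n →L[ℝ] ℂ) := fun l =>
        ContinuousLinearMap.smulRightL ℝ (Rn n) ℂ (EuclideanSpace.proj l : Rn n →L[ℝ] ℝ)
      have e : fderiv ℝ g = fun x => ∑ l, (L l ∘ pderivs [l] g) x := by
        funext x
        refine ContinuousLinearMap.ext fun u => ?_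
        rw [fderiv_eq_sum_pderiv, sum_apply]
        refine Finset.sum_congr rfl fun l _ => ?_
        simp [L, pderivs]
      refine ⟨∑ l, ‖L l‖ * C l, fun x => ?_⟩
      have hs : ∀ l, ContDiff ℝ k (L l ∘ pderivs [l] g) := fun l =>
        ((L l).contDiff.comp (contDiff_wderiv hg [l])).of_le (by exact_mod_cast le_top)
      rw [← norm_iteratedFDeriv_fderiv, e, iteratedFDeriv_fun_sum_apply fun l _ => (hs l).contDiffAt]
      calc _ ≤ (1 + ‖x‖) ^ N * ∑ l, ‖L l‖ * ‖iteratedFDeriv ℝ k (pderivs [l] g) x‖ := by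
            gcongr
            refine (norm_sum_le _ _).trans (Finset.sum_le_sum fun l _ => ?_)
            exact (L l).norm_iteratedFDeriv_comp_left (N := ∞)
              (contDiff_wderiv hg [l]).contDiffAt (by exact_mod_cast le_top)
        _ = ∑ l, ‖L l‖ * ((1 + ‖x‖) ^ N * ‖iteratedFDeriv ℝ k (pderivs [l] g) x‖) := by
            rw [Finset.mul_sum]
            exact Finset.sum_congr rfl fun l _ => by ring
        _ ≤ _ := Finset.sum_le_sum fun l _ => mul_le_mul_of_nonneg_left (hC l x) (norm_nonneg (L l))
  refine ⟨⟨g, hg, fun N k => ?_⟩, rfl⟩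
  obtain ⟨C, hC⟩ := key k g hg h N
  refine ⟨C, fun x => le_trans ?_ (hC x)⟩
  gcongr
  linarith

lemma exists_schwartz_hat (f : 𝓢(Rn n, ℂ)) : ∃ h : 𝓢(Rn n, ℂ), ⇑h = hat f := by
  let e : Rn n ≃L[ℝ] Rn n := ContinuousLinearEquiv.smulLeft
    (Units.mk0 ((2 * Real.pi)⁻¹) (by positivity))
  refine ⟨SchwartzMap.compCLMOfContinuousLinearEquiv ℂ e (FourierTransform.fourier f), ?_⟩
  funext ξ
  rw [hat_eq_fourier]
  rfl

lemma exists_schwartz_pderivs (h : 𝓢(Rn n, ℂ)) (w : List (Fin n)) :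
    ∃ h' : 𝓢(Rn n, ℂ), ⇑h' = pderivs w h := by
  induction w with
  | nil => exact ⟨h, rfl⟩
  | cons l w ih =>
    obtain ⟨h', e⟩ := ih
    refine ⟨LineDeriv.lineDerivOp (bv l) h', ?_⟩
    funext x
    rw [SchwartzMap.lineDerivOp_apply_eq_fderiv, e]
    rfl

lemma schwartz_norm_le (h : 𝓢(Rn n, ℂ)) (m : ℝ) :
    ∃ C, 0 ≤ C ∧ ∀ ξ, ‖h ξ‖ ≤ C * bracket ξ ^ m := by
  set N := ⌈-m⌉₊
  set C := (2 : ℝ) ^ N * ((Finset.Iic (N, 0)).sup fun q : ℕ × ℕ => SchwartzMap.seminorm ℝ q.1 q.2) h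
  refine ⟨C, by positivity, fun ξ => ?_⟩
  have h1 := SchwartzMap.one_add_le_sup_seminorm_apply (𝕜 := ℝ) (m := (N, 0)) le_rfl le_rfl h ξ
  rw [norm_iteratedFDeriv_zero] at h1
  have hb := bracket_pos ξ
  have h2 : bracket ξ ^ N * ‖h ξ‖ ≤ C :=
    (mul_le_mul_of_nonneg_right (pow_le_pow_left₀ hb.le (bracket_le ξ) N) (norm_nonneg _)).trans h1
  have h3 : bracket ξ ^ (-(N : ℝ)) ≤ bracket ξ ^ m :=
    Real.rpow_le_rpow_of_exponent_le (one_le_bracket ξ) (by linarith [Nat.le_ceil (-m)])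
  calc ‖h ξ‖ = bracket ξ ^ N * ‖h ξ‖ * bracket ξ ^ (-(N : ℝ)) := by
        rw [Real.rpow_neg hb.le, Real.rpow_natCast]; field_simp
    _ ≤ _ := by gcongr

lemma rapid_hat (f : 𝓢(Rn n, ℂ)) : Rapid fun _ : Rn n => hat f := by
  intro m
  obtain ⟨h, e⟩ := exists_schwartz_hat f
  rw [← e]
  refine isSymbol_of_xi (h.smooth ⊤) fun α => ?_
  obtain ⟨hα, e'⟩ := exists_schwartz_pderivs h α
  rw [← e']
  exact schwartz_norm_le hα _

/-- Pseudodifferential operators map Schwartz functions to Schwartz functions. -/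
theorem exists_schwartz_op {m : ℝ} {b : Rn n → Rn n → ℂ} (hb : IsSymbol m (1 / 2) b)
    (f : 𝓢(Rn n, ℂ)) : ∃ g : 𝓢(Rn n, ℂ), ⇑g = op b f := by
  have hp := Rapid.mul hb (rapid_hat f)
  have hp' := Rapid.mul (b := fun _ _ => (((2 * Real.pi) ^ n : ℝ) : ℂ)⁻¹) (m := 0)
    (isSymbol_of_xi contDiff_const fun α => by
      obtain ⟨C, hC, h⟩ := (rough_const (n := n) (((2 * Real.pi) ^ n : ℝ) : ℂ)⁻¹).norm_dxi_le α
      exact ⟨C, hC, fun ξ => h 0 ξ⟩) hp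
  have e : op b f = oscInt fun x ξ => (((2 * Real.pi) ^ n : ℝ) : ℂ)⁻¹ * (b x ξ * hat f ξ) := by
    funext x
    rw [op, invHat_eq, oscInt, ← integral_const_mul]
    congr 1 with ξ
    ring
  rw [e]
  refine exists_schwartz hp'.contDiff_oscInt fun w N => ?_
  obtain ⟨q, hq, e'⟩ := hp'.exists_pderivs w
  rw [e']
  exact hq.decay N

end Schwartz

/-! ### The rearrangement behind the composition formula. -/

section Fubini

lemma integrable_bracket_prod (C : ℝ) (x : Rn n) :
    Integrable (fun q : Rn n × Rn n => C * (bracket q.1 ^ (-(n + 1 : ℝ)) *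
      ((1 + ‖x - q.2‖) ^ (n + 1))⁻¹)) (volume.prod volume) := by
  have h := integrable_inv_one_add_norm_sub_pow (n := n) one_pos x
  simp only [one_mul] at h
  exact (integrable_bracket.mul_prod h).const_mul C

/-- Rearrangement of the iterated integral that defines a composition of operators. -/
lemma integral_rearrange {G : Rn n → Rn n → Rn n → ℂ} {B : Rn n → ℂ} {C C' D : ℝ} {x : Rn n}
    (hG : Continuous fun q : (Rn n × Rn n) × Rn n => G q.1.1 q.1.2 q.2) (hB : Continuous B)
    (hBle : ∀ ζ, ‖B ζ‖ ≤ D * bracket ζ)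
    (hGle : ∀ ζ y ξ, ‖G ζ y ξ‖ ≤ C * bracket ζ ^ (-(n + 2 : ℝ)) * bracket ξ ^ (-(n + 1 : ℝ)))
    (hH : ∀ ζ y, ‖∫ ξ, osc y ξ * G ζ y ξ‖ ≤
      C * bracket ζ ^ (-(n + 2 : ℝ)) * ((1 + ‖y‖) ^ (n + 1))⁻¹)
    (hJ : ∀ y ξ, ‖∫ η, osc (x - y) η * (G (ξ + η) y ξ * B (ξ + η))‖ ≤
      C' * (bracket ξ ^ (-(n + 1 : ℝ)) * ((1 + ‖x - y‖) ^ (n + 1))⁻¹)) :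
    ∫ ζ, osc x ζ * (B ζ * ∫ y, osc (-y) ζ * ∫ ξ, osc y ξ * G ζ y ξ) =
      ∫ ξ, osc x ξ * ∫ y, ∫ η, osc (x - y) η * (G (ξ + η) y ξ * B (ξ + η)) := by
  have hord : ∀ ζ : Rn n, bracket ζ * bracket ζ ^ (-(n + 2 : ℝ)) = bracket ζ ^ (-(n + 1 : ℝ)) := by
    intro ζ
    rw [← Real.rpow_one_add' (bracket_pos ζ).le (by linarith [Nat.cast_nonneg (α := ℝ) n])]
    congr 1
    ring
  have hHm : StronglyMeasurable fun q : Rn n × Rn n => ∫ ξ, osc q.2 ξ * G q.1 q.2 ξ :=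
    StronglyMeasurable.integral_prod_right' (f := fun p : (Rn n × Rn n) × Rn n =>
      osc p.1.2 p.2 * G p.1.1 p.1.2 p.2)
      (((continuous_osc (f := fun p : (Rn n × Rn n) × Rn n => p.1.2) (by fun_prop)
        continuous_snd).mul hG).stronglyMeasurable)
  have h1 : ∀ ζ, osc x ζ * (B ζ * ∫ y, osc (-y) ζ * ∫ ξ, osc y ξ * G ζ y ξ) =
      ∫ y, osc (x - y) ζ * (B ζ * ∫ ξ, osc y ξ * G ζ y ξ) := fun ζ => by
    rw [← integral_const_mul, ← integral_const_mul]
    congr 1 with y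
    rw [sub_eq_add_neg, osc_add_left]
    ring
  have hi1 : Integrable (Function.uncurry fun ζ y : Rn n =>
      osc (x - y) ζ * (B ζ * ∫ ξ, osc y ξ * G ζ y ξ)) (volume.prod volume) := by
    refine (integrable_bracket_prod (D * C) (0 : Rn n)).mono' ?_
      (Filter.Eventually.of_forall fun q => ?_)
    · have hc : Continuous fun q : Rn n × Rn n => osc (x - q.2) q.1 :=
        continuous_osc (by fun_prop) (by fun_prop)
      exact (hc.stronglyMeasurable.mul
        ((hB.comp continuous_fst).stronglyMeasurable.mul hHm)).aestronglyMeasurable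
    · obtain ⟨ζ, y⟩ := q
      simp only [Function.uncurry, norm_mul, norm_osc, one_mul, zero_sub, norm_neg]
      calc _ ≤ (D * bracket ζ) * (C * bracket ζ ^ (-(n + 2 : ℝ)) * ((1 + ‖y‖) ^ (n + 1))⁻¹) :=
            mul_le_mul (hBle ζ) (hH ζ y) (norm_nonneg _) ((norm_nonneg _).trans (hBle ζ))
        _ = _ := by rw [← hord]; ring
  have h2 : ∀ y, ∫ ζ, osc (x - y) ζ * (B ζ * ∫ ξ, osc y ξ * G ζ y ξ) =
      ∫ ξ, osc x ξ * ∫ η, osc (x - y) η * (G (ξ + η) y ξ * B (ξ + η)) := fun y => by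
    have e1 : ∀ ζ, osc (x - y) ζ * (B ζ * ∫ ξ, osc y ξ * G ζ y ξ) =
        ∫ ξ, osc (x - y) ζ * (B ζ * (osc y ξ * G ζ y ξ)) := fun ζ => by
      rw [integral_const_mul, integral_const_mul]
    simp_rw [e1]
    rw [integral_integral_swap]
    · congr 1 with ξ
      -- The substitution `ζ = ξ + η`: the outgoing frequency is the incoming one plus the frequency
      -- of the symbol.
      rw [← integral_const_mul, ← integral_add_left_eq_self (fun ζ => _) ξ]
      congr 1 with η
      have : osc x ξ = osc (x - y) ξ * osc y ξ := by rw [← osc_add_left, sub_add_cancel]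
      rw [osc_add_right, this]
      ring
    · refine ((((integrable_bracket (n := n)).mul_prod integrable_bracket)).const_mul (D * C)).mono' ?_
        (Filter.Eventually.of_forall fun q => ?_)
      · have hc : Continuous fun q : Rn n × Rn n => osc (x - y) q.1 :=
          continuous_osc (by fun_prop) (by fun_prop)
        have hc' : Continuous fun q : Rn n × Rn n => osc y q.2 :=
          continuous_osc (by fun_prop) (by fun_prop)
        have hG' : Continuous fun q : Rn n × Rn n => G q.1 y q.2 :=
          hG.comp (f := fun q : Rn n × Rn n => ((q.1, y), q.2)) (by fun_prop)
        exact (hc.mul ((hB.comp continuous_fst).mul (hc'.mul hG'))).aestronglyMeasurable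
      · obtain ⟨ζ, ξ⟩ := q
        simp only [Function.uncurry, norm_mul, norm_osc, one_mul]
        calc _ ≤ (D * bracket ζ) * (C * bracket ζ ^ (-(n + 2 : ℝ)) * bracket ξ ^ (-(n + 1 : ℝ))) :=
              mul_le_mul (hBle ζ) (hGle ζ y ξ) (norm_nonneg _) ((norm_nonneg _).trans (hBle ζ))
          _ = _ := by rw [← hord ζ]; ring
  simp_rw [h1]
  rw [integral_integral_swap hi1]
  simp_rw [h2]
  rw [integral_integral_swap]
  · simp_rw [integral_const_mul]
  · have hJm : StronglyMeasurable fun q : Rn n × Rn n =>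
        ∫ η, osc (x - q.1) η * (G (q.2 + η) q.1 q.2 * B (q.2 + η)) := by
      refine StronglyMeasurable.integral_prod_right' (f := fun p : (Rn n × Rn n) × Rn n =>
        osc (x - p.1.1) p.2 * (G (p.1.2 + p.2) p.1.1 p.1.2 * B (p.1.2 + p.2))) ?_
      have hc : Continuous fun p : (Rn n × Rn n) × Rn n => osc (x - p.1.1) p.2 :=
        continuous_osc (by fun_prop) (by fun_prop)
      have hG' := hG.comp (f := fun p : (Rn n × Rn n) × Rn n => ((p.1.2 + p.2, p.1.1), p.1.2))
        (by fun_prop)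
      have hB' := hB.comp (f := fun p : (Rn n × Rn n) × Rn n => p.1.2 + p.2) (by fun_prop)
      exact (hc.mul (hG'.mul hB')).stronglyMeasurable
    have hc : Continuous fun q : Rn n × Rn n => osc x q.2 :=
      continuous_osc (by fun_prop) (by fun_prop)
    refine (integrable_bracket_prod C' x).swap.mono'
      (hc.stronglyMeasurable.mul hJm).aestronglyMeasurable (Filter.Eventually.of_forall fun q => ?_)
    simp only [Function.uncurry, norm_mul, norm_osc, one_mul]
    exact hJ q.1 q.2

end Fubini

/-! ### The Fourier transform of the image of an operator, scale by scale. -/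

section Pieces

lemma summable_lam_inv : Summable fun k => lam k ^ (-1 : ℝ) := by
  simp only [lam, Real.rpow_neg_one, ← inv_pow]
  exact summable_geometric_of_lt_one (by norm_num) (by norm_num)

lemma lam_rpow_neg_le_bracket_add {k : ℕ} {ξ η : Rn n} (h : ξ ∈ Shell k) (hη : ‖η‖ ≤ hlf k)
    (s : ℝ) : lam k ^ (-s) ≤ 64 ^ |s| * bracket (ξ + η) ^ (-s) := by
  have h1 := bracket_add_rpow_le_of_mem_shell h hη s
  have h2 := Real.rpow_pos_of_pos (lam_pos k) s
  have h3 := Real.rpow_pos_of_pos (bracket_pos (ξ + η)) s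
  rw [Real.rpow_neg (lam_pos k).le, Real.rpow_neg (bracket_pos _).le, inv_eq_one_div,
    ← div_eq_mul_inv, div_le_div_iff₀ h2 h3, one_mul]
  exact h1

variable {φ : Rn n → ℂ} {χ : ℕ → Rn n → ℂ} {u : Rn n → Rn n → ℂ}

/-- The amplitudes of the Fourier transform of the image of an operator. -/
def freqAmp (φ : Rn n → ℂ) (χ : ℕ → Rn n → ℂ) (u : Rn n → Rn n → ℂ) (k : ℕ) (ζ y ξ : Rn n) : ℂ :=
  φ ((hlf k)⁻¹ • (ζ - ξ)) * (χ k ξ * u y ξ)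

lemma UnitBump.norm_pderivs_shift_le (hφ : UnitBump φ) (w : List (Fin n)) : ∃ C, 0 ≤ C ∧
    ∀ k ζ ξ, ‖pderivs w (fun ξ : Rn n => φ ((hlf k)⁻¹ • (ζ - ξ))) ξ‖ ≤ C := by
  have hφ' : UnitBump fun η => φ (-η) :=
    ⟨hφ.smooth.comp contDiff_neg, fun η hη => hφ.supp _ (by rwa [norm_neg])⟩
  obtain ⟨C, hC, h⟩ := hφ'.wbdd_scaled (P := ℕ) id w
  refine ⟨C, hC, fun k ζ ξ => ?_⟩
  have e := wderiv_comp_affine (v := bv) (hφ'.smooth_scaled (hlf k)⁻¹)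
    (ContinuousLinearMap.id ℝ (Rn n)) (-ζ) w
  have e' : (fun ξ : Rn n => φ ((hlf k)⁻¹ • (ζ - ξ))) = fun ξ =>
      φ (-((hlf k)⁻¹ • (ContinuousLinearMap.id ℝ (Rn n) ξ + -ζ))) := by
    funext ξ
    rw [← smul_neg]
    congr 2
    simp [sub_eq_add_neg]
  rw [pderivs_eq_wderiv_bv, e', e]
  refine (h k _ (Set.mem_univ _)).trans ?_
  rw [pow_zero, mul_one]
  refine mul_le_of_le_one_right hC (Real.rpow_le_one_of_one_le_of_nonpos (one_le_lam k) ?_)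
  rw [wordWt_const]
  have : (0 : ℝ) ≤ w.length := Nat.cast_nonneg _
  linarith

lemma UnitBump.contDiff_shift (hφ : UnitBump φ) (k : ℕ) (ζ : Rn n) :
    ContDiff ℝ ∞ fun ξ : Rn n => φ ((hlf k)⁻¹ • (ζ - ξ)) :=
  (hφ.smooth_scaled (hlf k)⁻¹).comp (contDiff_const.sub contDiff_id)

lemma contDiff_freqAmp (hφ : UnitBump φ) (hχ : Dyadic χ) (hu : ∀ y, ContDiff ℝ ∞ (u y)) (k : ℕ)
    (ζ y : Rn n) : ContDiff ℝ ∞ (freqAmp φ χ u k ζ y) :=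
  (hφ.contDiff_shift k ζ).mul ((hχ.smooth k).mul (hu y))

lemma continuous_freqAmp (hφ : UnitBump φ) (hχ : Dyadic χ) {m : ℝ} (hu : Rough m u) (k : ℕ) :
    Continuous fun q : (Rn n × Rn n) × Rn n => freqAmp φ χ u k q.1.1 q.1.2 q.2 := by
  have h1 := hφ.smooth.continuous.comp (f := fun q : (Rn n × Rn n) × Rn n =>
    (hlf k)⁻¹ • (q.1.1 - q.2)) (by fun_prop)
  have h2 := (hχ.smooth k).continuous.comp (f := fun q : (Rn n × Rn n) × Rn n => q.2) (by fun_prop)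
  have h3 : Continuous fun q : (Rn n × Rn n) × Rn n => u q.1.2 q.2 :=
    (hu.continuous_dxi []).comp (f := fun q : (Rn n × Rn n) × Rn n => (q.1.2, q.2)) (by fun_prop)
  exact h1.mul (h2.mul h3)

lemma wbdd_freqAmp (hφ : UnitBump φ) (hχ : Dyadic χ) {s : ℝ} (hu : Rough s u) :
    WBdd bv (fun _ => 0) (fun p => Shell p.1) (fun p _ => lam p.1) (fun _ _ => 1) s 0
      (fun p : ℕ × Rn n × Rn n => freqAmp φ χ u p.1 p.2.1 p.2.2) := by
  have hmono : ∀ (k : ℕ) {t t' : ℝ}, t ≤ t' → lam k ^ t ≤ lam k ^ t' := fun k _ _ h =>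
    Real.rpow_le_rpow_of_exponent_le (one_le_lam k) h
  let Ω : ℕ × Rn n × Rn n → Set (Rn n) := fun p => Shell p.1
  have hφ1 : WBdd bv (fun _ => 0) Ω (fun p _ => lam p.1) (fun _ _ => 1) 0 0
      (fun (p : ℕ × Rn n × Rn n) ξ => φ ((hlf p.1)⁻¹ • (p.2.1 - ξ))) := fun w => by
    obtain ⟨C, hC, h⟩ := hφ.norm_pderivs_shift_le w
    exact ⟨C, hC, fun p ξ _ => by
      rw [← pderivs_eq_wderiv_bv]
      simpa [wordWt_const] using h p.1 p.2.1 ξ⟩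
  have hχ1 : WBdd bv (fun _ => 0) Ω (fun p _ => lam p.1) (fun _ _ => 1) 0 0
      (fun (p : ℕ × Rn n × Rn n) => χ p.1) := fun w => by
    obtain ⟨C, hC, h⟩ := hχ.bdd w
    refine ⟨C, hC, fun p ξ _ => (h p.1 ξ).trans ?_⟩
    rw [pow_zero, mul_one, wordWt_const]
    exact mul_le_mul_of_nonneg_left (hmono _ (by simp)) hC
  have hu1 : WBdd bv (fun _ => 0) Ω (fun p _ => lam p.1) (fun _ _ => 1) s 0
      (fun (p : ℕ × Rn n × Rn n) => u p.2.2) := fun w => by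
    obtain ⟨C, hC, h⟩ := hu.wbdd w
    refine ⟨C, hC, fun p ξ hξ => (h (p.1, p.2.2) ξ hξ).trans ?_⟩
    simp only [pow_zero, mul_one, wordWt_const]
    refine mul_le_mul_of_nonneg_left (hmono _ ?_) hC
    have : (0 : ℝ) ≤ w.length := Nat.cast_nonneg _
    linarith
  have hmul : WBdd bv (fun _ => 0) Ω (fun p _ => lam p.1) (fun _ _ => 1) (0 + (0 + s)) 0
      (fun p : ℕ × Rn n × Rn n => freqAmp φ χ u p.1 p.2.1 p.2.2) := WBdd.mul (M := 0) (M' := 0) (fun p _ => lam_pos p.1) (fun _ _ => le_rfl)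
    (fun p => hφ.contDiff_shift p.1 p.2.1)
    (fun p => (hχ.smooth p.1).mul (hu.smooth p.2.2)) hφ1
    (WBdd.mul (M := 0) (M' := 0) (fun p _ => lam_pos p.1) (fun _ _ => le_rfl)
      (fun p => hχ.smooth p.1) (fun p => hu.smooth p.2.2) hχ1 hu1)
  rwa [zero_add, zero_add] at hmul

/-- On the support both `⟨ξ⟩` and `⟨ζ⟩` are comparable to `λ_k`, so any negative power of `λ_k` can
be traded for decay in either variable. -/
lemma norm_pderivs_freqAmp_le (hφ : UnitBump φ) (hχ : Dyadic χ) (hu : ∀ m, Rough m u)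
    (w : List (Fin n)) : ∃ C, 0 ≤ C ∧ ∀ k ζ y ξ, ‖pderivs w (freqAmp φ χ u k ζ y) ξ‖ ≤
      C * lam k ^ (-1 : ℝ) * bracket ζ ^ (-(n + 2 : ℝ)) * bracket ξ ^ (-(n + 1 : ℝ)) := by
  -- The three summands buy summability in `k`, decay in `ζ` that tolerates a factor `⟨ζ⟩`, and
  -- integrability in `ξ`.
  set s : ℝ := -1 + (-(n + 2 : ℝ)) + (-(n + 1 : ℝ)) with hs
  obtain ⟨C, hC, h⟩ := wbdd_freqAmp hφ hχ (hu s) w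
  refine ⟨C * (64 ^ |(n + 2 : ℝ)| * 4 ^ |(-(n + 1 : ℝ))|), by positivity, fun k ζ y ξ => ?_⟩
  have hb := bracket_pos ξ
  have hb' := bracket_pos ζ
  have hl := lam_pos k
  by_cases hx : ξ ∈ Shell k ∩ {ξ : Rn n | ‖ζ - ξ‖ ≤ hlf k}
  · refine (h (k, ζ, y) ξ hx.1).trans ?_
    have h1 := lam_rpow_neg_le_bracket_add hx.1 hx.2 (n + 2 : ℝ)
    have h2 := lam_rpow_le_of_mem_shell hx.1 (-(n + 1 : ℝ))
    rw [add_sub_cancel] at h1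
    have e : lam k ^ s = lam k ^ (-1 : ℝ) * lam k ^ (-(n + 2 : ℝ)) * lam k ^ (-(n + 1 : ℝ)) := by
      rw [hs, Real.rpow_add hl, Real.rpow_add hl]
    simp only [pow_zero, mul_one, wordWt_const, mul_zero, add_zero]
    rw [e]
    calc _ ≤ C * (lam k ^ (-1 : ℝ) * (64 ^ |(n + 2 : ℝ)| * bracket ζ ^ (-(n + 2 : ℝ))) *
          (4 ^ |(-(n + 1 : ℝ))| * bracket ξ ^ (-(n + 1 : ℝ)))) := by gcongr
      _ = _ := by ring
  · have hcl : IsClosed (Shell k ∩ {ξ : Rn n | ‖ζ - ξ‖ ≤ hlf k}) :=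
      (isClosed_shell k).inter (isClosed_le (by fun_prop) continuous_const)
    have : pderivs w (freqAmp φ χ u k ζ y) ξ = 0 := by
      refine wderiv_eq_zero_of_isClosed hcl (fun ξ hξ => ?_) w hx
      rw [freqAmp]
      by_cases h1 : ξ ∈ Shell k
      · have : hlf k < ‖ζ - ξ‖ := by
          by_contra! h2
          exact hξ ⟨h1, h2⟩
        rw [hφ.supp_scaled k _ this, zero_mul]
      · rw [hχ.supp k ξ h1, zero_mul, mul_zero]
    rw [this, norm_zero]
    positivity

/-- `n + 1` integrations by parts in `ξ` yield the decay in `y` that makes the outer integral of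
`freqPart` absolutely convergent. -/
lemma norm_integral_freqAmp_le (hφ : UnitBump φ) (hχ : Dyadic χ) (hu : ∀ m, Rough m u) :
    ∃ C, 0 ≤ C ∧ ∀ k ζ y, ‖∫ ξ, osc y ξ * freqAmp φ χ u k ζ y ξ‖ ≤
      C * lam k ^ (-1 : ℝ) * bracket ζ ^ (-(n + 2 : ℝ)) * ((1 + ‖y‖) ^ (n + 1))⁻¹ := by
  choose C hC h using norm_pderivs_freqAmp_le hφ hχ hu
  have hint := integrable_bracket (n := n)
  set K := ∫ ξ : Rn n, bracket ξ ^ (-(n + 1 : ℝ))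
  have hK : 0 ≤ K := integral_nonneg fun ξ => by have := bracket_pos ξ; positivity
  set D := C [] + ∑ j, C (List.replicate (n + 1) j)
  have hS : 0 ≤ ∑ j, C (List.replicate (n + 1) j) := Finset.sum_nonneg fun l _ => hC _
  have hD : 0 ≤ D := add_nonneg (hC _) hS
  refine ⟨2 ^ (n + 1) * (1 + n ^ (n + 1) * n) * (D * K), by positivity, fun k ζ y => ?_⟩
  set A := lam k ^ (-1 : ℝ) * bracket ζ ^ (-(n + 2 : ℝ))
  have hA : 0 ≤ A := by have := bracket_pos ζ; have := lam_pos k; positivity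
  have h' : ∀ w ξ, ‖pderivs w (freqAmp φ χ u k ζ y) ξ‖ ≤ C w * A * bracket ξ ^ (-(n + 1 : ℝ)) :=
    fun w ξ => (h w k ζ y ξ).trans (le_of_eq (by ring))
  have hsm := contDiff_freqAmp hφ hχ (hu 0).smooth k ζ y
  have hi : ∀ w, Integrable (pderivs w (freqAmp φ χ u k ζ y)) := fun w =>
    (hint.const_mul (C w * A)).mono' (contDiff_wderiv hsm w).continuous.aestronglyMeasurable
      (Filter.Eventually.of_forall fun ξ => h' w ξ)
  have hle : ∀ w, ∫ ξ, ‖pderivs w (freqAmp φ χ u k ζ y) ξ‖ ≤ C w * A * K := fun w => by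
    rw [← integral_const_mul]
    exact integral_mono (hi w).norm (hint.const_mul (C w * A)) fun ξ => h' w ξ
  have := weighted_norm_integral_osc_le hsm (n + 1)
    (fun j N' _ => hi _) (s := 1) (L := D * A * K) one_pos
    ((hle []).trans (by gcongr; linarith)) (fun j => by
      rw [one_pow, one_mul]
      refine (hle _).trans ?_
      gcongr
      have := Finset.single_le_sum (f := fun j => C (List.replicate (n + 1) j)) (fun i _ => hC _)
        (Finset.mem_univ j)
      linarith [hC []]) y
  rw [one_mul] at this
  rw [← div_eq_mul_inv, le_div_iff₀ (by positivity), mul_comm]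
  exact this.trans (le_of_eq (by ring))

/-- The Fourier transforms of the pieces of the image of an operator. -/
def freqPart (φ : Rn n → ℂ) (χ : ℕ → Rn n → ℂ) (u : Rn n → Rn n → ℂ) (k : ℕ) (ζ : Rn n) : ℂ :=
  (((2 * Real.pi) ^ n : ℝ) : ℂ)⁻¹ * ∫ y, osc (-y) ζ * ∫ ξ, osc y ξ * freqAmp φ χ u k ζ y ξ

lemma norm_freqPart_le (hφ : UnitBump φ) (hχ : Dyadic χ) (hu : ∀ m, Rough m u) :
    ∃ C, 0 ≤ C ∧ ∀ k ζ, ‖freqPart φ χ u k ζ‖ ≤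
      C * lam k ^ (-1 : ℝ) * bracket ζ ^ (-(n + 2 : ℝ)) := by
  obtain ⟨C, hC, h⟩ := norm_integral_freqAmp_le hφ hχ hu
  have hint := integrable_inv_one_add_norm_pow (n := n)
  have hK : 0 ≤ ∫ y : Rn n, ((1 + ‖y‖) ^ (n + 1))⁻¹ := integral_nonneg fun ξ => by positivity
  set K := ∫ y : Rn n, ((1 + ‖y‖) ^ (n + 1))⁻¹
  set κ₀ := ‖(((2 * Real.pi) ^ n : ℝ) : ℂ)⁻¹‖
  have hκ₀ : 0 ≤ κ₀ := norm_nonneg _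
  refine ⟨κ₀ * (C * K), by positivity, fun k ζ => ?_⟩
  rw [freqPart, norm_mul]
  calc _ ≤ κ₀ * ∫ y : Rn n, C * lam k ^ (-1 : ℝ) * bracket ζ ^ (-(n + 2 : ℝ)) *
        ((1 + ‖y‖) ^ (n + 1))⁻¹ := by
        refine mul_le_mul_of_nonneg_left ?_ hκ₀
        refine norm_integral_le_of_norm_le (hint.const_mul _) (Filter.Eventually.of_forall fun y => ?_)
        rw [norm_mul, norm_osc, one_mul]
        exact h k ζ y
    _ = _ := by rw [integral_const_mul]; ring

lemma continuous_freqPart (hφ : UnitBump φ) (hχ : Dyadic χ) (hu : ∀ m, Rough m u) (k : ℕ) :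
    Continuous (freqPart φ χ u k) := by
  obtain ⟨C, hC, h⟩ := norm_integral_freqAmp_le hφ hχ hu
  obtain ⟨C', hC', h'⟩ := norm_pderivs_freqAmp_le hφ hχ hu []
  have hcont := continuous_freqAmp hφ hχ (hu 0) k
  have hone : ∀ ζ : Rn n, bracket ζ ^ (-(n + 2 : ℝ)) ≤ 1 := fun ζ =>
    Real.rpow_le_one_of_one_le_of_nonpos (one_le_bracket ζ)
      (by linarith [Nat.cast_nonneg (α := ℝ) n])
  have hl := lam_pos k
  have hslice : ∀ ζ, Continuous fun q : Rn n × Rn n => osc q.1 q.2 * freqAmp φ χ u k ζ q.1 q.2 :=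
    fun ζ => (continuous_osc (by fun_prop) (by fun_prop)).mul
      (hcont.comp (f := fun q : Rn n × Rn n => ((ζ, q.1), q.2)) (by fun_prop))
  refine continuous_const.mul (continuous_of_dominated
    (bound := fun y => C * lam k ^ (-1 : ℝ) * ((1 + ‖y‖) ^ (n + 1))⁻¹) (fun ζ => ?_)
    (fun ζ => Filter.Eventually.of_forall fun y => ?_)
    (integrable_inv_one_add_norm_pow.const_mul _) (Filter.Eventually.of_forall fun y => ?_))
  · have hc : Continuous fun y : Rn n => osc (-y) ζ := continuous_osc (by fun_prop) (by fun_prop)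
    exact (hc.stronglyMeasurable.mul (StronglyMeasurable.integral_prod_right'
      (hslice ζ).stronglyMeasurable)).aestronglyMeasurable
  · rw [norm_mul, norm_osc, one_mul]
    refine (h k ζ y).trans (mul_le_mul_of_nonneg_right ?_ (by positivity))
    exact mul_le_of_le_one_right (by positivity) (hone ζ)
  · refine (continuous_osc (by fun_prop) (by fun_prop)).mul (continuous_of_dominated
      (bound := fun ξ => C' * lam k ^ (-1 : ℝ) * bracket ξ ^ (-(n + 1 : ℝ))) (fun ζ => ?_)
      (fun ζ => Filter.Eventually.of_forall fun ξ => ?_)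
      (integrable_bracket.const_mul _) (Filter.Eventually.of_forall fun ξ => ?_))
    · exact ((hslice ζ).comp (f := fun ξ : Rn n => (y, ξ)) (by fun_prop)).aestronglyMeasurable
    · rw [norm_mul, norm_osc, one_mul]
      have := bracket_pos ξ
      refine (h' k ζ y ξ).trans (mul_le_mul_of_nonneg_right ?_ (by positivity))
      exact mul_le_of_le_one_right (by positivity) (hone ζ)
    · exact continuous_const.mul
        (hcont.comp (f := fun ζ : Rn n => ((ζ, y), ξ)) (by fun_prop))

end Pieces

/-! ### Applying an operator to the sum of the pieces. -/

section Composition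

variable {F : ℕ → Rn n → R3 n → ℂ}

lemma norm_kerJ_le_of_rapid (hF : ∀ m, IsAmp m 0 F) : ∃ C, 0 ≤ C ∧ ∀ k x ξ y,
    ‖kerJ (F k) x ξ y‖ ≤ C * lam k ^ (-1 : ℝ) *
      (bracket ξ ^ (-(n + 1 : ℝ)) * ((1 + ‖x - y‖) ^ (n + 1))⁻¹) := by
  -- The summand `-n/2` cancels the height `h_k ^ n = λ_k ^ (n/2)` of the kernel.
  obtain ⟨C, hC, h⟩ := (hF (-1 + -(n + 1 : ℝ) + -((n : ℝ) / 2))).norm_kerJ_le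
  refine ⟨C * 4 ^ |(-(n + 1 : ℝ))|, by positivity, fun k x ξ y => ?_⟩
  have hl := lam_pos k
  have hb := bracket_pos ξ
  by_cases hξ : ξ ∈ Shell k
  · refine (h k x ξ y).trans ?_
    have hh := hlf_pos k
    have h1 := lam_rpow_le_of_mem_shell hξ (-(n + 1 : ℝ))
    have h2 : ((1 + hlf k * ‖x - y‖) ^ (n + 1))⁻¹ ≤ ((1 + ‖x - y‖) ^ (n + 1))⁻¹ := by
      gcongr
      exact le_mul_of_one_le_left (norm_nonneg _) (one_le_hlf k)
    have e : lam k ^ (-1 + -(n + 1 : ℝ) + -((n : ℝ) / 2)) * hlf k ^ n =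
        lam k ^ (-1 : ℝ) * lam k ^ (-(n + 1 : ℝ)) := by
      rw [hlf_pow, ← Real.rpow_add hl, neg_add_cancel_right, Real.rpow_add hl]
    calc _ = C * (lam k ^ (-1 + -(n + 1 : ℝ) + -((n : ℝ) / 2)) * hlf k ^ n) *
          ((1 + hlf k * ‖x - y‖) ^ (n + 1))⁻¹ := by ring
      _ ≤ C * (lam k ^ (-1 : ℝ) * (4 ^ |(-(n + 1 : ℝ))| * bracket ξ ^ (-(n + 1 : ℝ)))) *
          ((1 + ‖x - y‖) ^ (n + 1))⁻¹ := by rw [e]; gcongr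
      _ = _ := by ring
  · have : kerJ (F k) x ξ y = 0 := by
      simp [kerJ, fun η => (hF 0).supp_xi k y (x, ξ, η) hξ]
    rw [this, norm_zero]
    positivity

lemma norm_opT_le_of_rapid (hF : ∀ m, IsAmp m 0 F) : ∃ C, 0 ≤ C ∧ ∀ k x ξ,
    ‖opT (F k) x ξ‖ ≤ C * lam k ^ (-1 : ℝ) * bracket ξ ^ (-(n + 1 : ℝ)) := by
  obtain ⟨C, hC, h⟩ := (hF (-1 + -(n + 1 : ℝ))).norm_opT_le
  refine ⟨C * 4 ^ |(-(n + 1 : ℝ))|, by positivity, fun k x ξ => ?_⟩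
  have hl := lam_pos k
  have hb := bracket_pos ξ
  by_cases hξ : ξ ∈ Shell k
  · have h1 := lam_rpow_le_of_mem_shell hξ (-(n + 1 : ℝ))
    refine (h k x ξ).trans ?_
    rw [Real.rpow_add hl]
    calc _ ≤ C * (lam k ^ (-1 : ℝ) * (4 ^ |(-(n + 1 : ℝ))| * bracket ξ ^ (-(n + 1 : ℝ)))) := by
          gcongr
      _ = _ := by ring
  · rw [(hF 0).opT_eq_zero hξ, norm_zero]
    positivity

/-- The factor `λ_k^{-1}` makes the integrals of the absolute values summable, which justifies
exchanging sum and integral. -/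
lemma invHat_tsum {g : ℕ → Rn n → ℂ} (hg : ∀ k, Continuous (g k)) {C : ℝ}
    (h : ∀ k ξ, ‖g k ξ‖ ≤ C * lam k ^ (-1 : ℝ) * bracket ξ ^ (-(n + 1 : ℝ))) (x : Rn n) :
    invHat (fun ξ => ∑' k, g k ξ) x = ∑' k, invHat (g k) x := by
  have hb : ∀ k, Integrable fun ξ : Rn n => C * lam k ^ (-1 : ℝ) * bracket ξ ^ (-(n + 1 : ℝ)) :=
    fun k => integrable_bracket.const_mul _
  have hi : ∀ k, Integrable fun ξ => osc x ξ * g k ξ := fun k =>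
    (hb k).mono' ((continuous_osc continuous_const continuous_id).mul (hg k)).aestronglyMeasurable
      (Filter.Eventually.of_forall fun ξ => by rw [norm_mul, norm_osc, one_mul]; exact h k ξ)
  simp only [invHat_eq]
  simp_rw [← tsum_mul_left (a := osc x _)]
  rw [tsum_mul_left, ← integral_tsum_of_summable_integral_norm hi]
  · refine Summable.of_nonneg_of_le (fun k => integral_nonneg fun ξ => norm_nonneg _) (fun k => ?_)
      (summable_lam_inv.mul_left (C * ∫ ξ : Rn n, bracket ξ ^ (-(n + 1 : ℝ))))
    refine (integral_mono (hi k).norm (hb k) fun ξ => ?_).trans (le_of_eq ?_)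
    · dsimp only
      rw [norm_mul, norm_osc, one_mul]
      exact h k ξ
    · rw [integral_const_mul]
      ring

variable {φ : Rn n → ℂ} {χ : ℕ → Rn n → ℂ} {u : Rn n → Rn n → ℂ} {B : Rn n → ℂ} {D : ℝ} {x : Rn n}

lemma invHat_freqPart (hφ : UnitBump φ) (hχ : Dyadic χ) (hu : ∀ m, Rough m u) (hB : Continuous B)
    (hBle : ∀ ζ, ‖B ζ‖ ≤ D * bracket ζ) (hF : ∀ m, IsAmp m 0 F)
    (hFB : ∀ k y ξ η, F k y (x, ξ, η) = smAmp φ χ u k y (x, ξ, η) * B (ξ + η)) (k : ℕ) :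
    invHat (fun ζ => B ζ * freqPart φ χ u k ζ) x = invHat (opT (F k) x) x := by
  obtain ⟨C₁, hC₁, h₁⟩ := norm_pderivs_freqAmp_le hφ hχ hu []
  obtain ⟨C₂, hC₂, h₂⟩ := norm_integral_freqAmp_le hφ hχ hu
  obtain ⟨C₃, hC₃, h₃⟩ := norm_kerJ_le_of_rapid hF
  have hker : ∀ ξ y, ∫ η, osc (x - y) η * (freqAmp φ χ u k (ξ + η) y ξ * B (ξ + η)) =
      kerJ (F k) x ξ y := fun ξ y => by
    rw [kerJ]
    congr 1 with η
    rw [hFB, freqAmp, add_sub_cancel_left]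
    rfl
  have hl := lam_pos k
  have key := integral_rearrange (x := x) (C := (C₁ + C₂) * lam k ^ (-1 : ℝ))
    (C' := C₃ * lam k ^ (-1 : ℝ)) (continuous_freqAmp hφ hχ (hu 0) k) hB hBle
    (fun ζ y ξ => (h₁ k ζ y ξ).trans (by
      have := bracket_pos ξ
      have := bracket_pos ζ
      gcongr
      linarith))
    (fun ζ y => (h₂ k ζ y).trans (by
      have := bracket_pos ζ
      gcongr
      linarith))
    (fun y ξ => by rw [hker]; exact h₃ k x ξ y)
  simp_rw [hker] at key
  have e₁ : ∀ ζ, osc x ζ * (B ζ * freqPart φ χ u k ζ) = (((2 * Real.pi) ^ n : ℝ) : ℂ)⁻¹ *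
      (osc x ζ * (B ζ * ∫ y, osc (-y) ζ * ∫ ξ, osc y ξ * freqAmp φ χ u k ζ y ξ)) := fun ζ => by
    rw [freqPart]
    ring
  have e₂ : ∀ ξ, osc x ξ * opT (F k) x ξ = (((2 * Real.pi) ^ n : ℝ) : ℂ)⁻¹ *
      (osc x ξ * ∫ y, kerJ (F k) x ξ y) := fun ξ => by
    rw [opT]
    ring
  simp_rw [invHat_eq, e₁, e₂]
  rw [integral_const_mul, integral_const_mul, key]

/-- Here `x` is fixed and `B` plays the role of `b(x, ·)`. It is used twice: `B = 1` identifies the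
first image, and the symbol itself gives the second application of the operator. -/
theorem invHat_tsum_freqPart (hφ : UnitBump φ) (hχ : Dyadic χ) (hu : ∀ m, Rough m u)
    (hB : Continuous B) (hBle : ∀ ζ, ‖B ζ‖ ≤ D * bracket ζ) (hF : ∀ m, IsAmp m 0 F)
    (hFB : ∀ k y ξ η, F k y (x, ξ, η) = smAmp φ χ u k y (x, ξ, η) * B (ξ + η)) :
    invHat (fun ζ => B ζ * ∑' k, freqPart φ χ u k ζ) x = invHat (opS F x) x := by
  obtain ⟨C₁, hC₁, h₁⟩ := norm_freqPart_le hφ hχ hu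
  obtain ⟨C₂, hC₂, h₂⟩ := norm_opT_le_of_rapid hF
  have e₁ : (fun ζ => B ζ * ∑' k, freqPart φ χ u k ζ) = fun ζ => ∑' k, B ζ * freqPart φ χ u k ζ := by
    funext ζ
    rw [tsum_mul_left]
  have hcont : ∀ k, Continuous (opT (F k) x) := fun k => continuous_iff_continuousAt.2 fun ξ =>
    (((hF 0).amp1 k).hasFDerivAt_opT (one_le_hlf k) (x, ξ)).continuousAt.comp
      (f := fun ξ => (x, ξ)) (by fun_prop)
  rw [e₁, invHat_tsum (g := fun k ζ => B ζ * freqPart φ χ u k ζ)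
      (fun k => hB.mul (continuous_freqPart hφ hχ hu k)) (C := D * C₁) (fun k ζ => ?_),
    show opS F x = fun ξ => ∑' k, opT (F k) x ξ from rfl,
    invHat_tsum hcont (fun k ξ => h₂ k x ξ)]
  · simp_rw [invHat_freqPart hφ hχ hu hB hBle hF hFB]
  · rw [norm_mul]
    have hb := bracket_pos ζ
    have e : bracket ζ ^ (-(n + 1 : ℝ)) = bracket ζ * bracket ζ ^ (-(n + 2 : ℝ)) := by
      rw [← Real.rpow_one_add' hb.le (by linarith [Nat.cast_nonneg (α := ℝ) n])]
      congr 1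
      ring
    rw [e]
    refine (mul_le_mul (hBle ζ) (h₁ k ζ) (norm_nonneg _) ((norm_nonneg _).trans (hBle ζ))).trans
      (le_of_eq (by ring))

lemma continuous_tsum_freqPart (hφ : UnitBump φ) (hχ : Dyadic χ) (hu : ∀ m, Rough m u) :
    Continuous fun ζ => ∑' k, freqPart φ χ u k ζ := by
  obtain ⟨C, hC, h⟩ := norm_freqPart_le hφ hχ hu
  refine continuous_tsum (continuous_freqPart hφ hχ hu) (summable_lam_inv.mul_left C) fun k ζ =>
    (h k ζ).trans ?_
  have := lam_pos k
  exact mul_le_of_le_one_right (by positivity) (Real.rpow_le_one_of_one_le_of_nonpos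
    (one_le_bracket ζ) (by linarith [Nat.cast_nonneg (α := ℝ) n]))

lemma integrable_tsum_freqPart (hφ : UnitBump φ) (hχ : Dyadic χ) (hu : ∀ m, Rough m u) :
    Integrable fun ζ => ∑' k, freqPart φ χ u k ζ := by
  obtain ⟨C, hC, h⟩ := norm_freqPart_le hφ hχ hu
  refine ((integrable_bracket (n := n)).const_mul (C * ∑' k, lam k ^ (-1 : ℝ))).mono'
    (continuous_tsum_freqPart hφ hχ hu).aestronglyMeasurable (Filter.Eventually.of_forall fun ζ => ?_)
  have hb := bracket_pos ζ
  refine tsum_of_norm_bounded (g := fun k => C * lam k ^ (-1 : ℝ) * bracket ζ ^ (-(n + 1 : ℝ)))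
    ((summable_lam_inv.hasSum.mul_left C).mul_right _) fun k => (h k ζ).trans ?_
  have := lam_pos k
  gcongr
  · exact one_le_bracket ζ
  · linarith

end Composition

/-! ### The exact square of a smoothed operator. -/

section Square

variable {φ : Rn n → ℝ} {ψ : ℕ → Rn n → ℝ} {a : Rn n → Rn n → ℂ}

lemma rough_mul_hat {m : ℝ} (ha : Rough m a) (f : 𝓢(Rn n, ℂ)) (m' : ℝ) :
    Rough m' fun x ξ => a x ξ * hat f ξ := by
  have h : Rough (m' - m) fun _ : Rn n => hat f :=
    rough_of_xi (contDiff_slice_right (rapid_hat f 0).1 0) fun α => by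
      obtain ⟨C, hC, h⟩ := (rapid_hat f).norm_dxi_le α (m' - m - α.length)
      exact ⟨C, hC, fun ξ => h 0 ξ⟩
  have := ha.mul h
  rwa [add_sub_cancel] at this

/-- The square of the operator with symbol `sharp φ ψ a`. -/
theorem op_sharp_op_sharp (hφ : IsCutoff φ) (hψ : IsLittlewoodPaley ψ) (ha : Rough 1 a)
    {f g : 𝓢(Rn n, ℂ)} (hg : ⇑g = op (sharp φ ψ a) f) (x : Rn n) :
    op (sharp φ ψ a) g x = op (opS (sqAmp φ ψ a)) f x := by
  -- Absorbing the Schwartz function `f̂` into the symbol gives it every order, so that all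
  -- integrals converge absolutely.
  set u : Rn n → Rn n → ℂ := fun y ξ => a y ξ * hat f ξ with hu_def
  have hu : ∀ m, Rough m u := rough_mul_hat ha f
  have hb := isSymbol_sharp hφ hψ ha
  have hφ' := hφ.unitBump
  have hχ := hψ.dyadic
  have hmul : ∀ k y p, sharpAmp φ ψ u k y p = hat f p.2.1 * sharpAmp φ ψ a k y p := fun k y p => by
    simp only [smAmp, sepAmp, hu_def]
    ring
  set γ : Rn n → ℂ := fun ζ => ∑' k, freqPart (fun η => (φ η : ℂ)) (fun k ξ => (ψ k ξ : ℂ)) u k ζ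
  have h₁ : invHat γ = g := by
    funext x
    have h := invHat_tsum_freqPart (B := fun _ => 1) (D := 1) (x := x) hφ' hχ hu continuous_const
      (fun ζ => by simpa using one_le_bracket ζ) (fun m => isAmp_smAmp hφ' hχ (hu m))
      (fun k y ξ η => by rw [mul_one])
    simp only [one_mul] at h
    rw [hg, op, sharp_eq_opS]
    refine h.trans (congrArg (invHat · x) (funext fun ξ => ?_))
    rw [opS, opS, ← tsum_mul_right]
    refine tsum_congr fun k => ?_
    have e : sharpAmp φ ψ u k = fun y p => hat f p.2.1 * sharpAmp φ ψ a k y p :=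
      funext fun y => funext fun p => hmul k y p
    exact (congrArg (opT · x ξ) e).trans ((opT_mul_left _ (fun _ => hat f) x ξ).trans (mul_comm _ _))
  -- `γ` is continuous and integrable, and its inverse transform `g` is a Schwartz function, so
  -- Fourier inversion applies.
  have h₂ : hat g = γ := by
    rw [← h₁]
    refine hat_invHat (continuous_tsum_freqPart hφ' hχ hu) (integrable_tsum_freqPart hφ' hχ hu) ?_
    rw [h₁]
    exact g.integrable
  obtain ⟨D, -, hD⟩ := hb.2 [] []
  have h := invHat_tsum_freqPart (B := sharp φ ψ a x) (D := D) (x := x)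
    (F := fun k y p => sharpAmp φ ψ u k y p * sharp φ ψ a p.1 (p.2.1 + (1 : ℝ) • p.2.2)) hφ' hχ hu
    (contDiff_slice_right hb.1 x).continuous (fun ζ => by simpa [dxi, dx, pderivs] using hD x ζ) (fun m => ?_)
    (fun k y ξ η => by rw [one_smul])
  · rw [op, h₂, op]
    refine h.trans (congrArg (invHat · x) (funext fun ξ => ?_))
    rw [opS, opS, ← tsum_mul_right]
    refine tsum_congr fun k => ?_
    rw [show (fun y p => sharpAmp φ ψ u k y p * sharp φ ψ a p.1 (p.2.1 + (1 : ℝ) • p.2.2)) =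
      fun y p => hat f p.2.1 * sqAmp φ ψ a k y p from
      funext fun y => funext fun p => by rw [hmul, sqAmp, mul_assoc], opT_mul_left _ fun _ => hat f,
      mul_comm]
  · have := (isAmp_sharpAmp hφ hψ (hu (m - 1))).mul (jcont_shift hb.1 1) (hb.ampBdd_shift (by simp))
    rwa [sub_add_cancel] at this

lemma op_add {m m' : ℝ} {p q : Rn n → Rn n → ℂ} (hp : IsSymbol m (1 / 2) p)
    (hq : IsSymbol m' (1 / 2) q) (f : 𝓢(Rn n, ℂ)) (x : Rn n) :
    op (fun x ξ => p x ξ + q x ξ) f x = op p f x + op q f x := by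
  simp only [op, invHat_eq]
  rw [← mul_add, ← integral_add ((Rapid.mul hp (rapid_hat f)).integrable x)
    ((Rapid.mul hq (rapid_hat f)).integrable x)]
  congr 2 with ξ
  ring

end Square

end PsiDO

end

/-! ### Assembly of the root, its smoothing and the error. -/

theorem proposition4p5 (n : ℕ) (hn : 2 ≤ n)
    (φ : PsiDO.Rn n → ℝ) (hφ : PsiDO.IsCutoff φ)
    (ψ : ℕ → PsiDO.Rn n → ℝ) (hψ : PsiDO.IsLittlewoodPaley ψ)
    (A : PsiDO.Rn n → PsiDO.Rn n → ℝ)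
    (hA : PsiDO.IsRoughSymbol 2 2 0 (fun x ξ => (A x ξ : ℂ)))
    (hA_nonneg : ∀ x ξ, 0 ≤ A x ξ)
    (hA_ell : PsiDO.IsElliptic 2 (fun x ξ => (A x ξ : ℂ)))
    (hA_hom : PsiDO.IsHomogeneous 2 (fun x ξ => (A x ξ : ℂ))) :
    ∃ (b : PsiDO.Rn n → PsiDO.Rn n → ℝ) (e : PsiDO.Rn n → PsiDO.Rn n → ℂ),
      PsiDO.IsASymbol 2 1 (1 / 2) (fun x ξ => (b x ξ : ℂ)) ∧
      PsiDO.IsElliptic 1 (fun x ξ => (b x ξ : ℂ)) ∧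
      PsiDO.IsSymbol 1 (1 / 2) e ∧
      (∀ f : 𝓢(PsiDO.Rn n, ℂ), ∃ g : 𝓢(PsiDO.Rn n, ℂ),
        (∀ x, g x = PsiDO.op (fun x ξ => (b x ξ : ℂ)) f x) ∧
        ∀ x, PsiDO.op (PsiDO.sharp φ ψ (fun x ξ => (A x ξ : ℂ))) f x =
          PsiDO.op (fun x ξ => (b x ξ : ℂ)) g x + PsiDO.op e f x) ∧
      ∃ a : PsiDO.Rn n → PsiDO.Rn n → ℝ,
        PsiDO.IsAsympHomogeneous 2 1 (1 / 2) (fun x ξ => (b x ξ : ℂ))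
          (fun x ξ => (a x ξ : ℂ)) ∧
        ∀ x ξ : PsiDO.Rn n, 1 ≤ ‖ξ‖ → a x ξ = Real.sqrt (A x ξ) := by
  obtain ⟨a, ha, hsq, hsqrt, hhom, c, hc, hlow⟩ :=
    PsiDO.exists_sqrt_symbol hA.rough hA_nonneg hA_ell hA_hom
  set a' : PsiDO.Rn n → PsiDO.Rn n → ℂ := fun x ξ => (a x ξ : ℂ) with ha'
  -- The smoothing is real already; taking the real part only turns it into a function with values
  -- in `ℝ`.
  have hb : (fun x ξ => (((PsiDO.sharp φ ψ a' x ξ).re : ℝ) : ℂ)) = PsiDO.sharp φ ψ a' :=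
    funext fun x => funext fun ξ => PsiDO.sharp_ofReal hφ ψ a x ξ
  have hE := PsiDO.isSymbol_err hφ hψ ha PsiDO.unitBump_bump
  refine ⟨fun x ξ => (PsiDO.sharp φ ψ a' x ξ).re,
    fun x ξ => PsiDO.opS (PsiDO.errAmp φ ψ a') x ξ - (PsiDO.bump ξ : ℂ), ?_, ?_, hE, fun f => ?_, a, ?_, hsqrt⟩
  · rw [hb]
    exact PsiDO.isASymbol_sharp hφ hψ ha
  · rw [hb]
    exact PsiDO.isElliptic_sharp hφ hψ ha hc hlow
  · obtain ⟨g, hg⟩ := PsiDO.exists_schwartz_op (PsiDO.isSymbol_sharp hφ hψ ha) f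
    rw [hb]
    refine ⟨g, fun x => congrFun hg x, fun x => ?_⟩
    -- Hence the smoothing of `A` is that of `a²` minus the bump, and the bump goes into the error.
    have e : (fun x ξ => (A x ξ : ℂ)) = fun x ξ => a' x ξ * a' x ξ - (PsiDO.bump ξ : ℂ) := by
      funext x ξ
      have := hsq x ξ
      rw [ha', eq_sub_iff_add_eq]
      push_cast [← Complex.ofReal_add, ← Complex.ofReal_mul]
      rw [← this, sq]
    rw [PsiDO.op_sharp_op_sharp hφ hψ ha hg, ← PsiDO.op_add (PsiDO.isAmp_sqAmp hφ hψ ha).isSymbol_opS hE, e,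
      show PsiDO.sharp φ ψ (fun x ξ => a' x ξ * a' x ξ - (PsiDO.bump ξ : ℂ)) = _ from
        funext fun x => funext fun ξ => PsiDO.sharp_sub_eq hφ hψ ha PsiDO.unitBump_bump x ξ]
  · rw [hb]
    exact PsiDO.isAsympHomogeneous_sharp hφ hψ ha hhom
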